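/- Let $D\subset\mathbb R^2$ be a bounded open set with Lipschitz boundary whose exterior $\mathbb R^2\setminus\overline D$ is connected, let $\nu$ be the unit normal on $\partial D$ pointing out of $D$, and let $k\in\mathbb C\setminus\mathbb R_{\le 0}$. Let $\Phi_k(x,y)=\frac i4 H^{(1)}_0(k|x-y|)$, with $H^{(1)}_0$ the principal branch of the Hankel function of the first kind. A function $u\in C^2(\mathbb R^2\setminus\overline D)$ is called an outgoing solution if $\Delta u+k^2u=0$ in $\mathbb R^2\setminus\overline D$, $u$ is of class $H^1$ on every bounded part of $\mathbb R^2\setminus\overline D$, and $$u(x)=\int_{\partial D}\Big\{\frac{\partial\Phi_k(x,y)}{\partial\nu(y)}\,u(y)-\Phi_k(x,y)\,\frac{\partial u}{\partial\nu}(y)\Big\}\,ds(y),\qquad x\in\mathbb R^2\setminus\overline D,$$ where $u|_{\partial D}$ is the trace of $u$ from the exterior and $\frac{\partial u}{\partial\nu}\in H^{-1/2}(\partial D)$ is its normal derivative from the exterior in the sense of Green's first identity (the second part of the integral is a duality pairing). A function $u^\infty:\mathbb S^1\to\mathbb C$ is called a far-field pattern of $u$ if $$u(x)=\frac{e^{ik|x|}}{\sqrt{|x|}}\Big\{u^\infty(\hat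 x)+O\Big(\frac1{|x|}\Big)\Big\},\qquad |x|\to\infty,$$ uniformly in all directions $\hat x=x/|x|\in\mathbb S^1$. Then: 1. Every outgoing solution $u$ has exactly one far-field pattern $u^\infty$. 2. If $u$ is an outgoing solution and $u^\infty$ vanishes on a nonempty open subset of $\mathbb S^1$, then $u=0$ in $\mathbb R^2\setminus\overline D$. 3. Consequently, outgoing solutions and their far-field patterns are in one-to-one correspondence: if two outgoing solutions $u_1,u_2$ (for the same $D$ and $k$) satisfy $u_1^\infty=u_2^\infty$ on $\mathbb S^1$, then $u_1=u_2$ in $\mathbb R^2\setminus\overline D$. This includes complex wavenumbers with $\operatorname{Im}k<0$. -/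

import Mathlib

noncomputable section

open MeasureTheory Filter Topology
open scoped ContDiff Laplacian

namespace ExteriorHelmholtz

/-- The Euclidean plane. -/
abbrev Plane : Type := EuclideanSpace ℝ (Fin 2)

/-! ### The obstacle -/

/-- The open set `D` has a Lipschitz boundary: near every boundary point, in suitable orthonormal
coordinates, `D` is the set of points lying above the graph of a Lipschitz function. -/
def HasLipschitzBoundary (D : Set Plane) : Prop :=
  ∀ p ∈ frontier D, ∃ (e : Plane ≃ₗᵢ[ℝ] Plane) (K : NNReal) (γ : ℝ → ℝ) (ε : ℝ),
    LipschitzWith K γ ∧ 0 < ε ∧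
      ∀ x ∈ Metric.ball p ε, (x ∈ D ↔ γ (e x 0) < e x 1)

/-- An obstacle: a bounded open set with Lipschitz boundary and connected exterior. -/
structure IsObstacle (D : Set Plane) : Prop where
  isOpen : IsOpen D
  bounded : Bornology.IsBounded D
  lipschitz : HasLipschitzBoundary D
  connected_exterior : IsConnected (closure D)ᶜ

/-- The arc length measure `ds` on the boundary of `D`. -/
def boundaryMeasure (D : Set Plane) : Measure Plane :=
  (Measure.hausdorffMeasure 1).restrict (frontier D)

/-- `n` is the unit outward normal to `D` at `y`: it has norm one and, to first order at `y`,
the set `D` is the half-plane `{z | ⟪z - y, n⟫ < 0}`. Such an `n` is unique. -/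
def IsOutwardNormalAt (D : Set Plane) (y n : Plane) : Prop :=
  ‖n‖ = 1 ∧ ∀ ε > 0, ∀ᶠ z in 𝓝 y,
    (inner ℝ (z - y) n < -ε * ‖z - y‖ → z ∈ D) ∧
    (ε * ‖z - y‖ < inner ℝ (z - y) n → z ∉ D)

/-- `ν` is the (almost everywhere defined) field of unit outward normals on the boundary of `D`. -/
def IsOutwardNormalField (D : Set Plane) (ν : Plane → Plane) : Prop :=
  Measurable ν ∧ ∀ᵐ y ∂boundaryMeasure D, IsOutwardNormalAt D y (ν y)

/-! ### The fundamental solution -/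

/-- The Bessel function of the first kind of order zero. -/
def besselJ0 (z : ℂ) : ℂ :=
  ∑' m : ℕ, (-1) ^ m / (m.factorial : ℂ) ^ 2 * (z / 2) ^ (2 * m)

/-- The principal branch of the Bessel function of the second kind of order zero. -/
def besselY0 (z : ℂ) : ℂ :=
  2 / (Real.pi : ℂ) * (Complex.log (z / 2) + (Real.eulerMascheroniConstant : ℂ)) * besselJ0 z
    - 2 / (Real.pi : ℂ) *
      ∑' m : ℕ, (-1) ^ m * ((harmonic m : ℚ) : ℂ) / (m.factorial : ℂ) ^ 2 * (z / 2) ^ (2 * m)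

/-- The principal branch of the Hankel function of the first kind of order zero. -/
def hankelH0 (z : ℂ) : ℂ := besselJ0 z + Complex.I * besselY0 z

/-- The fundamental solution `Φ_k(x, y) = (i / 4) H₀⁽¹⁾(k |x - y|)` of the Helmholtz equation. -/
def fundamentalSolution (k : ℂ) (x y : Plane) : ℂ :=
  Complex.I / 4 * hankelH0 (k * (‖x - y‖ : ℂ))

/-! ### Solutions of the Helmholtz equation in the exterior and their Cauchy data -/

/-- `u` is a `C²` solution of the Helmholtz equation in the exterior of `D`, of class `H¹` on every
bounded part of the exterior. The values of `u` on `closure D` are irrelevant. -/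
structure IsExteriorSolution (D : Set Plane) (k : ℂ) (u : Plane → ℂ) : Prop where
  contDiffOn : ContDiffOn ℝ 2 u (closure D)ᶜ
  helmholtz : ∀ x ∈ (closure D)ᶜ, Δ u x + k ^ 2 * u x = 0
  memLp : ∀ R : ℝ, MemLp u 2 (volume.restrict ((closure D)ᶜ ∩ Metric.ball 0 R))
  memLp_fderiv : ∀ R : ℝ,
    MemLp (fderiv ℝ u) 2 (volume.restrict ((closure D)ᶜ ∩ Metric.ball 0 R))

/-- Smooth compactly supported functions on the whole plane. -/
def IsTestFunction (φ : Plane → ℂ) : Prop :=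
  ContDiff ℝ ∞ φ ∧ HasCompactSupport φ

/-- `g` is the trace of `u` on the boundary of `D` from the exterior: the `L²` limit of the boundary
values of smooth functions that converge to `u` in `H¹` on every bounded part of the exterior. -/
def IsExteriorTrace (D : Set Plane) (u g : Plane → ℂ) : Prop :=
  MemLp g 2 (boundaryMeasure D) ∧
  ∃ φ : ℕ → Plane → ℂ, (∀ n, IsTestFunction (φ n)) ∧
    (∀ R : ℝ,
      Tendsto (fun n => eLpNorm (fun x => φ n x - u x) 2
        (volume.restrict ((closure D)ᶜ ∩ Metric.ball 0 R))) atTop (𝓝 0) ∧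
      Tendsto (fun n => eLpNorm (fun x => fderiv ℝ (φ n) x - fderiv ℝ u x) 2
        (volume.restrict ((closure D)ᶜ ∩ Metric.ball 0 R))) atTop (𝓝 0)) ∧
    Tendsto (fun n => eLpNorm (fun y => φ n y - g y) 2 (boundaryMeasure D)) atTop (𝓝 0)

/-- The bilinear product `∇u · ∇φ` (no complex conjugation). -/
def gradDot (u φ : Plane → ℂ) (x : Plane) : ℂ :=
  ∑ i : Fin 2,
    fderiv ℝ u x (EuclideanSpace.single i 1) * fderiv ℝ φ x (EuclideanSpace.single i 1)

/-- `h` is the exterior normal derivative `∂u/∂ν` on the boundary of `D` (with `ν` pointing out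
of `D`) of a solution `u` of the Helmholtz equation, in the usual `H^{-1/2}` sense: the functional
`h φ = ∫_{∂D} (∂u/∂ν) φ ds` on boundary functions given by Green's first identity. -/
def IsExteriorNormalDerivative (D : Set Plane) (k : ℂ) (u : Plane → ℂ)
    (h : (frontier D → ℂ) → ℂ) : Prop :=
  ∀ φ : Plane → ℂ, IsTestFunction φ →
    h (fun y => φ y) =
      -∫ x in (closure D)ᶜ, (gradDot u φ x - k ^ 2 * u x * φ x)

/-- `u` is an outgoing solution: it is a solution in the exterior of `D` that is given there by
Green's representation
`u(x) = ∫_{∂D} {∂Φ_k(x,y)/∂ν(y) u(y) - Φ_k(x,y) ∂u/∂ν(y)} ds(y)`. -/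
def IsOutgoing (D : Set Plane) (k : ℂ) (u : Plane → ℂ) : Prop :=
  IsExteriorSolution D k u ∧
  ∃ (ν : Plane → Plane) (g : Plane → ℂ) (h : (frontier D → ℂ) → ℂ),
    IsOutwardNormalField D ν ∧ IsExteriorTrace D u g ∧ IsExteriorNormalDerivative D k u h ∧
    ∀ x ∈ (closure D)ᶜ,
      u x = (∫ y, fderiv ℝ (fundamentalSolution k x) y (ν y) * g y ∂boundaryMeasure D)
        - h (fun y => fundamentalSolution k x y)

/-! ### The far-field pattern -/

/-- `w` is the far-field pattern of `u`:
`u(x) = e^{ik|x|} / √|x| * (w(x/|x|) + O(1/|x|))` as `|x| → ∞`, uniformly in all directions. -/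
def IsFarField (k : ℂ) (u : Plane → ℂ) (w : Metric.sphere (0 : Plane) 1 → ℂ) : Prop :=
  ∃ C R : ℝ, 0 < R ∧ ∀ r : ℝ, R ≤ r → ∀ θ : Metric.sphere (0 : Plane) 1,
    ∃ ρ : ℂ, ‖ρ‖ ≤ C / r ∧
      u (r • (θ : Plane)) =
        Complex.exp (Complex.I * k * (r : ℂ)) / (Real.sqrt r : ℂ) * (w θ + ρ)

end ExteriorHelmholtz

end

noncomputable section

open MeasureTheory Filter Topology
open scoped ContDiff Laplacian

namespace ExteriorHelmholtz

/-! ### Power series of the Bessel functions -/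

/-! Everything rests on an exact plane wave formula for the Hankel function that is insensitive to
the sign of `Im k`. Since `k` is off the cut, `λ = √k` has positive real part. There is a path of
complex unit vectors `(dirC s, dirS s)`, `s ∈ ℝ`, passing through `(1, 0)` at `s = 0`, along which
`i k dirC s = i k - λ s²`. Superposing the waves along it gives `π i H₀(kr) = e^{ikr} ∫ e^{-λ r s²}
dens s ds` for `r > 0` (`hankelH0_eq_besselIntegral`), an absolutely convergent integral. Both sides
solve Bessel's equation, and their difference tends to `0` as `r → 0⁺`; only the zero solution does
so, because any solution independent of `J₀` is logarithmically singular
(`IsBesselPair.eq_zero_of_tendsto`). The behaviour at `0` is read off from the Laplace transform of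
the logarithm, which is where Euler's constant appears.

The superposition is rotation invariant within a cone (`integral_planeWave_eq_of_sq_add_sq`). For `x
= rθ` far away, `Φ(x, y)` may therefore be expanded about the fixed direction `θ` for all `y` in a
ball. By Fubini, a potential of compactly supported sources becomes a Gaussian integral over the
path of one function, the amplitude of the sources at complex directions
(`exists_potential_eq_integral`). Symmetrising in `s` and bounding second differences gives the far
field with error `O(1/r)`; the pattern is a nonzero multiple of the amplitude at the real direction
`θ` (`exists_norm_potential_sub_le`).

The amplitude at `(cos t, sin t)` is entire in `t`. If the pattern vanishes on an arc, the amplitude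
vanishes on the whole complex circle, hence along every path, and the exact formula makes the
potential zero outside a ball (`exists_potential_eq_zero`). This replaces Rellich's lemma.
Analyticity along real lines carries the zero through the connected exterior
(`IsPotentialAround.eq_zero`).

An outgoing solution is brought to this form by evaluating its normal derivative functional on a
cut-off fundamental solution. Green's identity then turns the pairing into a volume integral over a
thin layer around the obstacle (`IsOutgoing.isPotentialAround`). Potentials can be subtracted, so
the uniqueness statement follows from the vanishing statement. -/

lemma summable_mul_pow_of_le_factorial {a : ℕ → ℂ} {C : ℝ}
    (ha : ∀ m, ‖a m‖ ≤ C / m.factorial) (w : ℂ) : Summable fun m => a m * w ^ m := by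
  refine Summable.of_norm_bounded ((Real.summable_pow_div_factorial ‖w‖).mul_left C) fun m => ?_
  rw [norm_mul, norm_pow]
  calc ‖a m‖ * ‖w‖ ^ m ≤ C / m.factorial * ‖w‖ ^ m := by gcongr; exact ha m
    _ = _ := by ring

lemma hasDerivAt_tsum_mul_pow {a : ℕ → ℂ} {C : ℝ}
    (ha : ∀ m, ‖a m‖ ≤ C / m.factorial) (w : ℂ) :
    HasDerivAt (fun z : ℂ => ∑' m, a m * z ^ m) (∑' m : ℕ, ((m : ℂ) + 1) * a (m + 1) * w ^ m) w := by
  set R : ℝ := ‖w‖ + 1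
  have hR : 0 ≤ R := by positivity
  have hu : Summable fun m : ℕ => ‖a m‖ * (m * R ^ (m - 1)) := by
    rw [← summable_nat_add_iff 1]
    refine Summable.of_nonneg_of_le (fun m => by positivity) (fun m => ?_)
      ((Real.summable_pow_div_factorial R).mul_left C)
    have h := ha (m + 1)
    rw [Nat.factorial_succ] at h
    push_cast at h ⊢
    have hm : (0 : ℝ) < m.factorial := by positivity
    calc ‖a (m + 1)‖ * (((m : ℝ) + 1) * R ^ (m + 1 - 1))
        ≤ C / ((m + 1) * m.factorial) * (((m : ℝ) + 1) * R ^ (m + 1 - 1)) := by gcongr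
      _ = C * (R ^ m / m.factorial) := by
        rw [Nat.add_sub_cancel]; field_simp
  have hw : w ∈ Metric.ball (0 : ℂ) R := by simp [R]
  have key := hasDerivAt_tsum_of_isPreconnected (g := fun m (z : ℂ) => a m * z ^ m)
    (g' := fun m z => a m * (m * z ^ (m - 1))) hu Metric.isOpen_ball
    (convex_ball (0 : ℂ) R).isPreconnected
    (fun n y _ => (hasDerivAt_pow n y).const_mul (a n))
    (fun n y hy => by
      rw [norm_mul, norm_mul, norm_pow, Complex.norm_natCast]
      have : ‖y‖ ≤ R := by simpa using (Metric.mem_ball.1 hy).le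
      gcongr) hw (summable_mul_pow_of_le_factorial ha w) hw
  refine key.congr_deriv ?_
  have hs : Summable fun m : ℕ => a m * (m * w ^ (m - 1)) := by
    refine Summable.of_norm_bounded hu fun m => ?_
    rw [norm_mul, norm_mul, norm_pow, Complex.norm_natCast]
    have : ‖w‖ ≤ R := by simp [R]
    gcongr
  rw [hs.tsum_eq_zero_add]
  simp only [Nat.cast_zero, zero_mul, mul_zero, zero_add, Nat.add_sub_cancel]
  exact tsum_congr fun m => by push_cast; ring

/-- The left side is the Euler operator `w d/dw`, which acts diagonally on powers. With it Bessel's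
equation needs only first derivatives of power series. -/
lemma mul_tsum_succ_mul_pow {a : ℕ → ℂ} {C : ℝ}
    (ha : ∀ m : ℕ, ‖(m : ℂ) * a m‖ ≤ C / m.factorial) (w : ℂ) :
    w * ∑' m : ℕ, ((m : ℂ) + 1) * a (m + 1) * w ^ m = ∑' m : ℕ, ((m : ℂ) * a m) * w ^ m := by
  rw [(summable_mul_pow_of_le_factorial ha w).tsum_eq_zero_add, ← tsum_mul_left]
  simp only [Nat.cast_zero, zero_mul, zero_add]
  exact tsum_congr fun m => by push_cast; ring

/-- The coefficients of `J₀` in powers of `(z / 2) ^ 2`. -/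
def coeffJ (m : ℕ) : ℂ := (-1) ^ m / (m.factorial : ℂ) ^ 2

/-- The coefficients of the entire part of `Y₀` in powers of `(z / 2) ^ 2`. -/
def coeffY (m : ℕ) : ℂ := (-1) ^ m * ((harmonic m : ℚ) : ℂ) / (m.factorial : ℂ) ^ 2

/-- This is the equation `(w J')' = -J` in the variable `w = z² / 4`, read off coefficient by
coefficient. -/
lemma sq_succ_mul_coeffJ (m : ℕ) : ((m : ℂ) + 1) ^ 2 * coeffJ (m + 1) = -coeffJ m := by
  have : (m.factorial : ℂ) ≠ 0 := by exact_mod_cast m.factorial_ne_zero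
  have h2 : (m : ℂ) + 1 ≠ 0 := by exact_mod_cast m.succ_ne_zero
  simp only [coeffJ, Nat.factorial_succ, pow_succ]
  push_cast
  field_simp

/-- The extra term comes from the increment `1 / (m + 1)` of the harmonic numbers. In Bessel's
equation it cancels the cross term produced by the factor `log` in front of `J₀`. -/
lemma sq_succ_mul_coeffY (m : ℕ) :
    ((m : ℂ) + 1) ^ 2 * coeffY (m + 1) = -coeffY m + ((m : ℂ) + 1) * coeffJ (m + 1) := by
  have : (m.factorial : ℂ) ≠ 0 := by exact_mod_cast m.factorial_ne_zero
  have h2 : (m : ℂ) + 1 ≠ 0 := by exact_mod_cast m.succ_ne_zero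
  simp only [coeffJ, coeffY, Nat.factorial_succ, pow_succ, harmonic_succ]
  push_cast
  field_simp
  ring

lemma norm_coeffJ (m : ℕ) : ‖coeffJ m‖ = 1 / (m.factorial : ℝ) ^ 2 := by
  simp [coeffJ]

lemma harmonic_le_self (m : ℕ) : harmonic m ≤ m := by
  induction m with
  | zero => simp
  | succ n ih =>
    rw [harmonic_succ]
    push_cast
    gcongr
    exact inv_le_one_of_one_le₀ (by linarith [(Nat.cast_nonneg n : (0 : ℚ) ≤ n)])

lemma norm_coeffY_le (m : ℕ) : ‖coeffY m‖ ≤ m / (m.factorial : ℝ) ^ 2 := by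
  have h0 : (0 : ℝ) ≤ ((harmonic m : ℚ) : ℝ) := by
    rcases Nat.eq_zero_or_pos m with rfl | h
    · simp
    · exact_mod_cast (harmonic_pos h.ne').le
  have h1 : ((harmonic m : ℚ) : ℝ) ≤ m := by exact_mod_cast harmonic_le_self m
  have h2 : ‖((harmonic m : ℚ) : ℂ)‖ = ((harmonic m : ℚ) : ℝ) := by
    rw [← Complex.ofReal_ratCast, Complex.norm_real, Real.norm_of_nonneg h0]
  rw [coeffY, norm_div, norm_mul, h2]
  simp only [norm_pow, norm_neg, norm_one, one_pow, one_mul, Complex.norm_natCast]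
  gcongr

lemma cast_le_factorial (m : ℕ) : (m : ℝ) ≤ m.factorial := by
  exact_mod_cast Nat.self_le_factorial m

lemma sq_le_two_mul_factorial (m : ℕ) : (m : ℝ) ^ 2 ≤ 2 * m.factorial := by
  rcases m with _ | m
  · simp
  · rw [Nat.factorial_succ]
    push_cast
    have h : ((m : ℝ) + 1) ≤ 2 * m.factorial := by
      have h1 := cast_le_factorial m
      have h2 : (1 : ℝ) ≤ m.factorial := by exact_mod_cast Nat.one_le_iff_ne_zero.2 m.factorial_ne_zero
      linarith
    nlinarith [(Nat.cast_nonneg m : (0 : ℝ) ≤ m)]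

lemma norm_coeffJ_le (m : ℕ) : ‖coeffJ m‖ ≤ 1 / m.factorial := by
  rw [norm_coeffJ]
  have h2 : (1 : ℝ) ≤ m.factorial := by exact_mod_cast Nat.one_le_iff_ne_zero.2 m.factorial_ne_zero
  gcongr
  nlinarith

lemma norm_mul_coeffJ_le (m : ℕ) : ‖(m : ℂ) * coeffJ m‖ ≤ 1 / m.factorial := by
  have h0 : (0 : ℝ) < m.factorial := by positivity
  rw [norm_mul, norm_coeffJ, Complex.norm_natCast, mul_one_div, div_le_div_iff₀ (by positivity) h0]
  nlinarith [cast_le_factorial m]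

lemma norm_coeffY_le' (m : ℕ) : ‖coeffY m‖ ≤ 1 / m.factorial := by
  have h0 : (0 : ℝ) < m.factorial := by positivity
  refine (norm_coeffY_le m).trans ?_
  rw [div_le_div_iff₀ (by positivity) h0]
  nlinarith [cast_le_factorial m]

lemma norm_mul_coeffY_le (m : ℕ) : ‖(m : ℂ) * coeffY m‖ ≤ 2 / m.factorial := by
  have h0 : (0 : ℝ) < m.factorial := by positivity
  rw [norm_mul, Complex.norm_natCast]
  calc (m : ℝ) * ‖coeffY m‖ ≤ m * (m / (m.factorial : ℝ) ^ 2) := by gcongr; exact norm_coeffY_le m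
    _ = (m : ℝ) ^ 2 / (m.factorial : ℝ) ^ 2 := by ring
    _ ≤ _ := by
      rw [div_le_div_iff₀ (by positivity) h0]
      nlinarith [sq_le_two_mul_factorial m]

/-- `J₀(z)` as a function of `z ^ 2 / 4`. -/
def seriesJ (w : ℂ) : ℂ := ∑' m, coeffJ m * w ^ m

/-- The entire part of `Y₀(z)` as a function of `z ^ 2 / 4`. -/
def seriesY (w : ℂ) : ℂ := ∑' m, coeffY m * w ^ m

/-- The derivative of `seriesJ`. -/
def seriesJ' (w : ℂ) : ℂ := ∑' m : ℕ, ((m : ℂ) + 1) * coeffJ (m + 1) * w ^ m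

/-- The derivative of `seriesY`. -/
def seriesY' (w : ℂ) : ℂ := ∑' m : ℕ, ((m : ℂ) + 1) * coeffY (m + 1) * w ^ m

lemma hasDerivAt_seriesJ (w : ℂ) : HasDerivAt seriesJ (seriesJ' w) w :=
  hasDerivAt_tsum_mul_pow norm_coeffJ_le w

lemma hasDerivAt_seriesY (w : ℂ) : HasDerivAt seriesY (seriesY' w) w :=
  hasDerivAt_tsum_mul_pow norm_coeffY_le' w

lemma hasDerivAt_mul_seriesJ' (w : ℂ) :
    HasDerivAt (fun z => z * seriesJ' z) (-seriesJ w) w := by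
  have h := hasDerivAt_tsum_mul_pow norm_mul_coeffJ_le w
  have h1 : (fun z => z * seriesJ' z) = fun z => ∑' m : ℕ, ((m : ℂ) * coeffJ m) * z ^ m :=
    funext fun z => mul_tsum_succ_mul_pow norm_mul_coeffJ_le z
  rw [h1]
  refine h.congr_deriv ?_
  rw [seriesJ, ← tsum_neg]
  refine tsum_congr fun m => ?_
  have := sq_succ_mul_coeffJ m
  push_cast
  linear_combination w ^ m * this

lemma hasDerivAt_mul_seriesY' (w : ℂ) :
    HasDerivAt (fun z => z * seriesY' z) (-seriesY w + seriesJ' w) w := by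
  have h := hasDerivAt_tsum_mul_pow norm_mul_coeffY_le w
  have h1 : (fun z => z * seriesY' z) = fun z => ∑' m : ℕ, ((m : ℂ) * coeffY m) * z ^ m :=
    funext fun z => mul_tsum_succ_mul_pow norm_mul_coeffY_le z
  rw [h1]
  refine h.congr_deriv ?_
  have hJ : Summable fun m : ℕ => ((m : ℂ) + 1) * coeffJ (m + 1) * w ^ m := by
    refine summable_mul_pow_of_le_factorial (C := 1) (fun m => ?_) w
    have := norm_mul_coeffJ_le (m + 1)
    push_cast at this
    refine this.trans ?_
    gcongr
    simp
  rw [seriesY, seriesJ', ← tsum_neg,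
    ← (summable_mul_pow_of_le_factorial norm_coeffY_le' w).neg.tsum_add hJ]
  refine tsum_congr fun m => ?_
  have := sq_succ_mul_coeffY m
  push_cast
  linear_combination w ^ m * this

lemma seriesJ_zero : seriesJ 0 = 1 := by
  rw [seriesJ, tsum_eq_single 0 (fun m hm => by simp [hm])]
  simp [coeffJ]

lemma seriesY_zero : seriesY 0 = 0 := by
  rw [seriesY, tsum_eq_single 0 (fun m hm => by simp [hm])]
  simp [coeffY]

lemma besselJ0_eq (z : ℂ) : besselJ0 z = seriesJ ((z / 2) ^ 2) :=
  tsum_congr fun m => by rw [coeffJ, pow_mul]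

lemma besselY0_eq (z : ℂ) : besselY0 z =
    2 / (Real.pi : ℂ) * ((Complex.log (z / 2) + (Real.eulerMascheroniConstant : ℂ)) *
      seriesJ ((z / 2) ^ 2) - seriesY ((z / 2) ^ 2)) := by
  have : seriesY ((z / 2) ^ 2) = ∑' m : ℕ, (-1) ^ m * ((harmonic m : ℚ) : ℂ) /
      (m.factorial : ℂ) ^ 2 * (z / 2) ^ (2 * m) :=
    tsum_congr fun m => by rw [coeffY, pow_mul]
  rw [besselY0, besselJ0_eq, this]
  ring

/-- The function `Ψ` such that the fundamental solution is `Ψ(|x - y| ^ 2)`. -/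
def radialProfile (k Q : ℂ) : ℂ :=
  Complex.I / 4 * (seriesJ (k ^ 2 * Q / 4) + Complex.I * (2 / (Real.pi : ℂ) *
    ((Complex.log k - Complex.log 2 + Complex.log Q / 2 + (Real.eulerMascheroniConstant : ℂ)) *
      seriesJ (k ^ 2 * Q / 4) - seriesY (k ^ 2 * Q / 4))))

lemma log_mul_div_two {k : ℂ} (hk : k ≠ 0) {r : ℝ} (hr : 0 < r) :
    Complex.log (k * r / 2) = Complex.log k - Complex.log 2 + Complex.log r := by
  have h : k * (r : ℂ) / 2 = ((r / 2 : ℝ) : ℂ) * k := by push_cast; ring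
  rw [h, Complex.log_ofReal_mul (by positivity) hk, Real.log_div hr.ne' two_ne_zero,
    ← Complex.ofReal_log hr.le]
  have h2 : Complex.log 2 = (Real.log 2 : ℂ) := by
    rw [Complex.ofReal_log (by norm_num)]; norm_num
  rw [h2]
  push_cast
  ring

lemma radialProfile_sq {k : ℂ} (hk : k ≠ 0) {r : ℝ} (hr : 0 < r) :
    radialProfile k ((r : ℂ) ^ 2) = Complex.I / 4 * hankelH0 (k * r) := by
  have h1 : k ^ 2 * (r : ℂ) ^ 2 / 4 = (k * r / 2) ^ 2 := by ring
  have h2 : Complex.log ((r : ℂ) ^ 2) / 2 = Complex.log r := by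
    rw [← Complex.ofReal_pow, ← Complex.ofReal_log (by positivity), ← Complex.ofReal_log hr.le,
      Real.log_pow]
    push_cast
    ring
  rw [radialProfile, hankelH0, besselJ0_eq, besselY0_eq, h1, h2, log_mul_div_two hk hr]

lemma fundamentalSolution_eq_radialProfile {k : ℂ} (hk : k ≠ 0) {x y : Plane} (h : x ≠ y) :
    fundamentalSolution k x y = radialProfile k ((‖x - y‖ : ℂ) ^ 2) :=
  (radialProfile_sq hk (norm_pos_iff.2 (sub_ne_zero.2 h))).symm

/-- In the squared distance, unlike the distance, the points of a complexified line enter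
polynomially. Holomorphy in this variable is what later gives analyticity of potentials along lines.
-/
lemma differentiableOn_radialProfile (k : ℂ) :
    DifferentiableOn ℂ (radialProfile k) Complex.slitPlane := by
  have hJ : Differentiable ℂ seriesJ := fun w => (hasDerivAt_seriesJ w).differentiableAt
  have hY : Differentiable ℂ seriesY := fun w => (hasDerivAt_seriesY w).differentiableAt
  have hJ' : Differentiable ℂ fun Q : ℂ => seriesJ (k ^ 2 * Q / 4) := hJ.comp (by fun_prop)
  have hY' : Differentiable ℂ fun Q : ℂ => seriesY (k ^ 2 * Q / 4) := hY.comp (by fun_prop)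
  intro Q hQ
  have hl : DifferentiableAt ℂ Complex.log Q := Complex.differentiableAt_log hQ
  have := hJ' Q
  have := hY' Q
  unfold radialProfile
  refine DifferentiableAt.differentiableWithinAt ?_
  fun_prop

/-! ### Bessel's differential equation -/

/-- `f` solves `(r f')' = -k² r f` on the positive half-line, with flux `p = r f'`. -/
def IsBesselPair (k : ℂ) (f p : ℝ → ℂ) : Prop :=
  ∀ r : ℝ, 0 < r → HasDerivAt f (p r / r) r ∧ HasDerivAt p (-k ^ 2 * r * f r) r

lemma hasDerivAt_scaled_sq (k : ℂ) (r : ℝ) :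
    HasDerivAt (fun r : ℝ => (k * (r : ℂ) / 2) ^ 2) (k ^ 2 * r / 2) r := by
  have h := (((hasDerivAt_id r).ofReal_comp.const_mul k).div_const 2).pow 2
  refine h.congr_deriv ?_
  simp
  ring

lemma isBesselPair_seriesJ (k : ℂ) :
    IsBesselPair k (fun r => seriesJ ((k * r / 2) ^ 2))
      (fun r => 2 * ((k * r / 2) ^ 2 * seriesJ' ((k * r / 2) ^ 2))) := by
  intro r hr
  have hr' : (r : ℂ) ≠ 0 := by exact_mod_cast hr.ne'
  refine ⟨((hasDerivAt_seriesJ _).comp r (hasDerivAt_scaled_sq k r)).congr_deriv ?_,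
    (((hasDerivAt_mul_seriesJ' _).comp r (hasDerivAt_scaled_sq k r)).const_mul 2).congr_deriv ?_⟩
  · field_simp
  · ring

lemma isBesselPair_hankel {k : ℂ} (hk : k ≠ 0) :
    ∃ p, IsBesselPair k (fun r => hankelH0 (k * r)) p := by
  set J : ℝ → ℂ := fun r => seriesJ ((k * r / 2) ^ 2) with hJ
  set pJ : ℝ → ℂ := fun r => 2 * ((k * r / 2) ^ 2 * seriesJ' ((k * r / 2) ^ 2)) with hpJ
  set T : ℝ → ℂ := fun r => seriesY ((k * r / 2) ^ 2) with hT
  set pT : ℝ → ℂ := fun r => 2 * ((k * r / 2) ^ 2 * seriesY' ((k * r / 2) ^ 2)) with hpT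
  set l : ℝ → ℂ := fun r => Complex.log k - Complex.log 2 + ((Real.log r : ℝ) : ℂ)
    + (Real.eulerMascheroniConstant : ℂ) with hl
  set c : ℂ := Complex.I * (2 / (Real.pi : ℂ))
  -- The flux is `r` times the derivative of `J + c (l J - T)`; the bare `J` inside the bracket
  -- comes from `r l' = 1`.
  refine ⟨fun r => pJ r + c * (J r + l r * pJ r - pT r), fun r hr => ?_⟩
  have hr' : (r : ℂ) ≠ 0 := by exact_mod_cast hr.ne'
  have h1 : HasDerivAt J (pJ r / r) r := (isBesselPair_seriesJ k r hr).1
  have h2 : HasDerivAt pJ (-k ^ 2 * r * J r) r := (isBesselPair_seriesJ k r hr).2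
  have h3 : HasDerivAt T (pT r / r) r :=
    ((hasDerivAt_seriesY _).comp r (hasDerivAt_scaled_sq k r)).congr_deriv (by
      simp only [hpT]; field_simp)
  have h4 : HasDerivAt pT (-k ^ 2 * r * T r + 2 * pJ r / r) r :=
    (((hasDerivAt_mul_seriesY' _).comp r (hasDerivAt_scaled_sq k r)).const_mul 2).congr_deriv (by
      simp only [hpJ, hT]; field_simp)
  have h5 : HasDerivAt l (1 / r) r := by
    have := (((Real.hasDerivAt_log hr.ne').ofReal_comp.const_add
      (Complex.log k - Complex.log 2)).add_const (Real.eulerMascheroniConstant : ℂ))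
    refine this.congr_deriv ?_
    push_cast
    ring
  have hH : ∀ s : ℝ, 0 < s → hankelH0 (k * s) = J s + c * (l s * J s - T s) := by
    intro s hs
    rw [hankelH0, besselJ0_eq, besselY0_eq, log_mul_div_two hk hs, ← Complex.ofReal_log hs.le]
    simp only [hJ, hT, hl, c]
    ring
  constructor
  · have h := h1.add (((h5.mul h1).sub h3).const_mul c)
    refine (h.congr_of_eventuallyEq ?_).congr_deriv ?_
    · filter_upwards [eventually_gt_nhds hr] with s hs
      simpa using hH s hs
    · field_simp
  · have h := h2.add (((h1.add (h5.mul h2)).sub h4).const_mul c)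
    refine h.congr_deriv ?_
    rw [show (fun r : ℝ => hankelH0 (k * r)) r = _ from hH r hr]
    field_simp
    ring

lemma eq_of_hasDerivAt_zero_Ioo {f : ℝ → ℂ} {a b : ℝ}
    (hf : ∀ r ∈ Set.Ioo a b, HasDerivAt f 0 r) {r s : ℝ} (hr : r ∈ Set.Ioo a b)
    (hs : s ∈ Set.Ioo a b) : f r = f s :=
  isOpen_Ioo.is_const_of_deriv_eq_zero isPreconnected_Ioo
    (fun x hx => (hf x hx).differentiableAt.differentiableWithinAt)
    (fun x hx => (hf x hx).deriv) hr hs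

/-- Away from `r = 0` the pair solves a linear first order system with bounded coefficients, so
uniqueness for Lipschitz ODEs applies on `[a, r]`. -/
lemma IsBesselPair.eq_zero_of_initial {k : ℂ} {f p : ℝ → ℂ} (h : IsBesselPair k f p)
    {a : ℝ} (ha : 0 < a) (hf : f a = 0) (hp : p a = 0) {r : ℝ} (hr : a ≤ r) : f r = 0 := by
  set v : ℝ → ℂ × ℂ → ℂ × ℂ := fun t x => (x.2 / t, -k ^ 2 * t * x.1) with hv
  set K : NNReal := ⟨max (1 / a) (‖k‖ ^ 2 * r), le_max_of_le_left (by positivity)⟩ with hK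
  have hLip : ∀ t ∈ Set.Ico a r, LipschitzOnWith K (v t) Set.univ := by
    intro t ht
    have ht0 : 0 < t := ha.trans_le ht.1
    refine LipschitzOnWith.of_dist_le_mul fun x _ y _ => ?_
    have hx1 : ‖x.1 - y.1‖ ≤ ‖x - y‖ := norm_fst_le (x - y)
    have hx2 : ‖x.2 - y.2‖ ≤ ‖x - y‖ := norm_snd_le (x - y)
    rw [dist_eq_norm, dist_eq_norm, Prod.norm_def]
    change max _ _ ≤ max (1 / a) (‖k‖ ^ 2 * r) * _
    simp only [hv, Prod.fst_sub, Prod.snd_sub]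
    refine max_le ?_ ?_
    · rw [← sub_div, norm_div, Complex.norm_real, Real.norm_of_nonneg ht0.le, div_eq_mul_one_div,
        mul_comm]
      gcongr
      exact le_max_of_le_left (one_div_le_one_div_of_le ha ht.1)
    · rw [← mul_sub, norm_mul, norm_mul, norm_neg, norm_pow, Complex.norm_real,
        Real.norm_of_nonneg ht0.le]
      gcongr
      refine le_max_of_le_right ?_
      have := ht.2.le
      gcongr
  have hd : ∀ t ∈ Set.Icc a r, HasDerivAt (fun t => (f t, p t)) (v t (f t, p t)) t := fun t ht =>
    (h t (ha.trans_le ht.1)).1.prodMk (h t (ha.trans_le ht.1)).2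
  have key := ODE_solution_unique_of_mem_Icc_right (f := fun t => (f t, p t))
    (g := fun _ => (0 : ℂ × ℂ)) (s := fun _ => Set.univ) hLip
    (fun t ht => (hd t ht).continuousAt.continuousWithinAt)
    (fun t ht => (hd t ⟨ht.1, ht.2.le⟩).hasDerivWithinAt) (fun _ _ => trivial)
    continuousOn_const
    (fun t _ => by
      have : v t 0 = 0 := by simp [hv]
      rw [this]
      exact hasDerivWithinAt_const _ _ _) (fun _ _ => trivial) (by simp [hf, hp])
  have := key ⟨hr, le_rfl⟩
  exact (Prod.mk.inj this).1

/-- The Wronskian of `f` with `J₀(kr)`, taken with fluxes, is a constant `c`, so `(f / J)' = c / (r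
J²)`. As `J → 1` at `0`, a nonzero `c` would force `f / J` to diverge logarithmically. Hence `c =
0`, `f` is a multiple of `J` near `0`, and its limit makes that multiple zero. -/
lemma IsBesselPair.eq_zero_of_tendsto {k : ℂ} {f p : ℝ → ℂ} (h : IsBesselPair k f p)
    (hf : Tendsto f (𝓝[>] 0) (𝓝 0)) {r : ℝ} (hr : 0 < r) : f r = 0 := by
  set J : ℝ → ℂ := fun r => seriesJ ((k * r / 2) ^ 2) with hJdef
  obtain ⟨pJ, hJ⟩ : ∃ pJ, IsBesselPair k J pJ := ⟨_, isBesselPair_seriesJ k⟩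
  have hJc : Tendsto (fun r => ((J r)⁻¹) ^ 2) (𝓝 0) (𝓝 1) := by
    have h1 : HasDerivAt J _ 0 := (hasDerivAt_seriesJ _).comp 0 (hasDerivAt_scaled_sq k 0)
    have h2 : Tendsto J (𝓝 0) (𝓝 1) := by
      have := h1.continuousAt.tendsto
      simpa [hJdef, seriesJ_zero] using this
    simpa using (h2.inv₀ one_ne_zero).pow 2
  obtain ⟨δ, hδ, hJδ⟩ := Metric.eventually_nhds_iff_ball.1
    (hJc.eventually (Metric.ball_mem_nhds 1 (by norm_num : (0 : ℝ) < 1 / 2)))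
  have hJre : ∀ r ∈ Set.Ioo 0 δ, 1 / 2 ≤ (((J r)⁻¹) ^ 2).re := by
    intro r hr
    have h1 := hJδ r (by simp [abs_of_pos hr.1, hr.2])
    rw [dist_eq_norm] at h1
    have h2 := (abs_le.1 ((Complex.abs_re_le_norm _).trans h1.le)).1
    rw [Complex.sub_re, Complex.one_re] at h2
    linarith
  have hJne : ∀ r ∈ Set.Ioo 0 δ, J r ≠ 0 := by
    intro r hr h0
    have := hJre r hr
    norm_num [h0] at this
  have hδ2 : δ / 2 ∈ Set.Ioo 0 δ := ⟨by positivity, by linarith⟩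
  set c : ℂ := p (δ / 2) * J (δ / 2) - f (δ / 2) * pJ (δ / 2)
  have hW : ∀ r ∈ Set.Ioo 0 δ, p r * J r - f r * pJ r = c := by
    intro r hr
    refine eq_of_hasDerivAt_zero_Ioo (f := fun r => p r * J r - f r * pJ r) (fun s hs => ?_) hr hδ2
    obtain ⟨h1, h2⟩ := h s hs.1
    obtain ⟨h3, h4⟩ := hJ s hs.1
    refine ((h2.mul h3).sub (h1.mul h4)).congr_deriv ?_
    ring
  set q : ℝ → ℂ := fun r => f r / J r with hq
  have hq' : ∀ r ∈ Set.Ioo 0 δ, HasDerivAt q (c * ((J r)⁻¹) ^ 2 * ((r⁻¹ : ℝ) : ℂ)) r := by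
    intro r hr
    refine ((h r hr.1).1.div (hJ r hr.1).1 (hJne r hr)).congr_deriv ?_
    have := hJne r hr
    have hr' : (r : ℂ) ≠ 0 := by exact_mod_cast hr.1.ne'
    rw [← hW r hr]
    push_cast
    field_simp
  have hq0 : Tendsto q (𝓝[>] 0) (𝓝 0) := by
    have h1 : Tendsto J (𝓝[>] 0) (𝓝 1) := by
      have h1 : HasDerivAt J _ 0 := (hasDerivAt_seriesJ _).comp 0 (hasDerivAt_scaled_sq k 0)
      have := h1.continuousAt.tendsto
      refine Tendsto.mono_left ?_ nhdsWithin_le_nhds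
      simpa [hJdef, seriesJ_zero] using this
    have h2 := hf.div h1 one_ne_zero
    rwa [zero_div] at h2
  have hc : c = 0 := by
    by_contra hc
    have hc2 : 0 < Complex.normSq c := Complex.normSq_pos.2 hc
    -- Because `Re J⁻² ≥ 1/2` near `0`, `g` is nondecreasing. But `f / J → 0` and `-log r → ∞`, so
    -- `g` tends to `+∞` at `0⁺`, a contradiction.
    set g : ℝ → ℝ := fun r => ((starRingEnd ℂ) c * q r).re - Complex.normSq c / 2 * Real.log r
    have hg : ∀ r ∈ Set.Ioo 0 δ, HasDerivAt g
        (Complex.normSq c * (((J r)⁻¹) ^ 2).re * r⁻¹ - Complex.normSq c / 2 * r⁻¹) r := by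
      intro r hr
      have h1 := ((hq' r hr).const_mul ((starRingEnd ℂ) c))
      have h2 := Complex.reCLM.hasFDerivAt.comp_hasDerivAt r h1
      refine (h2.sub ((Real.hasDerivAt_log hr.1.ne').const_mul _)).congr_deriv ?_
      rw [Complex.reCLM_apply, ← mul_assoc, ← mul_assoc, mul_comm ((starRingEnd ℂ) c),
        Complex.mul_conj, Complex.re_mul_ofReal, Complex.re_ofReal_mul]
    have hmono : MonotoneOn g (Set.Ioo 0 δ) := by
      refine monotoneOn_of_deriv_nonneg (convex_Ioo 0 δ)
        (fun r hr => (hg r hr).continuousAt.continuousWithinAt) ?_ ?_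
      · rw [interior_Ioo]
        exact fun r hr => (hg r hr).differentiableAt.differentiableWithinAt
      · rw [interior_Ioo]
        intro r hr
        rw [(hg r hr).deriv]
        have h1 := hJre r hr
        have h2 : 0 < r⁻¹ := inv_pos.2 hr.1
        have : Complex.normSq c * (((J r)⁻¹) ^ 2).re * r⁻¹ - Complex.normSq c / 2 * r⁻¹
          = Complex.normSq c * ((((J r)⁻¹) ^ 2).re - 1 / 2) * r⁻¹ := by ring
        rw [this]
        have : 0 ≤ (((J r)⁻¹) ^ 2).re - 1 / 2 := by linarith
        positivity
    have hlim : Tendsto g (𝓝[>] 0) atTop := by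
      have h1 : Tendsto (fun r => ((starRingEnd ℂ) c * q r).re) (𝓝[>] 0) (𝓝 0) := by
        have := (Complex.continuous_re.tendsto _).comp (hq0.const_mul ((starRingEnd ℂ) c))
        rwa [mul_zero, Complex.zero_re] at this
      have h2 : Tendsto (fun r : ℝ => -(Complex.normSq c / 2 * Real.log r)) (𝓝[>] 0) atTop :=
        tendsto_neg_atBot_atTop.comp
          (Real.tendsto_log_nhdsGT_zero.const_mul_atBot (half_pos hc2))
      exact h1.add_atTop h2
    have h1 : ∀ᶠ r in 𝓝[>] (0 : ℝ), g (δ / 2) < g r := hlim.eventually_gt_atTop _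
    have h2 : ∀ᶠ r in 𝓝[>] (0 : ℝ), r ∈ Set.Ioo 0 (δ / 2) := Ioo_mem_nhdsGT hδ2.1
    obtain ⟨r, hr1, hr2⟩ := (h1.and h2).exists
    exact absurd (hmono ⟨hr2.1, hr2.2.trans hδ2.2⟩ hδ2 hr2.2.le) (not_le.2 hr1)
  have hqz : ∀ r ∈ Set.Ioo 0 δ, q r = 0 := by
    intro r hr
    have hconst : ∀ s ∈ Set.Ioo 0 δ, q s = q r := fun s hs =>
      eq_of_hasDerivAt_zero_Ioo (fun t ht => (hq' t ht).congr_deriv (by simp [hc])) hs hr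
    have h1 : Tendsto q (𝓝[>] 0) (𝓝 (q r)) :=
      tendsto_const_nhds.congr' (by
        filter_upwards [Ioo_mem_nhdsGT hδ] with s hs
        exact (hconst s hs).symm)
    exact tendsto_nhds_unique h1 hq0
  have hfz : ∀ r ∈ Set.Ioo 0 δ, f r = 0 := fun r hr =>
    (div_eq_zero_iff.1 (hqz r hr)).resolve_right (hJne r hr)
  have hpz : ∀ r ∈ Set.Ioo 0 δ, p r = 0 := by
    intro r hr
    have h1 : HasDerivAt f 0 r := (hasDerivAt_const r (0 : ℂ)).congr_of_eventuallyEq (by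
      filter_upwards [Ioo_mem_nhds hr.1 hr.2] with s hs using hfz s hs)
    have h2 := (h r hr.1).1.unique h1
    exact (div_eq_zero_iff.1 h2).resolve_right (by exact_mod_cast hr.1.ne')
  rcases lt_or_ge r δ with hrδ | hrδ
  · exact hfz r ⟨hr, hrδ⟩
  · exact h.eq_zero_of_initial hδ2.1 (hfz _ hδ2) (hpz _ hδ2) (hδ2.2.le.trans hrδ)

lemma IsBesselPair.eq_of_tendsto_sub {k : ℂ} {f p g q : ℝ → ℂ} (hf : IsBesselPair k f p)
    (hg : IsBesselPair k g q) (h : Tendsto (fun r => f r - g r) (𝓝[>] 0) (𝓝 0))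
    {r : ℝ} (hr : 0 < r) : f r = g r := by
  have hd : IsBesselPair k (fun r => f r - g r) (fun r => p r - q r) := fun s hs =>
    ⟨((hf s hs).1.sub (hg s hs).1).congr_deriv (by ring),
      ((hf s hs).2.sub (hg s hs).2).congr_deriv (by ring)⟩
  exact sub_eq_zero.1 (hd.eq_zero_of_tendsto h hr)

/-! ### A steepest descent path of complex directions -/

lemma sq_sqrt (z : ℂ) : Complex.sqrt z ^ 2 = z := by
  have := Complex.cpow_nat_inv_pow z two_ne_zero
  rwa [Nat.cast_ofNat] at this

lemma sqrt_re_pos {z : ℂ} (hz : z ∈ Complex.slitPlane) : 0 < (Complex.sqrt z).re := by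
  rw [Complex.sqrt, Complex.cpow_inv_two_re]
  refine Real.sqrt_pos.2 (half_pos ?_)
  by_cases h : z.im = 0
  · have := (Complex.mem_slitPlane_iff.1 hz).resolve_right (not_not.2 h)
    linarith [norm_nonneg z]
  · have := neg_lt_of_abs_lt (Complex.abs_re_lt_norm.2 h)
    linarith

lemma hasDerivAt_sqrt {z : ℂ} (hz : z ∈ Complex.slitPlane) :
    HasDerivAt Complex.sqrt (1 / (2 * Complex.sqrt z)) z := by
  have h := (hasDerivAt_id z).cpow_const (c := (2⁻¹ : ℂ)) hz
  refine h.congr_deriv ?_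
  have hz0 := Complex.slitPlane_ne_zero hz
  have h0 : Complex.sqrt z ≠ 0 := fun h0 => by have := sqrt_re_pos hz; simp [h0] at this
  rw [id, Complex.cpow_sub _ _ hz0, Complex.cpow_one, ← Complex.sqrt]
  field_simp
  rw [sq_sqrt]

/-- The square root of the wave number. -/
def lam (k : ℂ) : ℂ := Complex.sqrt k

/-- The coefficient of the quadratic phase of the path. -/
def tau (k : ℂ) : ℂ := Complex.I / (2 * lam k)

/-- The square root of `tau`. -/
def sig (k : ℂ) : ℂ := Complex.sqrt (tau k)

/-- The function `√(1 + τ s²)`. -/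
def rad (k : ℂ) (s : ℝ) : ℂ := Complex.sqrt (1 + tau k * (s : ℂ) ^ 2)

/-- The complex arc length density of the path. -/
def dens (k : ℂ) (s : ℝ) : ℂ := 2 * sig k / rad k s

/-- The first component of the path of complex unit vectors. -/
def dirC (k : ℂ) (s : ℝ) : ℂ := 1 + 2 * tau k * (s : ℂ) ^ 2

/-- The second component of the path of complex unit vectors. -/
def dirS (k : ℂ) (s : ℝ) : ℂ := 2 * Complex.I * sig k * s * rad k s

section path

lemma lam_sq (k : ℂ) : lam k ^ 2 = k := sq_sqrt k

lemma sig_sq (k : ℂ) : sig k ^ 2 = tau k := sq_sqrt _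

lemma rad_sq (k : ℂ) (s : ℝ) : rad k s ^ 2 = 1 + tau k * (s : ℂ) ^ 2 := sq_sqrt _

lemma rad_neg (k : ℂ) (s : ℝ) : rad k (-s) = rad k s := by simp [rad]

lemma dens_neg (k : ℂ) (s : ℝ) : dens k (-s) = dens k s := by simp [dens, rad_neg]

lemma dirC_neg (k : ℂ) (s : ℝ) : dirC k (-s) = dirC k s := by simp [dirC]

lemma dirS_neg (k : ℂ) (s : ℝ) : dirS k (-s) = -dirS k s := by simp [dirS, rad_neg]

lemma rad_zero (k : ℂ) : rad k 0 = 1 := by simp [rad]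

lemma dens_zero (k : ℂ) : dens k 0 = 2 * sig k := by simp [dens, rad_zero]

lemma dirC_zero (k : ℂ) : dirC k 0 = 1 := by simp [dirC]

lemma dirS_zero (k : ℂ) : dirS k 0 = 0 := by simp [dirS]

lemma dirC_sq_add_dirS_sq (k : ℂ) (s : ℝ) : dirC k s ^ 2 + dirS k s ^ 2 = 1 := by
  have h1 := rad_sq k s
  have h2 := sig_sq k
  have h3 := Complex.I_sq
  simp only [dirC, dirS, mul_pow, h1, h2, h3]
  ring

variable {k : ℂ} (hk : k ∈ Complex.slitPlane)
include hk

lemma lam_re_pos : 0 < (lam k).re := sqrt_re_pos hk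

lemma lam_ne_zero : lam k ≠ 0 := fun h => by have := lam_re_pos hk; simp [h] at this

/-- Positivity of `Re λ` is where the cut in `k` matters. It puts `τ` in the open upper half-plane,
so `1 + τ s²` never meets the cut of the square root and the path is smooth for all real `s`. -/
lemma tau_im_pos : 0 < (tau k).im := by
  have h : tau k = Complex.I * (2 * lam k)⁻¹ := by rw [tau, div_eq_mul_inv]
  rw [h, Complex.I_mul_im, Complex.inv_re]
  have h1 := lam_re_pos hk
  have h2 : 0 < Complex.normSq (2 * lam k) :=
    Complex.normSq_pos.2 (mul_ne_zero two_ne_zero (lam_ne_zero hk))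
  have h3 : 0 < (2 * lam k).re := by simpa using h1
  positivity

lemma tau_mem_slitPlane : tau k ∈ Complex.slitPlane :=
  Complex.mem_slitPlane_iff.2 (Or.inr (tau_im_pos hk).ne')

lemma sig_re_pos : 0 < (sig k).re := sqrt_re_pos (tau_mem_slitPlane hk)

lemma sig_ne_zero : sig k ≠ 0 := fun h => by have := sig_re_pos hk; simp [h] at this

lemma one_add_tau_mul_sq_mem (s : ℝ) : 1 + tau k * (s : ℂ) ^ 2 ∈ Complex.slitPlane := by
  rw [Complex.mem_slitPlane_iff]
  by_cases hs : s = 0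
  · simp [hs]
  · right
    have h1 := tau_im_pos hk
    rw [← Complex.ofReal_pow, Complex.add_im, Complex.im_mul_ofReal, Complex.one_im, zero_add]
    positivity

lemma rad_re_pos (s : ℝ) : 0 < (rad k s).re := sqrt_re_pos (one_add_tau_mul_sq_mem hk s)

lemma rad_ne_zero (s : ℝ) : rad k s ≠ 0 := fun h => by
  have := rad_re_pos hk s; simp [h] at this

lemma hasDerivAt_rad (s : ℝ) : HasDerivAt (rad k) (tau k * s / rad k s) s := by
  have h1 : HasDerivAt (fun s : ℝ => 1 + tau k * (s : ℂ) ^ 2) (tau k * (2 * s)) s := by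
    have := (((hasDerivAt_id s).ofReal_comp.pow 2).const_mul (tau k)).const_add 1
    simpa using this
  have h2 := (hasDerivAt_sqrt (one_add_tau_mul_sq_mem hk s)).comp s h1
  refine h2.congr_deriv ?_
  have := rad_ne_zero hk s
  rw [← rad]
  field_simp

/-- Together with the derivative of `dirS` this says that the path is `(cos φ, sin φ)` for a complex
angle with `φ(0) = 0` and `φ' = i dens`. All exact-derivative identities below are rotations in `φ`.
-/
lemma hasDerivAt_dirC (s : ℝ) :
    HasDerivAt (dirC k) (-Complex.I * dens k s * dirS k s) s := by
  have h1 : HasDerivAt (dirC k) (2 * tau k * (2 * s)) s := by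
    have := (((hasDerivAt_id s).ofReal_comp.pow 2).const_mul (2 * tau k)).const_add 1
    refine this.congr_deriv ?_
    simp
  refine h1.congr_deriv ?_
  have := rad_ne_zero hk s
  have h3 := Complex.I_sq
  simp only [dens, dirS]
  field_simp
  rw [← sig_sq k]
  linear_combination ( sig k ^ 2 * s) * h3

lemma hasDerivAt_dirS (s : ℝ) :
    HasDerivAt (dirS k) (Complex.I * dens k s * dirC k s) s := by
  have h1 : HasDerivAt (dirS k) _ s :=
    ((hasDerivAt_id s).ofReal_comp.const_mul (2 * Complex.I * sig k)).mul (hasDerivAt_rad hk s)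
  refine h1.congr_deriv ?_
  have h0 := rad_ne_zero hk s
  have h2 := rad_sq k s
  simp only [dens, dirC]
  field_simp
  simp only [id, Complex.ofReal_one, h2]
  ring

/-- The value of `τ` is chosen for this: `2 i k τ = -k / λ = -λ`. The phase is exactly quadratic,
with decay governed by `Re λ > 0` alone, even when `Im k < 0`. -/
lemma I_mul_k_mul_dirC (s : ℝ) :
    Complex.I * k * dirC k s = Complex.I * k - lam k * (s : ℂ) ^ 2 := by
  have h1 := lam_sq k
  have h0 := lam_ne_zero hk
  have h3 := Complex.I_sq
  simp only [dirC, tau]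
  field_simp
  linear_combination (k * s ^ 2) * h3 + (s ^ 2) * h1

lemma continuous_rad : Continuous (rad k) :=
  continuous_iff_continuousAt.2 fun s => (hasDerivAt_rad hk s).continuousAt

lemma continuous_dens : Continuous (dens k) :=
  continuous_const.div (continuous_rad hk) (rad_ne_zero hk)

lemma continuous_dirS : Continuous (dirS k) :=
  continuous_iff_continuousAt.2 fun s => (hasDerivAt_dirS hk s).continuousAt

omit hk in
lemma continuous_dirC : Continuous (dirC k) := by unfold dirC; fun_prop

omit hk in
lemma norm_rad_le (s : ℝ) : ‖rad k s‖ ≤ 1 + ‖sig k‖ * |s| := by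
  refine abs_le_of_sq_le_sq' ?_ (by positivity) |>.2
  rw [← norm_pow, rad_sq, ← sig_sq]
  refine (norm_add_le _ _).trans ?_
  rw [norm_mul, norm_pow, norm_pow, norm_one, Complex.norm_real, Real.norm_eq_abs]
  nlinarith [mul_nonneg (norm_nonneg (sig k)) (abs_nonneg s)]

/-- The points `1 + τ s²` lie on a ray from `1` in direction `τ`, whose line has distance `Im τ /
|τ|` from the origin. -/
lemma exists_le_norm_rad : ∃ c > 0, ∀ s, c ≤ ‖rad k s‖ := by
  have h1 := tau_im_pos hk
  have h0 : 0 < ‖tau k‖ := norm_pos_iff.2 (fun h => by simp [h] at h1)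
  refine ⟨√((tau k).im / ‖tau k‖), by positivity, fun s => ?_⟩
  refine Real.sqrt_le_iff.2 ⟨norm_nonneg _, ?_⟩
  rw [← norm_pow, rad_sq, div_le_iff₀ h0, ← Complex.norm_conj (tau k), ← norm_mul]
  refine le_trans ?_ (Complex.abs_im_le_norm _)
  have : ((1 + tau k * (s : ℂ) ^ 2) * (starRingEnd ℂ) (tau k)).im = -(tau k).im := by
    rw [add_mul, one_mul, mul_right_comm, Complex.mul_conj, ← Complex.ofReal_pow,
      ← Complex.ofReal_mul, Complex.add_im, Complex.ofReal_im, add_zero, Complex.conj_im]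
  rw [this, abs_neg]
  exact le_abs_self _

lemma exists_path_bounds : ∃ C : ℝ, 1 ≤ C ∧ ∀ s : ℝ, ‖dens k s‖ ≤ C ∧
    ‖dens k s - dens k 0‖ ≤ C * s ^ 2 ∧ ‖dirC k s - 1‖ ≤ C * s ^ 2 ∧
    ‖dirS k s‖ ≤ C * (|s| + s ^ 2) := by
  obtain ⟨c, hc, hcr⟩ := exists_le_norm_rad hk
  set C : ℝ := 1 + 2 * ‖sig k‖ / c + 2 * ‖sig k‖ * ‖tau k‖ / c + 2 * ‖tau k‖ + 2 * ‖sig k‖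
    + 2 * ‖sig k‖ * ‖sig k‖
  have a1 : 0 ≤ 2 * ‖sig k‖ / c := by positivity
  have a2 : 0 ≤ 2 * ‖sig k‖ * ‖tau k‖ / c := by positivity
  have a3 : 0 ≤ 2 * ‖tau k‖ := by positivity
  have a4 : 0 ≤ 2 * ‖sig k‖ := by positivity
  have a5 : 0 ≤ 2 * ‖sig k‖ * ‖sig k‖ := by positivity
  have hrad : ∀ s, ‖rad k s - 1‖ ≤ ‖tau k‖ * s ^ 2 := by
    intro s
    -- Rationalising the difference; the denominator `rad + 1` has modulus at least `1` because `Re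
    -- rad > 0`.
    have h1 : (rad k s - 1) * (rad k s + 1) = tau k * (s : ℂ) ^ 2 := by
      linear_combination rad_sq k s
    have h2 : 1 ≤ ‖rad k s + 1‖ := by
      refine le_trans ?_ (Complex.re_le_norm _)
      have := rad_re_pos hk s
      simp only [Complex.add_re, Complex.one_re]
      linarith
    calc ‖rad k s - 1‖ ≤ ‖rad k s - 1‖ * ‖rad k s + 1‖ := le_mul_of_one_le_right (norm_nonneg _) h2
      _ = ‖tau k‖ * s ^ 2 := by
        rw [← norm_mul, h1, norm_mul, norm_pow, Complex.norm_real, Real.norm_eq_abs, sq_abs]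
  refine ⟨C, by simp only [C]; linarith, fun s => ⟨?_, ?_, ?_, ?_⟩⟩
  · rw [dens, norm_div, norm_mul, Complex.norm_ofNat]
    calc 2 * ‖sig k‖ / ‖rad k s‖ ≤ 2 * ‖sig k‖ / c := by gcongr; exact hcr s
      _ ≤ C := by simp only [C]; linarith
  · have h0 := rad_ne_zero hk s
    have : dens k s - dens k 0 = -(2 * sig k * (rad k s - 1) / rad k s) := by
      rw [dens_zero, dens]; field_simp; ring
    rw [this, norm_neg, norm_div, norm_mul, norm_mul, Complex.norm_ofNat]
    calc 2 * ‖sig k‖ * ‖rad k s - 1‖ / ‖rad k s‖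
        ≤ 2 * ‖sig k‖ * (‖tau k‖ * s ^ 2) / c := by gcongr; exacts [hrad s, hcr s]
      _ = 2 * ‖sig k‖ * ‖tau k‖ / c * s ^ 2 := by ring
      _ ≤ C * s ^ 2 := by gcongr; simp only [C]; linarith
  · have : dirC k s - 1 = 2 * tau k * (s : ℂ) ^ 2 := by rw [dirC]; ring
    rw [this, norm_mul, norm_mul, Complex.norm_ofNat, norm_pow, Complex.norm_real,
      Real.norm_eq_abs, sq_abs]
    gcongr
    simp only [C]; linarith
  · rw [dirS]
    simp only [norm_mul, Complex.norm_ofNat, Complex.norm_I, Complex.norm_real, Real.norm_eq_abs]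
    calc 2 * 1 * ‖sig k‖ * |s| * ‖rad k s‖ ≤ 2 * 1 * ‖sig k‖ * |s| * (1 + ‖sig k‖ * |s|) := by
          gcongr; exact norm_rad_le s
      _ = 2 * ‖sig k‖ * |s| + 2 * ‖sig k‖ * ‖sig k‖ * |s| ^ 2 := by ring
      _ ≤ C * |s| + C * s ^ 2 := by
        rw [sq_abs]
        gcongr
        · simp only [C]; linarith
        · simp only [C]; linarith
      _ = _ := by ring

end path

/-! ### Superpositions of complex plane waves along the path -/

lemma one_add_sq_pow_le_exp {b : ℝ} (hb : 0 < b) (s : ℝ) :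
    (1 + s ^ 2) ^ 2 ≤ (1 + 2 / b) ^ 2 * Real.exp (b * s ^ 2) := by
  have h1 : b / 2 * s ^ 2 + 1 ≤ Real.exp (b / 2 * s ^ 2) := Real.add_one_le_exp _
  have h2 : 1 + s ^ 2 ≤ (1 + 2 / b) * Real.exp (b / 2 * s ^ 2) := by
    calc 1 + s ^ 2 ≤ (1 + 2 / b) * (b / 2 * s ^ 2 + 1) := by
          have : (1 + 2 / b) * (b / 2 * s ^ 2 + 1) = 1 + s ^ 2 + (b / 2 * s ^ 2 + 2 / b) := by
            field_simp; ring
          rw [this]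
          have : 0 ≤ b / 2 * s ^ 2 + 2 / b := by positivity
          linarith
      _ ≤ _ := by gcongr
  calc (1 + s ^ 2) ^ 2 ≤ ((1 + 2 / b) * Real.exp (b / 2 * s ^ 2)) ^ 2 := by gcongr
    _ = _ := by rw [mul_pow, ← Real.exp_nat_mul]; congr 2; push_cast; ring

lemma integrable_one_add_sq_pow_mul_exp {b : ℝ} (hb : 0 < b) :
    Integrable fun s : ℝ => (1 + s ^ 2) ^ 2 * Real.exp (-b * s ^ 2) := by
  refine ((integrable_exp_neg_mul_sq (half_pos hb)).const_mul ((1 + 2 / (b / 2)) ^ 2)).mono'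
    (by fun_prop) (ae_of_all _ fun s => ?_)
  rw [Real.norm_of_nonneg (by positivity)]
  calc (1 + s ^ 2) ^ 2 * Real.exp (-b * s ^ 2)
      ≤ (1 + 2 / (b / 2)) ^ 2 * Real.exp (b / 2 * s ^ 2) * Real.exp (-b * s ^ 2) := by
        gcongr; exact one_add_sq_pow_le_exp (half_pos hb) s
    _ = _ := by rw [mul_assoc, ← Real.exp_add]; congr 2; ring

/-- Uniform bounds for the path of complex directions, with constant `C`. -/
def PathBound (k : ℂ) (C : ℝ) : Prop :=
  1 ≤ C ∧ ∀ s : ℝ, ‖dens k s‖ ≤ C ∧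
    ‖dens k s - dens k 0‖ ≤ C * s ^ 2 ∧ ‖dirC k s - 1‖ ≤ C * s ^ 2 ∧
    ‖dirS k s‖ ≤ C * (|s| + s ^ 2)

lemma abs_le_one_add_sq (s : ℝ) : |s| ≤ 1 + s ^ 2 := by
  nlinarith [sq_nonneg (|s| - 1), sq_abs s, abs_nonneg s]

lemma PathBound.norm_dirC_le {k : ℂ} {C : ℝ} (hC : PathBound k C) (s : ℝ) :
    ‖dirC k s‖ ≤ 2 * C * (1 + s ^ 2) := by
  have h1 := (hC.2 s).2.2.1
  have h2 := norm_add_le (dirC k s - 1) 1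
  rw [sub_add_cancel, norm_one] at h2
  nlinarith [hC.1, sq_nonneg s]

lemma PathBound.norm_dirS_le {k : ℂ} {C : ℝ} (hC : PathBound k C) (s : ℝ) :
    ‖dirS k s‖ ≤ 2 * C * (1 + s ^ 2) := by
  have h1 := (hC.2 s).2.2.2
  have h2 := abs_le_one_add_sq s
  have h3 := hC.1
  refine h1.trans ?_
  nlinarith [sq_nonneg s, mul_nonneg (by linarith : 0 ≤ C) (by linarith : 0 ≤ 1 + s ^ 2 - |s|)]

/-- The complex plane wave with direction given by the path at parameter `s`. -/
def planeWave (k : ℂ) (p q s : ℝ) : ℂ :=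
  Complex.exp (Complex.I * k * (p * dirC k s + q * dirS k s))

section waves

variable {k : ℂ} (hk : k ∈ Complex.slitPlane) {C : ℝ} (hC : PathBound k C)
include hk

lemma continuous_planeWave (p q : ℝ) : Continuous (planeWave k p q) := by
  have := continuous_dirS hk
  have := continuous_dirC (k := k)
  unfold planeWave
  fun_prop

include hC

/-- The longitudinal part `p` contributes Gaussian decay at rate `Re λ · p`, while the transversal
part `q` can cost at most `2 C ‖k‖ |q|` of that rate. Positivity of the remaining rate is the cone
condition used throughout. -/
lemma norm_planeWave_le (p q s : ℝ) :
    ‖planeWave k p q s‖ ≤ Real.exp (2 * C * ‖k‖ * (|p| + |q|)) *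
      Real.exp (-((lam k).re * p - 2 * C * ‖k‖ * |q|) * s ^ 2) := by
  rw [planeWave, Complex.norm_exp, ← Real.exp_add]
  refine Real.exp_le_exp.2 ?_
  have h1 : Complex.I * k * (p * dirC k s + q * dirS k s)
      = p * (Complex.I * k * dirC k s) + Complex.I * k * q * dirS k s := by ring
  have h2 : (p * (Complex.I * k * dirC k s) : ℂ).re
      = p * (Complex.I * k).re - (lam k).re * p * s ^ 2 := by
    rw [Complex.re_ofReal_mul, I_mul_k_mul_dirC hk, Complex.sub_re, ← Complex.ofReal_pow,
      Complex.re_mul_ofReal]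
    ring
  have hC1 := hC.1
  have h3 : (Complex.I * k * q * dirS k s).re ≤ 2 * C * ‖k‖ * |q| * (1 + s ^ 2) := by
    refine (Complex.re_le_norm _).trans ?_
    rw [norm_mul, norm_mul, norm_mul, Complex.norm_I, Complex.norm_real, Real.norm_eq_abs]
    calc 1 * ‖k‖ * |q| * ‖dirS k s‖ ≤ 1 * ‖k‖ * |q| * (2 * C * (1 + s ^ 2)) := by
          gcongr; exact hC.norm_dirS_le s
      _ = _ := by ring
  have h4 : p * (Complex.I * k).re ≤ 2 * C * ‖k‖ * |p| := by
    calc p * (Complex.I * k).re ≤ |p * (Complex.I * k).re| := le_abs_self _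
      _ ≤ |p| * ‖k‖ := by
        rw [abs_mul]
        gcongr
        simpa using Complex.abs_re_le_norm (Complex.I * k)
      _ ≤ _ := by nlinarith [mul_nonneg (abs_nonneg p) (norm_nonneg k)]
  rw [h1, Complex.add_re, h2]
  linarith

lemma integrable_planeWave_mul {g : ℝ → ℂ} {A : ℝ} (hg : Continuous g)
    (hgA : ∀ s, ‖g s‖ ≤ A * (1 + s ^ 2) ^ 2) {p q : ℝ}
    (hpq : 2 * C * ‖k‖ * |q| < (lam k).re * p) :
    Integrable fun s => planeWave k p q s * g s := by
  have hb := sub_pos.2 hpq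
  refine ((integrable_one_add_sq_pow_mul_exp hb).const_mul
    (Real.exp (2 * C * ‖k‖ * (|p| + |q|)) * A)).mono'
    ((continuous_planeWave hk p q).mul hg).aestronglyMeasurable (ae_of_all _ fun s => ?_)
  rw [norm_mul]
  calc ‖planeWave k p q s‖ * ‖g s‖ ≤ (Real.exp (2 * C * ‖k‖ * (|p| + |q|)) *
      Real.exp (-((lam k).re * p - 2 * C * ‖k‖ * |q|) * s ^ 2)) * (A * (1 + s ^ 2) ^ 2) := by
        gcongr
        exacts [norm_planeWave_le hk hC p q s, hgA s]
    _ = _ := by ring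

lemma hasDerivAt_integral_planeWave {g : ℝ → ℂ} {A : ℝ} (hg : Continuous g)
    (hgA : ∀ s, ‖g s‖ ≤ A * (1 + s ^ 2)) {p q p' q' : ℝ → ℝ} {t₀ : ℝ}
    (hp : ∀ᶠ t in 𝓝 t₀, HasDerivAt p (p' t) t) (hq : ∀ᶠ t in 𝓝 t₀, HasDerivAt q (q' t) t)
    (hp' : ContinuousAt p' t₀) (hq' : ContinuousAt q' t₀)
    (hpq : 2 * C * ‖k‖ * |q t₀| < (lam k).re * p t₀) :
    HasDerivAt (fun t => ∫ s, planeWave k (p t) (q t) s * g s)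
      (∫ s, planeWave k (p t₀) (q t₀) s *
        (Complex.I * k * (p' t₀ * dirC k s + q' t₀ * dirS k s) * g s)) t₀ := by
  have hC1 := hC.1
  have hA : 0 ≤ A := by simpa using (norm_nonneg _).trans (hgA 0)
  have hpc := hp.self_of_nhds.continuousAt
  have hqc := hq.self_of_nhds.continuousAt
  -- Half of the decay rate at `t₀`: the rate stays above `b` for nearby `t`, giving one Gaussian
  -- majorant for all of them.
  set b : ℝ := ((lam k).re * p t₀ - 2 * C * ‖k‖ * |q t₀|) / 2 with hb
  have hb0 : 0 < b := by simp only [hb]; linarith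
  have e1 : ∀ᶠ t in 𝓝 t₀, b < (lam k).re * p t - 2 * C * ‖k‖ * |q t| := by
    have hc : ContinuousAt (fun t => (lam k).re * p t - 2 * C * ‖k‖ * |q t|) t₀ := by fun_prop
    exact hc.eventually (lt_mem_nhds (by simp only [hb]; linarith))
  have e2 : ∀ᶠ t in 𝓝 t₀, |p t| + |q t| < |p t₀| + |q t₀| + 1 := by
    have hc : ContinuousAt (fun t => |p t| + |q t|) t₀ := by fun_prop
    exact hc.eventually (gt_mem_nhds (by linarith))
  have e3 : ∀ᶠ t in 𝓝 t₀, |p' t| + |q' t| < |p' t₀| + |q' t₀| + 1 := by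
    have hc : ContinuousAt (fun t => |p' t| + |q' t|) t₀ := by fun_prop
    exact hc.eventually (gt_mem_nhds (by linarith))
  set M := |p t₀| + |q t₀| + 1
  set M' := |p' t₀| + |q' t₀| + 1
  have hgA2 : ∀ s, ‖g s‖ ≤ A * (1 + s ^ 2) ^ 2 := fun s => (hgA s).trans (by
    gcongr
    nlinarith [sq_nonneg s])
  have hcC := continuous_dirC (k := k)
  have hcS := continuous_dirS hk
  refine (hasDerivAt_integral_of_dominated_loc_of_deriv_le
    (F := fun t s => planeWave k (p t) (q t) s * g s)
    (F' := fun t s => planeWave k (p t) (q t) s *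
        (Complex.I * k * (p' t * dirC k s + q' t * dirS k s) * g s))
    (bound := fun s => Real.exp (2 * C * ‖k‖ * M) * ‖k‖ * (M' * (2 * C)) * A *
      ((1 + s ^ 2) ^ 2 * Real.exp (-b * s ^ 2)))
    (hp.and (hq.and (e1.and (e2.and e3)))) ?_ ?_ ?_ ?_ ?_ ?_).2
  · exact Eventually.of_forall fun t =>
      ((continuous_planeWave hk _ _).mul hg).aestronglyMeasurable
  · exact integrable_planeWave_mul hk hC hg hgA2 hpq
  · exact ((continuous_planeWave hk _ _).mul (by fun_prop)).aestronglyMeasurable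
  · refine ae_of_all _ fun s t ht => ?_
    obtain ⟨-, -, h1, h2, h3⟩ := ht
    have hE : ‖planeWave k (p t) (q t) s‖ ≤ Real.exp (2 * C * ‖k‖ * M) * Real.exp (-b * s ^ 2) := by
      refine (norm_planeWave_le hk hC _ _ s).trans ?_
      gcongr
    have hD : ‖(p' t : ℂ) * dirC k s + q' t * dirS k s‖ ≤ M' * (2 * C * (1 + s ^ 2)) := by
      calc ‖(p' t : ℂ) * dirC k s + q' t * dirS k s‖ ≤ |p' t| * ‖dirC k s‖ + |q' t| * ‖dirS k s‖ := by
            refine (norm_add_le _ _).trans ?_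
            simp only [norm_mul, Complex.norm_real, Real.norm_eq_abs, le_refl]
        _ ≤ |p' t| * (2 * C * (1 + s ^ 2)) + |q' t| * (2 * C * (1 + s ^ 2)) := by
            gcongr
            exacts [hC.norm_dirC_le s, hC.norm_dirS_le s]
        _ = (|p' t| + |q' t|) * (2 * C * (1 + s ^ 2)) := by ring
        _ ≤ _ := by gcongr
    rw [norm_mul, norm_mul, norm_mul, norm_mul, Complex.norm_I, one_mul]
    calc ‖planeWave k (p t) (q t) s‖ * (‖k‖ * ‖(p' t : ℂ) * dirC k s + q' t * dirS k s‖ * ‖g s‖)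
        ≤ (Real.exp (2 * C * ‖k‖ * M) * Real.exp (-b * s ^ 2)) *
          (‖k‖ * (M' * (2 * C * (1 + s ^ 2))) * (A * (1 + s ^ 2))) := by
          gcongr
          exact hgA s
      _ = _ := by ring
  · exact (integrable_one_add_sq_pow_mul_exp hb0).const_mul _
  · refine ae_of_all _ fun s t ht => ?_
    obtain ⟨h1, h2, -⟩ := ht
    have h := (((h1.ofReal_comp.mul_const (dirC k s)).add
      (h2.ofReal_comp.mul_const (dirS k s))).const_mul (Complex.I * k)).cexp.mul_const (g s)
    refine h.congr_deriv ?_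
    simp only [planeWave, Pi.add_apply]
    ring

omit hC in
lemma hasDerivAt_planeWave (p q s : ℝ) :
    HasDerivAt (planeWave k p q)
      (planeWave k p q s * (k * dens k s * (p * dirS k s - q * dirC k s))) s := by
  have h := ((((hasDerivAt_dirC hk s).const_mul (p : ℂ)).add
    ((hasDerivAt_dirS hk s).const_mul (q : ℂ))).const_mul (Complex.I * k)).cexp
  refine h.congr_deriv ?_
  simp only [planeWave, Pi.add_apply]
  linear_combination (-k * dens k s * (p * dirS k s - q * dirC k s) *
    Complex.exp (Complex.I * k * (p * dirC k s + q * dirS k s))) * Complex.I_sq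

/-- The integrand is the `s`-derivative of the plane wave. Both are integrable in the cone, so there
are no boundary terms. -/
lemma integral_planeWave_angular_eq_zero {p q : ℝ}
    (hpq : 2 * C * ‖k‖ * |q| < (lam k).re * p) :
    ∫ s, planeWave k p q s * (k * dens k s * (p * dirS k s - q * dirC k s)) = 0 := by
  have hC1 := hC.1
  have hcC := continuous_dirC (k := k)
  have hcS := continuous_dirS hk
  have hcd := continuous_dens hk
  refine integral_eq_zero_of_hasDerivAt_of_integrable
    (hasDerivAt_planeWave hk p q) ?_ ?_
  · refine integrable_planeWave_mul (A := ‖k‖ * C * (|p| * (2 * C) + |q| * (2 * C))) hk hC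
      (by fun_prop) (fun s => ?_) hpq
    rw [norm_mul, norm_mul]
    calc ‖k‖ * ‖dens k s‖ * ‖(p : ℂ) * dirS k s - q * dirC k s‖
        ≤ ‖k‖ * C * (|p| * (2 * C * (1 + s ^ 2)) + |q| * (2 * C * (1 + s ^ 2))) := by
          gcongr
          · exact (hC.2 s).1
          · refine (norm_sub_le _ _).trans ?_
            simp only [norm_mul, Complex.norm_real, Real.norm_eq_abs]
            gcongr
            exacts [hC.norm_dirS_le s, hC.norm_dirC_le s]
      _ = ‖k‖ * C * (|p| * (2 * C) + |q| * (2 * C)) * (1 + s ^ 2) := by ring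
      _ ≤ _ := by
        gcongr
        nlinarith [sq_nonneg s]
  · have := integrable_planeWave_mul (A := 1) hk hC (g := fun _ => 1) continuous_const
      (fun s => by simp only [norm_one, one_mul]; nlinarith [sq_nonneg s]) hpq
    simpa using this

/-- The superposition of plane waves depends only on the length of the vector. -/
lemma integral_planeWave_eq_of_sq_add_sq {p q r : ℝ} (hr : 0 < r) (hpq2 : p ^ 2 + q ^ 2 = r ^ 2)
    (hpq : 2 * C * ‖k‖ * |q| < (lam k).re * p) :
    ∫ s, planeWave k p q s * dens k s = ∫ s, planeWave k r 0 s * dens k s := by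
  have hC1 := hC.1
  have hlam := lam_re_pos hk
  have hp0 : 0 < p := by
    have : 0 ≤ 2 * C * ‖k‖ * |q| := by positivity
    by_contra h
    nlinarith
  set t₁ : ℝ := Real.arcsin (q / r)
  have hqr : |q / r| ≤ 1 := by
    rw [abs_div, abs_of_pos hr, div_le_one hr]
    exact abs_le_of_sq_le_sq (by nlinarith [sq_nonneg p]) hr.le
  have hsin : Real.sin t₁ = q / r := Real.sin_arcsin (abs_le.1 hqr).1 (abs_le.1 hqr).2
  have hcos : Real.cos t₁ = p / r := by
    rw [Real.cos_arcsin, Real.sqrt_eq_iff_mul_self_eq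
      (by nlinarith [abs_le.1 hqr, sq_abs (q / r), abs_nonneg (q / r)]) (by positivity)]
    field_simp
    linarith
  -- Turning `(p, q)` back to `(r, 0)` increases the cosine and decreases the modulus of the sine,
  -- so the cone condition persists along the whole arc.
  have hrange : ∀ t ∈ Set.uIcc 0 t₁,
      2 * C * ‖k‖ * |r * Real.sin t| < (lam k).re * (r * Real.cos t) := by
    intro t ht
    have hpi : |t₁| ≤ Real.pi / 2 :=
      abs_le.2 ⟨Real.neg_pi_div_two_le_arcsin _, Real.arcsin_le_pi_div_two _⟩
    have htt : |t| ≤ |t₁| := by simpa using Set.abs_sub_left_of_mem_uIcc ht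
    have h1 : Real.cos t₁ ≤ Real.cos t := by
      rw [← Real.cos_abs t₁, ← Real.cos_abs t]
      exact Real.cos_le_cos_of_nonneg_of_le_pi (abs_nonneg _)
        (by linarith [Real.pi_pos]) htt
    have h2 : |Real.sin t| ≤ |Real.sin t₁| := by
      refine sq_le_sq.1 ?_
      have := Real.cos_nonneg_of_neg_pi_div_two_le_of_le (neg_le_of_abs_le hpi) (le_of_abs_le hpi)
      nlinarith [Real.sin_sq_add_cos_sq t, Real.sin_sq_add_cos_sq t₁]
    calc 2 * C * ‖k‖ * |r * Real.sin t| ≤ 2 * C * ‖k‖ * |r * Real.sin t₁| := by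
          rw [abs_mul, abs_mul]; gcongr
      _ = 2 * C * ‖k‖ * |q| := by rw [hsin]; congr 2; field_simp
      _ < (lam k).re * p := hpq
      _ = (lam k).re * (r * Real.cos t₁) := by rw [hcos]; field_simp
      _ ≤ _ := by gcongr
  set G : ℝ → ℂ := fun t => ∫ s, planeWave k (r * Real.cos t) (r * Real.sin t) s * dens k s
  have hG : ∀ t ∈ Set.uIcc 0 t₁, HasDerivAt G 0 t := by
    intro t ht
    have h := hasDerivAt_integral_planeWave (A := C) hk hC (continuous_dens hk)
      (fun s => (hC.2 s).1.trans (by nlinarith [sq_nonneg s]))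
      (p := fun t => r * Real.cos t) (q := fun t => r * Real.sin t)
      (p' := fun t => r * -Real.sin t) (q' := fun t => r * Real.cos t) (t₀ := t)
      (Eventually.of_forall fun t => (Real.hasDerivAt_cos t).const_mul r)
      (Eventually.of_forall fun t => (Real.hasDerivAt_sin t).const_mul r)
      (by fun_prop) (by fun_prop) (hrange t ht)
    refine h.congr_deriv ?_
    have h0 := integral_planeWave_angular_eq_zero hk hC (hrange t ht)
    -- Rotating the real vector and moving along the path have the same effect up to the factor `i`,
    -- so the angular derivative is `i` times an integral already known to vanish.
    rw [← mul_zero Complex.I, ← h0, ← integral_const_mul]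
    congr 1
    ext s
    push_cast
    ring
  have hconst : G t₁ = G 0 := by
    have := (convex_uIcc 0 t₁).norm_image_sub_le_of_norm_hasDerivWithin_le (C := 0)
      (fun t ht => (hG t ht).hasDerivWithinAt) (by simp) Set.left_mem_uIcc Set.right_mem_uIcc
    rw [zero_mul, norm_le_zero_iff, sub_eq_zero] at this
    exact this
  have h1 : G t₁ = ∫ s, planeWave k p q s * dens k s := by
    simp only [G, hsin, hcos]
    rw [mul_div_cancel₀ _ hr.ne', mul_div_cancel₀ _ hr.ne']
  rw [← h1, hconst]
  simp [G]

end waves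

/-! ### The Laplace transform of the logarithm -/

lemma abs_log_le_rpow {v : ℝ} (hv : 0 < v) :
    |Real.log v| ≤ 2 * (v ^ (1 / 2 : ℝ) + v ^ (-(1 / 2) : ℝ)) := by
  have h1 : Real.log (v ^ (1 / 2 : ℝ)) = 1 / 2 * Real.log v := Real.log_rpow hv _
  have h2 : Real.log (v ^ (-(1 / 2) : ℝ)) = -(1 / 2) * Real.log v := Real.log_rpow hv _
  have h3 := Real.log_le_self (Real.rpow_nonneg hv.le (1 / 2))
  have h4 := Real.log_le_self (Real.rpow_nonneg hv.le (-(1 / 2)))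
  have h5 : 0 < v ^ (1 / 2 : ℝ) := by positivity
  have h6 : 0 < v ^ (-(1 / 2) : ℝ) := by positivity
  rw [abs_le]
  constructor <;> linarith

lemma integrableOn_rpow_mul_exp_neg {s c : ℝ} (hs : -1 < s) (hc : 0 < c) :
    IntegrableOn (fun v : ℝ => v ^ s * Real.exp (-c * v)) (Set.Ioi 0) := by
  simpa using integrableOn_rpow_mul_exp_neg_mul_rpow hs one_pos hc

lemma integrableOn_exp_neg_mul_log {l : ℂ} (hl : 0 < l.re) :
    IntegrableOn (fun v : ℝ => Complex.exp (-l * v) * (Real.log v : ℂ)) (Set.Ioi 0) := by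
  refine (((integrableOn_rpow_mul_exp_neg (s := 1 / 2) (by norm_num) hl).add
    (integrableOn_rpow_mul_exp_neg (s := -(1 / 2)) (by norm_num) hl)).const_mul 2).mono'
    ((by fun_prop : Measurable fun v : ℝ =>
      Complex.exp (-l * v) * (Real.log v : ℂ)).aestronglyMeasurable) ?_
  filter_upwards [ae_restrict_mem measurableSet_Ioi] with v hv
  have hv : 0 < v := hv
  rw [norm_mul, Complex.norm_exp, Complex.norm_real, Real.norm_eq_abs, Complex.re_mul_ofReal,
    Complex.neg_re]
  calc Real.exp (-l.re * v) * |Real.log v|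
      ≤ Real.exp (-l.re * v) * (2 * (v ^ (1 / 2 : ℝ) + v ^ (-(1 / 2) : ℝ))) := by
        gcongr; exact abs_log_le_rpow hv
    _ = _ := by simp only [Pi.add_apply]; ring

/-- The Laplace transform of the logarithm. -/
def laplaceLog (l : ℂ) : ℂ := ∫ v in Set.Ioi (0 : ℝ), Complex.exp (-l * v) * (Real.log v : ℂ)

lemma differentiableAt_laplaceLog {l : ℂ} (hl : 0 < l.re) : DifferentiableAt ℂ laplaceLog l := by
  have hc : 0 < l.re / 2 := half_pos hl
  have hs : {z : ℂ | l.re / 2 < z.re} ∈ 𝓝 l :=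
    (isOpen_lt continuous_const Complex.continuous_re).mem_nhds
      (show l.re / 2 < l.re by linarith)
  refine (hasDerivAt_integral_of_dominated_loc_of_deriv_le
    (F := fun (z : ℂ) (v : ℝ) => Complex.exp (-z * v) * (Real.log v : ℂ))
    (F' := fun (z : ℂ) (v : ℝ) => Complex.exp (-z * v) * (-1 * (v : ℂ)) * (Real.log v : ℂ))
    (bound := fun v : ℝ => 2 * (v ^ (3 / 2 : ℝ) * Real.exp (-(l.re / 2) * v) +
      v ^ (1 / 2 : ℝ) * Real.exp (-(l.re / 2) * v)))
    hs (Eventually.of_forall fun z => ?_) (integrableOn_exp_neg_mul_log hl) ?_ ?_ ?_ ?_).2.differentiableAt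
  · exact (by fun_prop : Measurable fun v : ℝ =>
      Complex.exp (-z * v) * (Real.log v : ℂ)).aestronglyMeasurable
  · exact (by fun_prop : Measurable fun v : ℝ =>
      Complex.exp (-l * v) * (-1 * (v : ℂ)) * (Real.log v : ℂ)).aestronglyMeasurable
  · filter_upwards [ae_restrict_mem measurableSet_Ioi] with v hv z hz
    have hv : 0 < v := hv
    have hz : l.re / 2 < z.re := hz
    rw [norm_mul, norm_mul, norm_mul, norm_neg, norm_one, one_mul, Complex.norm_exp,
      Complex.norm_real, Complex.norm_real, Real.norm_eq_abs, Real.norm_eq_abs, abs_of_pos hv,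
      Complex.re_mul_ofReal, Complex.neg_re]
    calc Real.exp (-z.re * v) * v * |Real.log v|
        ≤ Real.exp (-(l.re / 2) * v) * v * (2 * (v ^ (1 / 2 : ℝ) + v ^ (-(1 / 2) : ℝ))) := by
          gcongr; exact abs_log_le_rpow hv
      _ = 2 * (v * v ^ (1 / 2 : ℝ) * Real.exp (-(l.re / 2) * v) +
            v * v ^ (-(1 / 2) : ℝ) * Real.exp (-(l.re / 2) * v)) := by ring
      _ = _ := by
        rw [← Real.rpow_one_add' hv.le (by norm_num), ← Real.rpow_one_add' hv.le (by norm_num)]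
        norm_num
  · exact ((integrableOn_rpow_mul_exp_neg (by norm_num) hc).add
      (integrableOn_rpow_mul_exp_neg (by norm_num) hc)).const_mul 2
  · filter_upwards with v z hz
    have h := (((hasDerivAt_id z).neg.mul_const (v : ℂ)).cexp).mul_const (Real.log v : ℂ)
    exact h

/-- This is `Γ'(1) = -γ`, with the derivative taken under Euler's integral. -/
lemma laplaceLog_one : laplaceLog 1 = -(Real.eulerMascheroniConstant : ℂ) := by
  have h1 := Complex.hasDerivAt_GammaIntegral (s := 1) (by simp)
  have h2 : Complex.Gamma =ᶠ[𝓝 1] Complex.GammaIntegral := by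
    have : {z : ℂ | 0 < z.re} ∈ 𝓝 (1 : ℂ) :=
      (isOpen_lt continuous_const Complex.continuous_re).mem_nhds (by simp)
    filter_upwards [this] with z hz using Complex.Gamma_eq_integral hz
  have h3 := (h1.congr_of_eventuallyEq h2).unique Complex.hasDerivAt_Gamma_one
  rw [← h3, laplaceLog]
  refine setIntegral_congr_fun measurableSet_Ioi fun v _ => ?_
  simp only [sub_self, Complex.cpow_zero, one_mul]
  push_cast
  ring_nf

lemma mul_laplaceLog_ofReal {t : ℝ} (ht : 0 < t) :
    (t : ℂ) * laplaceLog t = -(Real.eulerMascheroniConstant : ℂ) - Complex.log t := by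
  have h1 := integral_comp_mul_left_Ioi
    (fun v : ℝ => Complex.exp (-1 * v) * (Real.log v : ℂ)) 0 ht
  have h2 : ∫ v in Set.Ioi (0 : ℝ), Complex.exp (-1 * v) * (Real.log v : ℂ)
    = -(Real.eulerMascheroniConstant : ℂ) := laplaceLog_one
  rw [mul_zero, h2] at h1
  have h3 : ∫ v in Set.Ioi (0 : ℝ), Complex.exp (-1 * (t * v : ℝ)) * (Real.log (t * v) : ℂ)
      = laplaceLog t + Complex.log t * (1 / t) := by
    have h4 : ∫ v in Set.Ioi (0 : ℝ), Complex.exp (-(t : ℂ) * v) = 1 / t := by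
      rw [integral_exp_mul_complex_Ioi (by simpa using ht)]
      simp
    have h5 : IntegrableOn (fun v : ℝ => Complex.exp (-(t : ℂ) * v)) (Set.Ioi 0) :=
      integrableOn_exp_mul_complex_Ioi (by simpa using ht) 0
    rw [← h4, laplaceLog, ← integral_const_mul,
      ← integral_add (integrableOn_exp_neg_mul_log (by simpa using ht)) (h5.const_mul _)]
    refine setIntegral_congr_fun measurableSet_Ioi fun v hv => ?_
    have hv : 0 < v := hv
    rw [Real.log_mul ht.ne' hv.ne', ← Complex.ofReal_log ht.le]
    push_cast
    ring_nf
  rw [h3] at h1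
  have ht' : (t : ℂ) ≠ 0 := by exact_mod_cast ht.ne'
  rw [Complex.real_smul] at h1
  push_cast at h1
  field_simp at h1
  linear_combination h1

/-- For positive reals the scaling `v ↦ t v` reduces to the value at `1`. Both sides are holomorphic
on the right half-plane, and the positive reals accumulate at `1`, so the identity theorem extends
the formula to `λ = √k`. -/
lemma mul_laplaceLog {l : ℂ} (hl : 0 < l.re) :
    l * laplaceLog l = -(Real.eulerMascheroniConstant : ℂ) - Complex.log l := by
  have ho : IsOpen {z : ℂ | 0 < z.re} := isOpen_lt continuous_const Complex.continuous_re
  have hf : AnalyticOnNhd ℂ (fun l => l * laplaceLog l) {z : ℂ | 0 < z.re} :=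
    DifferentiableOn.analyticOnNhd (fun z hz =>
      (differentiableAt_id.mul (differentiableAt_laplaceLog hz)).differentiableWithinAt) ho
  have hg : AnalyticOnNhd ℂ (fun l => -(Real.eulerMascheroniConstant : ℂ) - Complex.log l)
      {z : ℂ | 0 < z.re} :=
    DifferentiableOn.analyticOnNhd (fun z hz =>
      ((differentiableAt_const _).sub (Complex.differentiableAt_log
        (Complex.mem_slitPlane_iff.2 (Or.inl hz)))).differentiableWithinAt) ho
  refine hf.eqOn_of_preconnected_of_frequently_eq hg (convex_halfSpace_re_gt 0).isPreconnected
    (z₀ := 1) (by simp) ?_ hl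
  have ht : Tendsto (fun t : ℝ => (t : ℂ)) (𝓝[≠] 1) (𝓝[≠] 1) := by
    refine tendsto_nhdsWithin_iff.2 ⟨?_, ?_⟩
    · exact (Complex.continuous_ofReal.tendsto' 1 1 (by simp)).mono_left nhdsWithin_le_nhds
    · filter_upwards [self_mem_nhdsWithin] with t ht
      simpa using ht
  refine ht.frequently (Eventually.frequently ?_)
  filter_upwards [nhdsWithin_le_nhds (lt_mem_nhds zero_lt_one)] with t ht0
  exact mul_laplaceLog_ofReal ht0

/-! ### The plane wave representation of the Hankel function -/

/-- The superposition of plane waves that represents the Hankel function. -/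
def besselIntegral (k : ℂ) (r : ℝ) : ℂ := ∫ s, planeWave k r 0 s * dens k s

/-- An antiderivative of the density of the path. -/
def arcPrim (k : ℂ) (s : ℝ) : ℂ := 2 * Complex.log (sig k * s + rad k s)

section

variable {k : ℂ} (hk : k ∈ Complex.slitPlane)
include hk

lemma isBesselPair_besselIntegral : ∃ p, IsBesselPair k (besselIntegral k) p := by
  obtain ⟨C, hC⟩ : ∃ C, PathBound k C := exists_path_bounds hk
  have hC1 := hC.1
  have hlam := lam_re_pos hk
  have hcC := continuous_dirC (k := k)
  have hcS := continuous_dirS hk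
  have hcd := continuous_dens hk
  set g : ℝ → ℂ := fun s => Complex.I * k * dirC k s * dens k s with hg
  have hgc : Continuous g := by fun_prop
  have hgA : ∀ s, ‖g s‖ ≤ (‖k‖ * (2 * C) * C) * (1 + s ^ 2) := by
    intro s
    simp only [hg, norm_mul, Complex.norm_I, one_mul]
    calc ‖k‖ * ‖dirC k s‖ * ‖dens k s‖ ≤ ‖k‖ * (2 * C * (1 + s ^ 2)) * C := by
          gcongr
          exacts [hC.norm_dirC_le s, (hC.2 s).1]
      _ = _ := by ring
  refine ⟨fun r => r * ∫ s, planeWave k r 0 s * g s, fun r hr => ?_⟩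
  have hcone : 2 * C * ‖k‖ * |(0 : ℝ)| < (lam k).re * r := by
    rw [abs_zero, mul_zero]; positivity
  have hr' : (r : ℂ) ≠ 0 := by exact_mod_cast hr.ne'
  have hd : ∀ {h : ℝ → ℂ} {A : ℝ}, Continuous h → (∀ s, ‖h s‖ ≤ A * (1 + s ^ 2)) →
      HasDerivAt (fun r : ℝ => ∫ s, planeWave k r 0 s * h s)
        (∫ s, planeWave k r 0 s * (Complex.I * k * dirC k s * h s)) r := by
    intro h A hh hA
    have := hasDerivAt_integral_planeWave hk hC hh hA (p := fun t => t) (q := fun _ => 0)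
      (p' := fun _ => 1) (q' := fun _ => 0) (t₀ := r)
      (Eventually.of_forall fun t => hasDerivAt_id t)
      (Eventually.of_forall fun t => hasDerivAt_const t 0)
      continuousAt_const continuousAt_const hcone
    simpa using this
  constructor
  · refine (hd (A := C) hcd (fun s => (hC.2 s).1.trans (by nlinarith [sq_nonneg s]))).congr_deriv ?_
    exact (mul_div_cancel_left₀ _ hr').symm
  · have h1 := ((hasDerivAt_id r).ofReal_comp).mul (hd hgc hgA)
    refine h1.congr_deriv ?_
    have i1 : Integrable fun s => planeWave k r 0 s * g s :=
      integrable_planeWave_mul hk hC hgc (fun s => (hgA s).trans (by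
        gcongr; nlinarith [sq_nonneg s])) hcone
    have i2 : Integrable fun s => planeWave k r 0 s * (Complex.I * k * dirC k s * g s) := by
      refine integrable_planeWave_mul (A := ‖k‖ * (2 * C) * (‖k‖ * (2 * C) * C)) hk hC
        (by fun_prop) (fun s => ?_) hcone
      simp only [norm_mul, Complex.norm_I, one_mul]
      calc ‖k‖ * ‖dirC k s‖ * ‖g s‖
          ≤ ‖k‖ * (2 * C * (1 + s ^ 2)) * ((‖k‖ * (2 * C) * C) * (1 + s ^ 2)) := by
            gcongr
            exacts [hC.norm_dirC_le s, hgA s]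
        _ = _ := by ring
    have i3 : Integrable fun s => planeWave k r 0 s * dens k s :=
      integrable_planeWave_mul (A := C) hk hC hcd (fun s => (hC.2 s).1.trans (by
        nlinarith [sq_nonneg s, sq_nonneg (s ^ 2)])) hcone
    have i4 : Integrable fun s => planeWave k r 0 s * dirS k s := by
      refine integrable_planeWave_mul (A := 2 * C) hk hC hcS (fun s =>
        (hC.norm_dirS_le s).trans ?_) hcone
      gcongr
      nlinarith [sq_nonneg s]
    -- Bessel's equation under the integral sign: applied to the integrand it leaves the
    -- `s`-derivative of `k · planeWave · dirS`, whose integral is zero.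
    have key : ∫ s, (planeWave k r 0 s * g s + r * (planeWave k r 0 s *
        (Complex.I * k * dirC k s * g s)) + k ^ 2 * r * (planeWave k r 0 s * dens k s)) = 0 := by
      have hder : ∀ s, HasDerivAt (fun s => k * (planeWave k r 0 s * dirS k s))
          (planeWave k r 0 s * g s + r * (planeWave k r 0 s *
        (Complex.I * k * dirC k s * g s)) + k ^ 2 * r * (planeWave k r 0 s * dens k s)) s := by
        intro s
        refine (((hasDerivAt_planeWave hk r 0 s).mul (hasDerivAt_dirS hk s)).const_mul
          k).congr_deriv ?_
        have e1 := dirC_sq_add_dirS_sq k s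
        simp only [hg, Complex.ofReal_zero]
        linear_combination (k ^ 2 * r * planeWave k r 0 s * dens k s) * e1
          - (k ^ 2 * r * planeWave k r 0 s * dens k s * dirC k s ^ 2) * Complex.I_sq
      exact integral_eq_zero_of_hasDerivAt_of_integrable hder
        ((i1.add (i2.const_mul _)).add (i3.const_mul _)) (i4.const_mul k)
    have i12 : Integrable fun s => planeWave k r 0 s * g s +
        r * (planeWave k r 0 s * (Complex.I * k * dirC k s * g s)) := i1.add (i2.const_mul _)
    rw [integral_add i12 (i3.const_mul _),
      integral_add i1 (i2.const_mul _), integral_const_mul, integral_const_mul] at key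
    simp only [id, Complex.ofReal_one, one_mul, besselIntegral]
    linear_combination key

/-! ### The primitive of the path density and its logarithmic growth -/

lemma arcPrim_arg_re_pos {s : ℝ} (hs : 0 ≤ s) : 0 < (sig k * s + rad k s).re := by
  have h1 := sig_re_pos hk
  have h2 := rad_re_pos hk s
  rw [Complex.add_re, Complex.re_mul_ofReal]
  positivity

lemma hasDerivAt_arcPrim {s : ℝ} (hs : 0 ≤ s) : HasDerivAt (arcPrim k) (dens k s) s := by
  have h0 := arcPrim_arg_re_pos hk hs
  have h1 : HasDerivAt (fun s : ℝ => sig k * s + rad k s) (sig k * 1 + tau k * s / rad k s) s := by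
    have := ((hasDerivAt_id s).ofReal_comp.const_mul (sig k)).add (hasDerivAt_rad hk s)
    refine this.congr_deriv (by simp)
  refine ((h1.clog_real (Complex.mem_slitPlane_iff.2 (Or.inl h0))).const_mul 2).congr_deriv ?_
  have h2 : sig k * s + rad k s ≠ 0 := fun h => by simp [h] at h0
  have h3 := rad_ne_zero hk s
  rw [dens, ← sig_sq]
  field_simp
  ring

lemma exists_norm_arcPrim_le : ∃ C : ℝ, 0 ≤ C ∧ ∀ s, 0 ≤ s → ‖arcPrim k s‖ ≤ C * s := by
  obtain ⟨C, hC1, hC⟩ := exists_path_bounds hk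
  refine ⟨C, by linarith, fun s hs => ?_⟩
  have := (convex_Ici (0 : ℝ)).norm_image_sub_le_of_norm_hasDerivWithin_le
    (fun t ht => (hasDerivAt_arcPrim hk ht).hasDerivWithinAt) (fun t _ => (hC t).1)
    (Set.mem_Ici.2 le_rfl) (Set.mem_Ici.2 hs)
  simpa [arcPrim, rad_zero, abs_of_nonneg hs] using this

/-- `arcPrim` is logarithmic at infinity. -/
lemma exists_norm_arcPrim_sub_log_le : ∃ K : ℝ, 0 ≤ K ∧ ∀ s, 0 < s →
    ‖arcPrim k s - 2 * (Real.log s : ℂ) - 2 * Complex.log (2 * sig k)‖ ≤ K / s := by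
  obtain ⟨c, hc, hcr⟩ := exists_le_norm_rad hk
  have hsig := sig_re_pos hk
  set K : ℝ := 2 / (c * (sig k).re)
  have hK : 0 ≤ K := by positivity
  -- Inverting `x = 1 / s` moves infinity to `0`. A bounded derivative in `x` together with a limit
  -- at `0⁺` then yields an error `K x = K / s`.
  set f : ℝ → ℂ := fun x => arcPrim k x⁻¹ - 2 * (Real.log x⁻¹ : ℂ) with hf
  have hder : ∀ x ∈ Set.Ioi (0 : ℝ), HasDerivAt f
      ((-(x ^ 2)⁻¹ : ℝ) • (dens k x⁻¹ - 2 * (((x⁻¹)⁻¹ : ℝ) : ℂ))) x := by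
    intro x hx
    have hx : 0 < x := hx
    have h1 := (hasDerivAt_arcPrim hk (inv_pos.2 hx).le).sub
      ((Real.hasDerivAt_log (inv_pos.2 hx).ne').ofReal_comp.const_mul (2 : ℂ))
    exact h1.scomp x (hasDerivAt_inv hx.ne')
  have hbound : ∀ x ∈ Set.Ioi (0 : ℝ),
      ‖(-(x ^ 2)⁻¹ : ℝ) • (dens k x⁻¹ - 2 * (((x⁻¹)⁻¹ : ℝ) : ℂ))‖ ≤ K := by
    intro x hx
    have hx : 0 < x := hx
    set s := x⁻¹ with hs
    have hs0 : 0 < s := inv_pos.2 hx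
    have hs' : (s : ℂ) ≠ 0 := by exact_mod_cast hs0.ne'
    have h0 := arcPrim_arg_re_pos hk hs0.le
    have h2 : sig k * s + rad k s ≠ 0 := fun h => by simp [h] at h0
    have h3 := rad_ne_zero hk s
    have h4 := rad_sq k s
    have h5 := sig_sq k
    -- Since `rad² = 1 + σ² s²`, the leading terms cancel after multiplying by `σ s + rad`.
    have e : dens k s - 2 * ((s⁻¹ : ℝ) : ℂ) = -2 / (s * rad k s * (sig k * s + rad k s)) := by
      rw [dens]
      push_cast
      field_simp
      rw [← h5] at h4
      linear_combination -h4
    have h6 : (sig k).re * s ≤ ‖sig k * s + rad k s‖ := by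
      refine le_trans ?_ (Complex.re_le_norm _)
      rw [Complex.add_re, Complex.re_mul_ofReal]
      linarith [rad_re_pos hk s]
    rw [e, norm_smul, norm_neg, Real.norm_of_nonneg (by positivity), ← inv_pow, ← hs, norm_div,
      norm_mul, norm_mul, norm_neg, Complex.norm_ofNat, Complex.norm_real,
      Real.norm_of_nonneg hs0.le]
    calc s ^ 2 * (2 / (s * ‖rad k s‖ * ‖sig k * s + rad k s‖))
        ≤ s ^ 2 * (2 / (s * c * ((sig k).re * s))) := by
          gcongr
          exact hcr s
      _ = K := by simp only [K]; field_simp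
  have hlim : Tendsto f (𝓝[>] 0) (𝓝 (2 * Complex.log (2 * sig k))) := by
    have him : ∀ x : ℝ, (x : ℂ) ^ 2 + tau k ∈ Complex.slitPlane := fun x => by
      rw [Complex.mem_slitPlane_iff, ← Complex.ofReal_pow, Complex.add_im, Complex.ofReal_im,
        zero_add]
      exact Or.inr (tau_im_pos hk).ne'
    have h1 : ∀ x ∈ Set.Ioi (0 : ℝ), f x
        = 2 * Complex.log (sig k + Complex.sqrt ((x : ℂ) ^ 2 + tau k)) := by
      intro x hx
      have hx : 0 < x := hx
      have hx' : (x : ℂ) ≠ 0 := by exact_mod_cast hx.ne'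
      have e1 : Complex.sqrt ((x : ℂ) ^ 2 + tau k) = x * rad k x⁻¹ := by
        have e2 := sq_sqrt ((x : ℂ) ^ 2 + tau k)
        have e3 := rad_sq k x⁻¹
        push_cast at e3
        -- The two candidates have equal squares, and both have positive real part, so they are the
        -- same square root.
        have e4 : (Complex.sqrt ((x : ℂ) ^ 2 + tau k) - x * rad k x⁻¹) *
            (Complex.sqrt ((x : ℂ) ^ 2 + tau k) + x * rad k x⁻¹) = 0 := by
          have e5 : (x : ℂ) ^ 2 * rad k x⁻¹ ^ 2 = (x : ℂ) ^ 2 + tau k := by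
            rw [e3]; field_simp
          linear_combination e2 - e5
        refine sub_eq_zero.1 ((mul_eq_zero.1 e4).resolve_right fun h => ?_)
        have e6 := sqrt_re_pos (him x)
        have e7 := mul_pos hx (rad_re_pos hk x⁻¹)
        have e8 := congrArg Complex.re h
        rw [Complex.add_re, Complex.re_ofReal_mul, Complex.zero_re] at e8
        linarith
      have e2 : sig k * ((x⁻¹ : ℝ) : ℂ) + rad k x⁻¹
          = ((x⁻¹ : ℝ) : ℂ) * (sig k + x * rad k x⁻¹) := by
        push_cast; field_simp
      have e3 : sig k + x * rad k x⁻¹ ≠ 0 := fun h => by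
        have e4 := arcPrim_arg_re_pos hk (inv_pos.2 hx).le
        rw [e2, h] at e4
        simp at e4
      simp only [hf]
      rw [arcPrim, e2, Complex.log_ofReal_mul (inv_pos.2 hx) e3, e1]
      ring
    have h2 : ContinuousAt (fun x : ℝ =>
        2 * Complex.log (sig k + Complex.sqrt ((x : ℂ) ^ 2 + tau k))) 0 := by
      have e1 : ContinuousAt (fun x : ℝ => Complex.sqrt ((x : ℂ) ^ 2 + tau k)) 0 :=
        ContinuousAt.comp (g := Complex.sqrt) (hasDerivAt_sqrt (him 0)).continuousAt
          (by fun_prop)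
      refine continuousAt_const.mul ((continuousAt_const.add e1).clog ?_)
      refine Complex.mem_slitPlane_iff.2 (Or.inl ?_)
      exact add_pos hsig (sqrt_re_pos (him 0))
    have h3 : (2 : ℂ) * Complex.log (sig k + Complex.sqrt (((0 : ℝ) : ℂ) ^ 2 + tau k))
        = 2 * Complex.log (2 * sig k) := by
      rw [Complex.ofReal_zero, zero_pow two_ne_zero, zero_add, ← sig, ← two_mul]
    rw [← h3]
    refine (h2.tendsto.mono_left nhdsWithin_le_nhds).congr' ?_
    filter_upwards [self_mem_nhdsWithin] with x hx using (h1 x hx).symm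
  refine ⟨K, hK, fun s hs => ?_⟩
  have h1 : ∀ y ∈ Set.Ioi (0 : ℝ), ‖f s⁻¹ - f y‖ ≤ K * ‖s⁻¹ - y‖ := fun y hy =>
    (convex_Ioi (0 : ℝ)).norm_image_sub_le_of_norm_hasDerivWithin_le
      (fun t ht => (hder t ht).hasDerivWithinAt) hbound hy (inv_pos.2 hs)
  have h2 : Tendsto (fun y => ‖f s⁻¹ - f y‖) (𝓝[>] 0)
      (𝓝 ‖f s⁻¹ - 2 * Complex.log (2 * sig k)‖) := (tendsto_const_nhds.sub hlim).norm
  have h3 : Tendsto (fun y : ℝ => K * ‖s⁻¹ - y‖) (𝓝[>] 0) (𝓝 (K * ‖s⁻¹ - 0‖)) :=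
    Tendsto.mono_left (Continuous.tendsto (by fun_prop) 0) nhdsWithin_le_nhds
  have h4 := le_of_tendsto_of_tendsto h2 h3 (by
    filter_upwards [self_mem_nhdsWithin] with y hy using h1 y hy)
  rw [sub_zero, Real.norm_of_nonneg (inv_pos.2 hs).le, ← div_eq_mul_inv] at h4
  simpa only [hf, inv_inv] using h4

lemma log_lam : Complex.log (lam k) = Complex.log k / 2 := by
  have h1 := Complex.neg_pi_lt_arg k
  have h2 := Complex.arg_le_pi k
  have him : (Complex.log k / 2).im = k.arg / 2 := by
    rw [show Complex.log k / 2 = ((1 / 2 : ℝ) : ℂ) * Complex.log k by push_cast; ring,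
      Complex.im_ofReal_mul, Complex.log_im]
    ring
  rw [lam, sqrt_eq_exp (Complex.slitPlane_ne_zero hk), Complex.log_exp]
  · rw [him]; linarith [Real.pi_pos]
  · rw [him]; linarith [Real.pi_pos]

/-- Here the branches are fixed. As `|arg k| < π`, the argument `π/2 - arg k / 2` of `τ` lies in
`(0, π)`, so every logarithm involved is principal. The resulting term `iπ/2` accounts for the `J₀`
summand of the Hankel function. -/
lemma two_mul_log_two_mul_sig : 2 * Complex.log (2 * sig k)
    = Complex.log 2 + Real.pi / 2 * Complex.I - Complex.log k / 2 := by
  have hpi := Real.pi_pos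
  have h1 := Complex.neg_pi_lt_arg k
  have h2 : k.arg < Real.pi := lt_of_le_of_ne (Complex.arg_le_pi k)
    (Complex.mem_slitPlane_iff_arg.1 hk).1
  have hlog2 : Complex.log 2 = (Real.log 2 : ℂ) := by
    rw [Complex.ofReal_log (by norm_num)]; norm_num
  have hlam : lam k = Complex.exp (Complex.log k / 2) :=
    sqrt_eq_exp (Complex.slitPlane_ne_zero hk)
  set z : ℂ := Real.pi / 2 * Complex.I - (Real.log 2 : ℂ) - Complex.log k / 2 with hz
  have hzim : z.im = Real.pi / 2 - k.arg / 2 := by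
    rw [hz, show (Real.pi : ℂ) / 2 * Complex.I - (Real.log 2 : ℂ) - Complex.log k / 2
      = ((Real.pi / 2 : ℝ) : ℂ) * Complex.I - ((Real.log 2 : ℝ) : ℂ)
        - ((1 / 2 : ℝ) : ℂ) * Complex.log k by push_cast; ring,
      Complex.sub_im, Complex.sub_im, Complex.im_ofReal_mul, Complex.im_ofReal_mul,
      Complex.log_im, Complex.ofReal_im, Complex.I_im]
    ring
  have htau : tau k = Complex.exp z := by
    rw [hz, Complex.exp_sub, Complex.exp_sub, ← hlam, Complex.exp_pi_div_two_mul_I, ← hlog2,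
      Complex.exp_log two_ne_zero, tau, div_div]
  have hltau : Complex.log (tau k) = z := by
    rw [htau, Complex.log_exp]
    · rw [hzim]; linarith
    · rw [hzim]; linarith
  have htau0 : tau k ≠ 0 := by rw [htau]; exact Complex.exp_ne_zero _
  have hsig : sig k = Complex.exp (z / 2) := by rw [sig, sqrt_eq_exp htau0, hltau]
  have hz2 : (z / 2).im = z.im / 2 := by
    rw [show z / 2 = ((1 / 2 : ℝ) : ℂ) * z by push_cast; ring, Complex.im_ofReal_mul]
    ring
  have hlsig : Complex.log (sig k) = z / 2 := by
    rw [hsig, Complex.log_exp]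
    · rw [hz2, hzim]; linarith
    · rw [hz2, hzim]; linarith
  have : (2 : ℂ) * sig k = ((2 : ℝ) : ℂ) * sig k := by norm_num
  rw [this, Complex.log_ofReal_mul two_pos (sig_ne_zero hk), hlsig, hlog2, hz]
  ring

end

/-! ### The plane wave integral for small radius -/

lemma integral_eq_two_mul_of_even {f : ℝ → ℂ} (hf : Integrable f) (he : ∀ s, f (-s) = f s) :
    ∫ s, f s = 2 * ∫ s in Set.Ioi (0 : ℝ), f s := by
  have h1 : ∫ s in Set.Iic (0 : ℝ), f s = ∫ s in Set.Ioi (0 : ℝ), f s := by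
    have := integral_comp_neg_Iic 0 f
    rw [neg_zero] at this
    rw [← this]
    exact setIntegral_congr_fun measurableSet_Iic fun s _ => (he s).symm
  rw [← setIntegral_univ, ← Set.Iic_union_Ioi (a := (0 : ℝ)),
    setIntegral_union (Set.Iic_disjoint_Ioi le_rfl) measurableSet_Ioi hf.integrableOn
      hf.integrableOn, h1, two_mul]

section

variable {k : ℂ} (hk : k ∈ Complex.slitPlane)
include hk

lemma planeWave_zero_right (r s : ℝ) : planeWave k r 0 s
    = Complex.exp (Complex.I * k * r) * Complex.exp (-(lam k * r) * (s : ℂ) ^ 2) := by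
  rw [planeWave, ← Complex.exp_add]
  congr 1
  have := I_mul_k_mul_dirC hk s
  push_cast
  linear_combination (r : ℂ) * this

/-- The Gaussian integral in the factorization `besselIntegral k r = e^{ikr} * gaussDens k r`. -/
lemma besselIntegral_eq (r : ℝ) : besselIntegral k r = Complex.exp (Complex.I * k * r) *
    ∫ s : ℝ, Complex.exp (-(lam k * r) * (s : ℂ) ^ 2) * dens k s := by
  rw [besselIntegral, ← integral_const_mul]
  congr 1
  ext s
  rw [planeWave_zero_right hk, mul_assoc]

omit hk in
lemma norm_exp_neg_lam_mul_sq (r s : ℝ) :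
    ‖Complex.exp (-(lam k * r) * (s : ℂ) ^ 2)‖ = Real.exp (-((lam k).re * r) * s ^ 2) := by
  rw [Complex.norm_exp, ← Complex.ofReal_pow, Complex.re_mul_ofReal, Complex.neg_re,
    Complex.re_mul_ofReal]

/-- By evenness it suffices to integrate over the half-line. Integration by parts trades the density
for its primitive, and `v = r s²` turns the Gaussian into a Laplace kernel. Small `r` now only
enters through the large argument `√(v / r)` of `arcPrim`, where its logarithmic form is known. -/
lemma integral_gauss_dens_eq {r : ℝ} (hr : 0 < r) :
    ∫ s : ℝ, Complex.exp (-(lam k * r) * (s : ℂ) ^ 2) * dens k s =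
      2 * ∫ v in Set.Ioi (0 : ℝ), lam k * Complex.exp (-lam k * v) * arcPrim k √(r⁻¹ * v) := by
  have hb : 0 < (lam k).re * r := mul_pos (lam_re_pos hk) hr
  obtain ⟨C, hC1, hC⟩ := exists_path_bounds hk
  obtain ⟨C', hC'0, hC'⟩ := exists_norm_arcPrim_le hk
  have hr' : (r : ℂ) ≠ 0 := by exact_mod_cast hr.ne'
  have hcd := continuous_dens hk
  set E : ℝ → ℂ := fun s => Complex.exp (-(lam k * r) * (s : ℂ) ^ 2)
  have hEc : Continuous E := by fun_prop
  have hEn : ∀ s, ‖E s‖ = Real.exp (-((lam k).re * r) * s ^ 2) := norm_exp_neg_lam_mul_sq r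
  have hAc : ContinuousOn (arcPrim k) (Set.Ioi 0) := fun s hs =>
    (hasDerivAt_arcPrim hk (le_of_lt hs)).continuousAt.continuousWithinAt
  have i1 : Integrable fun s => E s * dens k s := by
    refine ((integrable_exp_neg_mul_sq hb).mul_const C).mono'
      (by fun_prop : Continuous fun s => E s * dens k s).aestronglyMeasurable
      (ae_of_all _ fun s => ?_)
    rw [norm_mul, hEn]
    gcongr
    exact (hC s).1
  have i2 : IntegrableOn (fun s => E s * arcPrim k s) (Set.Ioi 0) := by
    refine ((integrable_one_add_sq_pow_mul_exp hb).const_mul C').integrableOn.mono'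
      ((hEc.continuousOn.mul hAc).aestronglyMeasurable measurableSet_Ioi) ?_
    filter_upwards [ae_restrict_mem measurableSet_Ioi] with s hs
    have hs : 0 < s := hs
    rw [norm_mul, hEn]
    calc Real.exp (-((lam k).re * r) * s ^ 2) * ‖arcPrim k s‖
        ≤ Real.exp (-((lam k).re * r) * s ^ 2) * (C' * (1 + s ^ 2) ^ 2) := by
          gcongr
          refine (hC' s hs.le).trans ?_
          gcongr
          nlinarith [sq_nonneg (s - 1), sq_nonneg (s ^ 2)]
      _ = _ := by ring
  have i3 : IntegrableOn (fun s : ℝ => 2 * lam k * r * s * E s * arcPrim k s) (Set.Ioi 0) := by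
    refine ((integrable_one_add_sq_pow_mul_exp hb).const_mul
      (2 * ‖lam k‖ * r * C')).integrableOn.mono'
      ((ContinuousOn.mul (by fun_prop) hAc).aestronglyMeasurable measurableSet_Ioi) ?_
    filter_upwards [ae_restrict_mem measurableSet_Ioi] with s hs
    have hs : 0 < s := hs
    simp only [norm_mul, hEn, Complex.norm_ofNat, Complex.norm_real, Real.norm_of_nonneg hr.le,
      Real.norm_of_nonneg hs.le]
    calc 2 * ‖lam k‖ * r * s * Real.exp (-((lam k).re * r) * s ^ 2) * ‖arcPrim k s‖
        ≤ 2 * ‖lam k‖ * r * s * Real.exp (-((lam k).re * r) * s ^ 2) * (C' * s) := by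
          gcongr
          exact hC' s hs.le
      _ = 2 * ‖lam k‖ * r * C' * (s ^ 2 * Real.exp (-((lam k).re * r) * s ^ 2)) := by ring
      _ ≤ _ := by
          gcongr
          nlinarith [sq_nonneg s, sq_nonneg (s ^ 2)]
  have hder : ∀ s ∈ Set.Ici (0 : ℝ), HasDerivAt (fun s => E s * arcPrim k s)
      (E s * dens k s - 2 * lam k * r * s * E s * arcPrim k s) s := by
    intro s hs
    have h1 : HasDerivAt E (E s * (-(lam k * r) * (2 * s))) s := by
      have := (((hasDerivAt_id s).ofReal_comp.pow 2).const_mul (-(lam k * r))).cexp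
      refine this.congr_deriv ?_
      simp [E]
    refine (h1.mul (hasDerivAt_arcPrim hk hs)).congr_deriv ?_
    ring
  have hibp : ∫ s in Set.Ioi (0 : ℝ), E s * dens k s =
      ∫ s in Set.Ioi (0 : ℝ), 2 * lam k * r * s * E s * arcPrim k s := by
    have hint : IntegrableOn (fun s : ℝ => E s * dens k s -
      2 * lam k * r * s * E s * arcPrim k s) (Set.Ioi 0) := i1.integrableOn.sub i3
    have h0 := tendsto_zero_of_hasDerivAt_of_integrableOn_Ioi
      (fun s hs => hder s (Set.mem_Ici_of_Ioi hs)) hint i2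
    have h1 := integral_Ioi_of_hasDerivAt_of_tendsto' hder hint h0
    rw [integral_sub i1.integrableOn i3] at h1
    have h2 : arcPrim k 0 = 0 := by simp [arcPrim, rad_zero]
    rw [h2, mul_zero, sub_zero] at h1
    exact sub_eq_zero.1 h1
  set g : ℝ → ℂ := fun y => lam k * r * Complex.exp (-(lam k * r) * y) * arcPrim k √y
  have hsub : ∫ s in Set.Ioi (0 : ℝ), 2 * lam k * r * s * E s * arcPrim k s =
      ∫ y in Set.Ioi (0 : ℝ), g y := by
    rw [← integral_comp_rpow_Ioi_of_pos (g := g) two_pos]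
    refine setIntegral_congr_fun measurableSet_Ioi fun s hs => ?_
    have hs : 0 < s := hs
    have e1 : s ^ (2 - 1 : ℝ) = s := by norm_num
    have e2 : s ^ (2 : ℝ) = s ^ 2 := Real.rpow_two s
    simp only [g, E]
    rw [e1, e2, Real.sqrt_sq hs.le, Complex.real_smul]
    push_cast
    ring
  have hscale := integral_comp_mul_left_Ioi g 0 (inv_pos.2 hr)
  rw [mul_zero, inv_inv, Complex.real_smul] at hscale
  have hscale' : ∫ y in Set.Ioi (0 : ℝ), g y
      = (r : ℂ)⁻¹ * ∫ v in Set.Ioi (0 : ℝ), g (r⁻¹ * v) := by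
    rw [hscale]; field_simp
  rw [integral_eq_two_mul_of_even i1 (fun s => by simp [E, dens_neg]), hibp, hsub, hscale',
    ← integral_const_mul]
  congr 1
  refine setIntegral_congr_fun measurableSet_Ioi fun v _ => ?_
  have e : -(lam k * r) * ((r⁻¹ * v : ℝ) : ℂ) = -lam k * v := by
    push_cast; field_simp
  simp only [g]
  rw [e]
  field_simp

/-- Replacing `arcPrim` by its logarithmic form costs at most `K √(r / v)`, and `v^{-1/2}` is
integrable against the Laplace kernel. The main part is evaluated by `mul_laplaceLog` and
`two_mul_log_two_mul_sig`. -/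
lemma exists_norm_integral_gauss_dens_sub_le : ∃ K : ℝ, 0 ≤ K ∧ ∀ r : ℝ, 0 < r →
    ‖(∫ s : ℝ, Complex.exp (-(lam k * r) * (s : ℂ) ^ 2) * dens k s) -
      (Real.pi * Complex.I - 2 * (Complex.log k - Complex.log 2 + (Real.log r : ℂ) +
        (Real.eulerMascheroniConstant : ℂ)))‖ ≤ K * √r := by
  obtain ⟨K, hK0, hK⟩ := exists_norm_arcPrim_sub_log_le hk
  have hl := lam_re_pos hk
  have i0 := integrableOn_rpow_mul_exp_neg (s := -(1 / 2)) (by norm_num) hl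
  set B : ℝ := ∫ v in Set.Ioi (0 : ℝ), v ^ (-(1 / 2) : ℝ) * Real.exp (-(lam k).re * v)
  have hB : 0 ≤ B := setIntegral_nonneg measurableSet_Ioi fun v hv => by
    have : 0 < v := hv
    positivity
  refine ⟨2 * (‖lam k‖ * K * B), by positivity, fun r hr => ?_⟩
  set D : ℝ → ℂ := fun v => lam k * Complex.exp (-lam k * v) *
    (arcPrim k √(r⁻¹ * v) - ((Real.log v : ℂ) - Real.log r + 2 * Complex.log (2 * sig k)))
  have hlog : ∀ v : ℝ, 0 < v → 2 * (Real.log √(r⁻¹ * v) : ℂ) = (Real.log v : ℂ) - Real.log r := by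
    intro v hv
    rw [Real.log_sqrt (by positivity), Real.log_mul (by positivity) hv.ne', Real.log_inv]
    push_cast
    ring
  have hDle : ∀ v ∈ Set.Ioi (0 : ℝ), ‖D v‖ ≤
      ‖lam k‖ * K * √r * (v ^ (-(1 / 2) : ℝ) * Real.exp (-(lam k).re * v)) := by
    intro v hv
    have hv : 0 < v := hv
    have h1 := hK √(r⁻¹ * v) (by positivity)
    rw [hlog v hv, sub_sub] at h1
    simp only [D, norm_mul, Complex.norm_exp, Complex.re_mul_ofReal, Complex.neg_re]
    have h2 : K / √(r⁻¹ * v) = K * √r * v ^ (-(1 / 2) : ℝ) := by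
      rw [Real.rpow_neg hv.le, ← Real.sqrt_eq_rpow, Real.sqrt_mul (by positivity), Real.sqrt_inv]
      have : 0 < √r := by positivity
      have : 0 < √v := by positivity
      field_simp
    rw [h2] at h1
    calc _ ≤ ‖lam k‖ * Real.exp (-(lam k).re * v) * (K * √r * v ^ (-(1 / 2) : ℝ)) := by gcongr
      _ = _ := by ring
  have hAc : ContinuousOn (arcPrim k) (Set.Ioi 0) := fun s hs =>
    (hasDerivAt_arcPrim hk (le_of_lt hs)).continuousAt.continuousWithinAt
  have hAm : ContinuousOn (fun v : ℝ => arcPrim k √(r⁻¹ * v)) (Set.Ioi 0) :=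
    hAc.comp (by fun_prop) (fun v hv => by
      have : 0 < v := hv
      simp only [Set.mem_Ioi]
      positivity)
  have hDm : AEStronglyMeasurable D (volume.restrict (Set.Ioi 0)) := by
    refine ContinuousOn.aestronglyMeasurable ?_ measurableSet_Ioi
    refine ContinuousOn.mul (by fun_prop) (hAm.sub ?_)
    have : ContinuousOn (fun v : ℝ => ((Real.log v : ℝ) : ℂ)) (Set.Ioi 0) :=
      Complex.continuous_ofReal.comp_continuousOn
        (Real.continuousOn_log.mono fun v hv => (ne_of_gt hv : v ≠ 0))
    fun_prop
  have iD : IntegrableOn D (Set.Ioi 0) := by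
    refine (i0.const_mul (‖lam k‖ * K * √r)).mono' hDm ?_
    filter_upwards [ae_restrict_mem measurableSet_Ioi] with v hv using hDle v hv
  have iE : IntegrableOn (fun v : ℝ => Complex.exp (-lam k * v)) (Set.Ioi 0) :=
    integrableOn_exp_mul_complex_Ioi (by simpa using hl) 0
  have hE : ∫ v in Set.Ioi (0 : ℝ), Complex.exp (-lam k * v) = 1 / lam k := by
    rw [integral_exp_mul_complex_Ioi (by simpa using hl)]
    simp
  have iL := integrableOn_exp_neg_mul_log hl
  have hsplit : ∫ v in Set.Ioi (0 : ℝ), lam k * Complex.exp (-lam k * v) * arcPrim k √(r⁻¹ * v)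
      = lam k * laplaceLog (lam k) + (2 * Complex.log (2 * sig k) - Real.log r)
        + ∫ v in Set.Ioi (0 : ℝ), D v := by
    have h1 : lam k * laplaceLog (lam k) + (2 * Complex.log (2 * sig k) - Real.log r)
        = ∫ v in Set.Ioi (0 : ℝ), (lam k * (Complex.exp (-lam k * v) * (Real.log v : ℂ)) +
          lam k * (2 * Complex.log (2 * sig k) - Real.log r) * Complex.exp (-lam k * v)) := by
      rw [integral_add (iL.const_mul _) (iE.const_mul _), integral_const_mul, integral_const_mul,
        hE, laplaceLog]
      have := lam_ne_zero hk
      field_simp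
    have i1 : IntegrableOn (fun v : ℝ => (lam k * (Complex.exp (-lam k * v) * (Real.log v : ℂ)) +
          lam k * (2 * Complex.log (2 * sig k) - Real.log r) * Complex.exp (-lam k * v)))
        (Set.Ioi 0) := (iL.const_mul _).add (iE.const_mul _)
    rw [h1, ← integral_add i1 iD]
    refine setIntegral_congr_fun measurableSet_Ioi fun v _ => ?_
    simp only [D]
    ring
  have hconst : Real.pi * Complex.I - 2 * (Complex.log k - Complex.log 2 + (Real.log r : ℂ) +
        (Real.eulerMascheroniConstant : ℂ))
      = 2 * (lam k * laplaceLog (lam k) + (2 * Complex.log (2 * sig k) - Real.log r)) := by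
    rw [mul_laplaceLog hl, two_mul_log_two_mul_sig hk, log_lam hk]
    ring
  rw [integral_gauss_dens_eq hk hr, hsplit, hconst, ← mul_sub, add_sub_cancel_left, norm_mul,
    Complex.norm_ofNat]
  calc 2 * ‖∫ v in Set.Ioi (0 : ℝ), D v‖
      ≤ 2 * ∫ v in Set.Ioi (0 : ℝ),
        ‖lam k‖ * K * √r * (v ^ (-(1 / 2) : ℝ) * Real.exp (-(lam k).re * v)) := by
        gcongr
        refine norm_integral_le_of_norm_le (i0.const_mul _) ?_
        filter_upwards [ae_restrict_mem measurableSet_Ioi] with v hv using hDle v hv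
    _ = _ := by rw [integral_const_mul]; ring

/-- With `e = e^{ikr}`, `G` the Gaussian integral and `c` its logarithmic approximation, one has `π
i H₀ = c J + 2 T`. The difference is therefore `e (G - c) + (e - J) c - 2 T`, and each of the three
terms tends to zero. -/
lemma tendsto_besselIntegral_sub_hankel :
    Tendsto (fun r : ℝ => besselIntegral k r - Real.pi * Complex.I * hankelH0 (k * r))
      (𝓝[>] 0) (𝓝 0) := by
  obtain ⟨K, hK0, hK⟩ := exists_norm_integral_gauss_dens_sub_le hk
  set c : ℝ → ℂ := fun r => Real.pi * Complex.I - 2 * (Complex.log k - Complex.log 2 +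
    (Real.log r : ℂ) + (Real.eulerMascheroniConstant : ℂ)) with hc
  set G : ℝ → ℂ := fun r => ∫ s : ℝ, Complex.exp (-(lam k * r) * (s : ℂ) ^ 2) * dens k s
  set J : ℝ → ℂ := fun r => seriesJ ((k * r / 2) ^ 2) with hJ
  set T : ℝ → ℂ := fun r => seriesY ((k * r / 2) ^ 2) with hT
  set e : ℝ → ℂ := fun r => Complex.exp (Complex.I * k * r) with he
  have hJd : HasDerivAt J _ 0 := (hasDerivAt_seriesJ _).comp 0 (hasDerivAt_scaled_sq k 0)
  have hTd : HasDerivAt T _ 0 := (hasDerivAt_seriesY _).comp 0 (hasDerivAt_scaled_sq k 0)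
  have hed : DifferentiableAt ℝ e 0 := by
    simp only [he]
    fun_prop
  have t1 : Tendsto (fun r => e r * (G r - c r)) (𝓝[>] 0) (𝓝 0) := by
    have h1 : Tendsto (fun r => G r - c r) (𝓝[>] 0) (𝓝 0) := by
      refine squeeze_zero_norm' (a := fun r => K * √r) ?_ ?_
      · filter_upwards [self_mem_nhdsWithin] with r hr using hK r hr
      · refine Tendsto.mono_left ?_ nhdsWithin_le_nhds
        exact Continuous.tendsto' (by fun_prop) _ _ (by simp)
    have h2 : Tendsto e (𝓝[>] 0) (𝓝 (e 0)) :=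
      hed.continuousAt.tendsto.mono_left nhdsWithin_le_nhds
    simpa using h2.mul h1
  have t2 : Tendsto (fun r => (e r - J r) * c r) (𝓝[>] 0) (𝓝 0) := by
    -- Both functions equal `1` at `0` and are differentiable there, so their difference is `O(r)`,
    -- which beats the logarithm in `c`.
    have h1 : (fun r => e r - J r) =O[𝓝[>] 0] fun r : ℝ => (r : ℂ) := by
      have h2 := (hed.hasDerivAt.sub hJd).isBigO_sub
      have h3 : (e - J) 0 = 0 := by
        simp [he, hJ, seriesJ_zero]
      rw [h3] at h2
      have h4 : (fun r : ℝ => r - 0) =O[𝓝 0] fun r : ℝ => (r : ℂ) :=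
        Asymptotics.isBigO_of_le _ fun r => by simp
      simpa using (h2.trans h4).mono nhdsWithin_le_nhds
    have h5 : Tendsto (fun r : ℝ => (r : ℂ) * c r) (𝓝[>] 0) (𝓝 0) := by
      have h6 : Tendsto (fun r : ℝ => ((Real.log r * r : ℝ) : ℂ)) (𝓝[>] 0) (𝓝 0) :=
        (Complex.continuous_ofReal.tendsto' 0 0 (by simp)).comp (by
          simpa using tendsto_log_mul_rpow_nhdsGT_zero one_pos)
      have h7 : Tendsto (fun r : ℝ => (r : ℂ)) (𝓝[>] 0) (𝓝 0) :=
        (Complex.continuous_ofReal.tendsto' 0 0 (by simp)).mono_left nhdsWithin_le_nhds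
      have h8 := (h7.mul_const (Real.pi * Complex.I - 2 * (Complex.log k - Complex.log 2 +
        (Real.eulerMascheroniConstant : ℂ)))).sub (h6.const_mul 2)
      rw [zero_mul, mul_zero, sub_zero] at h8
      refine h8.congr fun r => ?_
      simp only [hc]
      push_cast
      ring
    exact (h1.mul (Asymptotics.isBigO_refl c _)).trans_tendsto h5
  have t3 : Tendsto (fun r => 2 * T r) (𝓝[>] 0) (𝓝 0) := by
    have h1 := (hTd.continuousAt.tendsto.mono_left (nhdsWithin_le_nhds (s := Set.Ioi 0))).const_mul 2
    simpa [hT, seriesY_zero] using h1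
  have t4 := (t1.add t2).sub t3
  rw [add_zero, sub_zero] at t4
  refine t4.congr' ?_
  filter_upwards [self_mem_nhdsWithin] with r hr
  have hr : 0 < r := hr
  have hpi : (Real.pi : ℂ) ≠ 0 := by exact_mod_cast Real.pi_ne_zero
  rw [besselIntegral_eq hk, hankelH0, besselJ0_eq, besselY0_eq,
    log_mul_div_two (Complex.slitPlane_ne_zero hk) hr, ← Complex.ofReal_log hr.le]
  change e r * (G r - c r) + (e r - J r) * c r - 2 * T r = e r * G r - Real.pi * Complex.I *
    (J r + Complex.I * (2 / Real.pi * ((_ + _) * J r - T r)))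
  simp only [hc]
  field_simp
  linear_combination (-(2 * (T r - (Complex.log k - Complex.log 2 + Real.log r +
    Real.eulerMascheroniConstant) * J r))) * Complex.I_sq

/-- The plane wave representation of the Hankel function along the ray through `k`. -/
lemma hankelH0_eq_besselIntegral {r : ℝ} (hr : 0 < r) :
    Real.pi * Complex.I * hankelH0 (k * r) = besselIntegral k r := by
  obtain ⟨p, hp⟩ := isBesselPair_besselIntegral hk
  obtain ⟨q, hq⟩ := isBesselPair_hankel (Complex.slitPlane_ne_zero hk)
  have hq' : IsBesselPair k (fun r => Real.pi * Complex.I * hankelH0 (k * r))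
      (fun r => Real.pi * Complex.I * q r) := fun s hs =>
    ⟨((hq s hs).1.const_mul _).congr_deriv (by ring),
      ((hq s hs).2.const_mul _).congr_deriv (by ring)⟩
  exact (hp.eq_of_tendsto_sub hq' (tendsto_besselIntegral_sub_hankel hk) hr).symm

lemma radialProfile_sq_eq_besselIntegral {r : ℝ} (hr : 0 < r) :
    radialProfile k ((r : ℂ) ^ 2) = 1 / (4 * Real.pi) * besselIntegral k r := by
  have hpi : (Real.pi : ℂ) ≠ 0 := by exact_mod_cast Real.pi_ne_zero
  rw [radialProfile_sq (Complex.slitPlane_ne_zero hk) hr, ← hankelH0_eq_besselIntegral hk hr]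
  field_simp

end

/-! ### The fundamental solution in the plane -/

lemma norm_sq_eq_sum_sq (d : Plane) : ‖d‖ ^ 2 = d 0 ^ 2 + d 1 ^ 2 := by
  rw [EuclideanSpace.norm_sq_eq, Fin.sum_univ_two]
  simp [sq_abs]

lemma abs_apply_le_norm (d : Plane) (i : Fin 2) : |d i| ≤ ‖d‖ := PiLp.norm_apply_le d i

lemma ofReal_norm_sq_mem_slitPlane {x y : Plane} (h : y ≠ x) :
    ((‖x - y‖ ^ 2 : ℝ) : ℂ) ∈ Complex.slitPlane :=
  Complex.ofReal_mem_slitPlane.2 (pow_pos (norm_pos_iff.2 (sub_ne_zero.2 h.symm)) 2)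

lemma fundamentalSolution_eventuallyEq {k : ℂ} (hk : k ≠ 0) {x y : Plane} (h : y ≠ x) :
    fundamentalSolution k x =ᶠ[𝓝 y] fun z => radialProfile k ((‖x - z‖ ^ 2 : ℝ) : ℂ) := by
  filter_upwards [isOpen_ne.mem_nhds h] with z hz
  rw [fundamentalSolution_eq_radialProfile hk hz.symm]
  push_cast
  rfl

lemma contDiffAt_fundamentalSolution {k : ℂ} (hk : k ≠ 0) {x y : Plane} (h : y ≠ x) :
    ContDiffAt ℝ ∞ (fundamentalSolution k x) y := by
  refine ContDiffAt.congr_of_eventuallyEq ?_ (fundamentalSolution_eventuallyEq hk h)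
  have h1 : ContDiffAt ℝ ∞ (radialProfile k) ((‖x - y‖ ^ 2 : ℝ) : ℂ) :=
    (((differentiableOn_radialProfile k).analyticAt
      (Complex.isOpen_slitPlane.mem_nhds (ofReal_norm_sq_mem_slitPlane h))).contDiffAt).restrict_scalars
      ℝ
  have h2 : ContDiffAt ℝ ∞ (fun z : Plane => ((‖x - z‖ ^ 2 : ℝ) : ℂ)) y :=
    Complex.ofRealCLM.contDiff.contDiffAt.comp y
      ((contDiff_const.sub contDiff_id).norm_sq ℝ).contDiffAt
  exact ContDiffAt.comp (g := radialProfile k) y h1 h2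

lemma hasFDerivAt_fundamentalSolution {k : ℂ} (hk : k ≠ 0) {x y : Plane} (h : y ≠ x) :
    HasFDerivAt (fundamentalSolution k x) (fderiv ℝ (fundamentalSolution k x) y) y :=
  ((contDiffAt_fundamentalSolution hk h).differentiableAt (by simp)).hasFDerivAt

lemma fderiv_fundamentalSolution_single {k : ℂ} (hk : k ≠ 0) {x y : Plane} (h : y ≠ x)
    (i : Fin 2) : fderiv ℝ (fundamentalSolution k x) y (EuclideanSpace.single i 1)
      = deriv (radialProfile k) ((‖x - y‖ ^ 2 : ℝ) : ℂ) * (2 * ((y i : ℂ) - x i)) := by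
  have h1 : HasDerivAt (radialProfile k) (deriv (radialProfile k) ((‖x - y‖ ^ 2 : ℝ) : ℂ))
      ((‖x - y‖ ^ 2 : ℝ) : ℂ) :=
    (((differentiableOn_radialProfile k).differentiableAt
      (Complex.isOpen_slitPlane.mem_nhds (ofReal_norm_sq_mem_slitPlane h)))).hasDerivAt
  have h2 : HasDerivAt (fun t : ℝ => ‖x - (y + t • EuclideanSpace.single i 1)‖ ^ 2)
      (2 * (y i - x i)) 0 := by
    have e : HasDerivAt (fun t : ℝ => x - (y + t • EuclideanSpace.single i (1 : ℝ)))
        (-(EuclideanSpace.single i (1 : ℝ))) 0 := by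
      have := ((((hasDerivAt_id (0 : ℝ)).smul_const
        (EuclideanSpace.single i (1 : ℝ))).const_add y).const_sub x)
      simpa using this
    refine e.norm_sq.congr_deriv ?_
    rw [inner_neg_right, EuclideanSpace.inner_single_right]
    simp
  have h3 : HasDerivAt (fun t : ℝ => fundamentalSolution k x (y + t • EuclideanSpace.single i 1))
      (deriv (radialProfile k) ((‖x - y‖ ^ 2 : ℝ) : ℂ) * ((2 * (y i - x i) : ℝ) : ℂ)) 0 := by
    have h4 : HasDerivAt (fun t : ℝ =>
        radialProfile k ((‖x - (y + t • EuclideanSpace.single i 1)‖ ^ 2 : ℝ) : ℂ))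
        (deriv (radialProfile k) ((‖x - y‖ ^ 2 : ℝ) : ℂ) * ((2 * (y i - x i) : ℝ) : ℂ)) 0 :=
      HasDerivAt.comp (h₂ := radialProfile k) (0 : ℝ) (by simpa using h1) h2.ofReal_comp
    refine h4.congr_of_eventuallyEq ?_
    have hc : Tendsto (fun t : ℝ => y + t • EuclideanSpace.single i (1 : ℝ)) (𝓝 0) (𝓝 y) :=
      Continuous.tendsto' (by fun_prop) _ _ (by simp)
    exact hc.eventually (fundamentalSolution_eventuallyEq hk h)
  have h5 := ((hasFDerivAt_fundamentalSolution hk h).hasLineDerivAt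
    (EuclideanSpace.single i 1)).unique h3
  rw [h5]
  push_cast
  ring

/-- The component of `d` along `θ`. -/
def along (θ d : Plane) : ℝ := θ 0 * d 0 + θ 1 * d 1

/-- The component of `d` along the unit vector orthogonal to `θ`. -/
def across (θ d : Plane) : ℝ := θ 0 * d 1 - θ 1 * d 0

lemma along_sq_add_across_sq {θ : Plane} (hθ : ‖θ‖ = 1) (d : Plane) :
    along θ d ^ 2 + across θ d ^ 2 = ‖d‖ ^ 2 := by
  have h1 := norm_sq_eq_sum_sq θ
  rw [hθ] at h1
  rw [norm_sq_eq_sum_sq, along, across]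
  linear_combination (-(d 0 ^ 2 + d 1 ^ 2)) * h1

lemma abs_along_le {θ : Plane} (hθ : ‖θ‖ = 1) (d : Plane) : |along θ d| ≤ ‖d‖ :=
  abs_le_of_sq_le_sq (by nlinarith [along_sq_add_across_sq hθ d, sq_nonneg (across θ d)])
    (norm_nonneg d)

lemma abs_across_le {θ : Plane} (hθ : ‖θ‖ = 1) (d : Plane) : |across θ d| ≤ ‖d‖ :=
  abs_le_of_sq_le_sq (by nlinarith [along_sq_add_across_sq hθ d, sq_nonneg (along θ d)])
    (norm_nonneg d)

@[fun_prop]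
lemma continuous_along (θ : Plane) : Continuous (along θ) := by unfold along; fun_prop

@[fun_prop]
lemma continuous_across (θ : Plane) : Continuous (across θ) := by unfold across; fun_prop

section

variable {k : ℂ} (hk : k ∈ Complex.slitPlane) {C : ℝ} (hC : PathBound k C)
include hk hC

/-- The reference direction `θ` need not be that of `x - y`. Rotation invariance allows one `θ` for
all source points, so that the dependence on `y` separates as a factor. -/
lemma fundamentalSolution_eq_integral {θ : Plane} (hθ : ‖θ‖ = 1) {x y : Plane}
    (h : 2 * C * ‖k‖ * |across θ (x - y)| < (lam k).re * along θ (x - y)) :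
    fundamentalSolution k x y = 1 / (4 * Real.pi) *
      ∫ s, planeWave k (along θ (x - y)) (across θ (x - y)) s * dens k s := by
  have hC1 := hC.1
  have hne : x ≠ y := by
    rintro rfl
    have h0 : along θ (x - x) = 0 := by simp [along]
    have : 0 ≤ 2 * C * ‖k‖ * |across θ (x - x)| := by positivity
    rw [h0, mul_zero] at h
    linarith
  have hr : 0 < ‖x - y‖ := norm_pos_iff.2 (sub_ne_zero.2 hne)
  rw [fundamentalSolution_eq_radialProfile (Complex.slitPlane_ne_zero hk) hne,
    radialProfile_sq_eq_besselIntegral hk hr, besselIntegral,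
    integral_planeWave_eq_of_sq_add_sq hk hC hr (along_sq_add_across_sq hθ _) h]

lemma fderiv_fundamentalSolution_eq_integral {θ : Plane} (hθ : ‖θ‖ = 1) {x y : Plane}
    (h : 2 * C * ‖k‖ * |across θ (x - y)| < (lam k).re * along θ (x - y)) (v : Plane) :
    fderiv ℝ (fundamentalSolution k x) y v = 1 / (4 * Real.pi) *
      ∫ s, planeWave k (along θ (x - y)) (across θ (x - y)) s *
        (-(Complex.I * k * (along θ v * dirC k s + across θ v * dirS k s)) * dens k s) := by
  have hC1 := hC.1
  have hne : y ≠ x := by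
    rintro rfl
    have h0 : along θ (y - y) = 0 := by simp [along]
    have : 0 ≤ 2 * C * ‖k‖ * |across θ (y - y)| := by positivity
    rw [h0, mul_zero] at h
    linarith
  have hl : ∀ t : ℝ, along θ (x - (y + t • v)) = along θ (x - y) - t * along θ v := by
    intro t; simp [along]; ring
  have hc : ∀ t : ℝ, across θ (x - (y + t • v)) = across θ (x - y) - t * across θ v := by
    intro t; simp [across]; ring
  have hdl : ∀ t : ℝ, HasDerivAt (fun t : ℝ => along θ (x - (y + t • v))) (-along θ v) t := by
    intro t
    simp only [hl]
    simpa using ((hasDerivAt_id t).mul_const (along θ v)).const_sub (along θ (x - y))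
  have hdc : ∀ t : ℝ, HasDerivAt (fun t : ℝ => across θ (x - (y + t • v))) (-across θ v) t := by
    intro t
    simp only [hc]
    simpa using ((hasDerivAt_id t).mul_const (across θ v)).const_sub (across θ (x - y))
  have h1 := hasDerivAt_integral_planeWave (A := C) hk hC (continuous_dens hk)
    (fun s => (hC.2 s).1.trans (by nlinarith [sq_nonneg s]))
    (p' := fun _ => -along θ v) (q' := fun _ => -across θ v) (t₀ := 0)
    (Eventually.of_forall hdl) (Eventually.of_forall hdc) continuousAt_const continuousAt_const
    (by simpa using h)
  have h2 : (fun t : ℝ => fundamentalSolution k x (y + t • v)) =ᶠ[𝓝 0] fun t =>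
      1 / (4 * Real.pi) * ∫ s, planeWave k (along θ (x - (y + t • v)))
        (across θ (x - (y + t • v))) s * dens k s := by
    have hopen : ∀ᶠ t in 𝓝 (0 : ℝ), 2 * C * ‖k‖ * |across θ (x - (y + t • v))|
        < (lam k).re * along θ (x - (y + t • v)) := by
      refine ContinuousAt.eventually_lt (by fun_prop) (by fun_prop) (by simpa using h)
    filter_upwards [hopen] with t ht
    exact fundamentalSolution_eq_integral hk hC hθ ht
  have h3 := ((hasFDerivAt_fundamentalSolution (Complex.slitPlane_ne_zero hk) hne).hasLineDerivAt
    v).unique ((h1.const_mul (1 / (4 * Real.pi) : ℂ)).congr_of_eventuallyEq h2)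
  rw [h3]
  simp only [zero_smul, add_zero]
  congr 2
  ext s
  push_cast
  ring

end

/-! ### Potentials of compactly supported sources -/

/-- The potential of a monopole density `a` and a dipole density `b` with respect to `μ`. -/
def potential (k : ℂ) (μ : Measure Plane) (a : Plane → ℂ) (b : Fin 2 → Plane → ℂ) (x : Plane) : ℂ :=
  ∫ y, (a y * fundamentalSolution k x y +
    (b 0 y * fderiv ℝ (fundamentalSolution k x) y (EuclideanSpace.single 0 1) +
      b 1 y * fderiv ℝ (fundamentalSolution k x) y (EuclideanSpace.single 1 1))) ∂μ

/-- The radiation amplitude of a source in a complex direction. -/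
def amplitude (k : ℂ) (μ : Measure Plane) (a : Plane → ℂ) (b : Fin 2 → Plane → ℂ) (p q : ℂ) : ℂ :=
  ∫ y, (a y - Complex.I * k * (b 0 y * p + b 1 y * q)) *
    Complex.exp (-(Complex.I * k * (y 0 * p + y 1 * q))) ∂μ

/-- Integrable source densities that vanish outside `K`. -/
structure IsSource (μ : Measure Plane) (a : Plane → ℂ) (b : Fin 2 → Plane → ℂ)
    (K : Set Plane) : Prop where
  integrable_mono : Integrable a μ
  integrable_di : ∀ i, Integrable (b i) μ
  mono_eq_zero : ∀ y ∉ K, a y = 0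
  di_eq_zero : ∀ i, ∀ y ∉ K, b i y = 0

/-- The amplitude along the path of complex directions that starts at `θ`. -/
def pathAmplitude (k : ℂ) (μ : Measure Plane) (a : Plane → ℂ) (b : Fin 2 → Plane → ℂ)
    (θ : Plane) (s : ℝ) : ℂ :=
  amplitude k μ a b (θ 0 * dirC k s - θ 1 * dirS k s) (θ 1 * dirC k s + θ 0 * dirS k s)

lemma exists_potential_eq_integral {k : ℂ} (hk : k ∈ Complex.slitPlane) {μ : Measure Plane}
    [SFinite μ] {a : Plane → ℂ} {b : Fin 2 → Plane → ℂ} {R₀ : ℝ} (hR₀ : 0 ≤ R₀)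
    (hs : IsSource μ a b (Metric.closedBall 0 R₀)) :
    ∃ R₁ : ℝ, 0 < R₁ ∧ ∀ r : ℝ, R₁ ≤ r → ∀ θ : Plane, ‖θ‖ = 1 →
      Integrable (fun s => planeWave k r 0 s * (dens k s * pathAmplitude k μ a b θ s)) ∧
      potential k μ a b (r • θ) = 1 / (4 * Real.pi) *
        ∫ s, planeWave k r 0 s * (dens k s * pathAmplitude k μ a b θ s) := by
  obtain ⟨C, hC⟩ : ∃ C, PathBound k C := exists_path_bounds hk
  have hC1 := hC.1
  have hlam := lam_re_pos hk
  set B : ℝ := 2 * C * ‖k‖ with hB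
  have hB0 : 0 ≤ B := by positivity
  -- This radius makes the decay rate `Re λ · along - B |across|` at least `1` for every source
  -- point in the ball, which gives the uniform majorant for Fubini.
  refine ⟨R₀ + (B * R₀ + 1) / (lam k).re, by positivity, fun r hr θ hθ => ?_⟩
  have hr1 : B * R₀ + 1 ≤ (lam k).re * (r - R₀) := by
    rw [mul_comm (lam k).re, ← div_le_iff₀ hlam]
    linarith
  have hr0 : 0 ≤ r := by
    have : 0 ≤ (B * R₀ + 1) / (lam k).re := by positivity
    linarith
  have hθ2 : θ 0 ^ 2 + θ 1 ^ 2 = 1 := by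
    have := norm_sq_eq_sum_sq θ
    rw [hθ] at this
    linarith
  have hl : ∀ y : Plane, along θ (r • θ - y) = r - along θ y := by
    intro y
    simp only [along, PiLp.sub_apply, PiLp.smul_apply, smul_eq_mul]
    linear_combination r * hθ2
  have hc : ∀ y : Plane, across θ (r • θ - y) = -across θ y := by
    intro y
    simp only [across, PiLp.sub_apply, PiLp.smul_apply, smul_eq_mul]
    ring
  have hcd := continuous_dens hk
  have hcC := continuous_dirC (k := k)
  have hcS := continuous_dirS hk
  set p : ℝ → ℂ := fun s => θ 0 * dirC k s - θ 1 * dirS k s with hp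
  set q : ℝ → ℂ := fun s => θ 1 * dirC k s + θ 0 * dirS k s with hq
  have hpc : Continuous p := by fun_prop
  have hqc : Continuous q := by fun_prop
  have hθi : ∀ i, |θ i| ≤ 1 := fun i => hθ ▸ abs_apply_le_norm θ i
  have hpb : ∀ s, ‖p s‖ ≤ 4 * C * (1 + s ^ 2) := by
    intro s
    refine (norm_sub_le _ _).trans ?_
    rw [norm_mul, norm_mul, Complex.norm_real, Complex.norm_real, Real.norm_eq_abs,
      Real.norm_eq_abs]
    calc |θ 0| * ‖dirC k s‖ + |θ 1| * ‖dirS k s‖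
        ≤ 1 * (2 * C * (1 + s ^ 2)) + 1 * (2 * C * (1 + s ^ 2)) := by
          gcongr
          exacts [hθi 0, hC.norm_dirC_le s, hθi 1, hC.norm_dirS_le s]
      _ = _ := by ring
  have hqb : ∀ s, ‖q s‖ ≤ 4 * C * (1 + s ^ 2) := by
    intro s
    refine (norm_add_le _ _).trans ?_
    rw [norm_mul, norm_mul, Complex.norm_real, Complex.norm_real, Real.norm_eq_abs,
      Real.norm_eq_abs]
    calc |θ 1| * ‖dirC k s‖ + |θ 0| * ‖dirS k s‖
        ≤ 1 * (2 * C * (1 + s ^ 2)) + 1 * (2 * C * (1 + s ^ 2)) := by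
          gcongr
          exacts [hθi 1, hC.norm_dirC_le s, hθi 0, hC.norm_dirS_le s]
      _ = _ := by ring
  set f : Plane × ℝ → ℂ := fun z =>
    planeWave k (r - along θ z.1) (-across θ z.1) z.2 *
      (dens k z.2 * (a z.1 - Complex.I * k * (b 0 z.1 * p z.2 + b 1 z.1 * q z.2))) with hf
  -- The phase is linear, so the wave at `rθ - y` is the wave at `rθ` times a factor depending only
  -- on `y` and `s`; the latter integrates to the amplitude.
  have hfwave : ∀ y s, f (y, s) = planeWave k r 0 s * (dens k s *
      ((a y - Complex.I * k * (b 0 y * p s + b 1 y * q s)) *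
        Complex.exp (-(Complex.I * k * (y 0 * p s + y 1 * q s))))) := by
    intro y s
    have e : planeWave k (r - along θ y) (-across θ y) s = planeWave k r 0 s *
        Complex.exp (-(Complex.I * k * (y 0 * p s + y 1 * q s))) := by
      rw [planeWave, planeWave, ← Complex.exp_add]
      congr 1
      simp only [along, across, hp, hq]
      push_cast
      ring
    simp only [hf]
    rw [e]
    ring
  have hcone : ∀ y ∈ Metric.closedBall (0 : Plane) R₀,
      2 * C * ‖k‖ * |across θ (r • θ - y)| < (lam k).re * along θ (r • θ - y) := by
    intro y hy
    have hy : ‖y‖ ≤ R₀ := by simpa using hy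
    rw [hl, hc, abs_neg]
    have h1 : along θ y ≤ R₀ := (le_abs_self _).trans ((abs_along_le hθ y).trans hy)
    have h2 : |across θ y| ≤ R₀ := (abs_across_le hθ y).trans hy
    calc B * |across θ y| ≤ B * R₀ := by gcongr
      _ < B * R₀ + 1 := by linarith
      _ ≤ (lam k).re * (r - R₀) := hr1
      _ ≤ _ := by gcongr
  have hwave : ∀ y ∈ Metric.closedBall (0 : Plane) R₀, ∀ s,
      ‖planeWave k (r - along θ y) (-across θ y) s‖ ≤
        Real.exp (B * (r + R₀ + R₀)) * Real.exp (-1 * s ^ 2) := by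
    intro y hy s
    have hy : ‖y‖ ≤ R₀ := by simpa using hy
    have h1 : |along θ y| ≤ R₀ := (abs_along_le hθ y).trans hy
    have h2 : |across θ y| ≤ R₀ := (abs_across_le hθ y).trans hy
    refine (norm_planeWave_le hk hC _ _ s).trans ?_
    rw [abs_neg]
    have h3 : |r - along θ y| ≤ r + R₀ := (abs_sub _ _).trans (by rw [abs_of_nonneg hr0]; linarith)
    gcongr
    · rw [← hB]
      have h4 : (lam k).re * (r - R₀) ≤ (lam k).re * (r - along θ y) := by
        gcongr
        exact (le_abs_self _).trans h1
      have h5 : B * |across θ y| ≤ B * R₀ := by gcongr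
      linarith
  have hfint : Integrable f (μ.prod volume) := by
    have hdom : Integrable (fun z : Plane × ℝ => (‖a z.1‖ + ‖b 0 z.1‖ + ‖b 1 z.1‖) *
        (Real.exp (B * (r + R₀ + R₀)) * (C * (1 + ‖k‖ * (4 * C))) *
          ((1 + z.2 ^ 2) ^ 2 * Real.exp (-1 * z.2 ^ 2)))) (μ.prod volume) :=
      Integrable.mul_prod ((hs.integrable_mono.norm.add (hs.integrable_di 0).norm).add
        (hs.integrable_di 1).norm) ((integrable_one_add_sq_pow_mul_exp one_pos).const_mul _)
    refine hdom.mono' ?_ (ae_of_all _ fun z => ?_)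
    · have h1 : Continuous fun z : Plane × ℝ =>
          planeWave k (r - along θ z.1) (-across θ z.1) z.2 := by
        unfold planeWave
        have := continuous_along θ
        have := continuous_across θ
        fun_prop
      have h2 : AEStronglyMeasurable (fun z : Plane × ℝ => a z.1) (μ.prod volume) :=
        hs.integrable_mono.aestronglyMeasurable.comp_fst
      have h3 : ∀ i, AEStronglyMeasurable (fun z : Plane × ℝ => b i z.1) (μ.prod volume) :=
        fun i => (hs.integrable_di i).aestronglyMeasurable.comp_fst
      have hp' : AEStronglyMeasurable (fun z : Plane × ℝ => p z.2) (μ.prod volume) :=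
        (hpc.comp continuous_snd).aestronglyMeasurable
      have hq' : AEStronglyMeasurable (fun z : Plane × ℝ => q z.2) (μ.prod volume) :=
        (hqc.comp continuous_snd).aestronglyMeasurable
      refine h1.aestronglyMeasurable.mul ?_
      refine (hcd.comp continuous_snd).aestronglyMeasurable.mul ?_
      exact h2.sub ((((h3 0).mul hp').add ((h3 1).mul hq')).const_mul _)
    · obtain ⟨y, s⟩ := z
      by_cases hy : y ∈ Metric.closedBall (0 : Plane) R₀
      · simp only [hf, norm_mul]
        have h1 : ‖a y - Complex.I * k * (b 0 y * p s + b 1 y * q s)‖ ≤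
            (‖a y‖ + ‖b 0 y‖ + ‖b 1 y‖) * ((1 + ‖k‖ * (4 * C)) * (1 + s ^ 2)) := by
          refine (norm_sub_le _ _).trans ?_
          rw [norm_mul, norm_mul, Complex.norm_I, one_mul]
          have h2 : ‖b 0 y * p s + b 1 y * q s‖ ≤
              (‖b 0 y‖ + ‖b 1 y‖) * (4 * C * (1 + s ^ 2)) := by
            refine (norm_add_le _ _).trans ?_
            rw [norm_mul, norm_mul, add_mul]
            gcongr
            exacts [hpb s, hqb s]
          have h3 : ‖k‖ * ‖b 0 y * p s + b 1 y * q s‖ ≤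
              ‖k‖ * ((‖b 0 y‖ + ‖b 1 y‖) * (4 * C * (1 + s ^ 2))) := by gcongr
          have h4 : 0 ≤ ‖k‖ * ‖a y‖ * (4 * C * (1 + s ^ 2)) := by positivity
          nlinarith [norm_nonneg (a y), norm_nonneg (b 0 y), norm_nonneg (b 1 y), sq_nonneg s,
            mul_nonneg (norm_nonneg (a y)) (sq_nonneg s),
            mul_nonneg (norm_nonneg (b 0 y)) (sq_nonneg s),
            mul_nonneg (norm_nonneg (b 1 y)) (sq_nonneg s)]
        calc _ ≤ (Real.exp (B * (r + R₀ + R₀)) * Real.exp (-1 * s ^ 2)) * (C *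
              ((‖a y‖ + ‖b 0 y‖ + ‖b 1 y‖) * ((1 + ‖k‖ * (4 * C)) * (1 + s ^ 2)))) := by
              gcongr
              exacts [hwave y hy s, (hC.2 s).1]
          _ = (‖a y‖ + ‖b 0 y‖ + ‖b 1 y‖) *
              (Real.exp (B * (r + R₀ + R₀)) * (C * (1 + ‖k‖ * (4 * C))) *
              ((1 + s ^ 2) * Real.exp (-1 * s ^ 2))) := by ring
          _ ≤ _ := by
              gcongr
              nlinarith [sq_nonneg s]
      · simp only [hf, hs.mono_eq_zero y hy, hs.di_eq_zero _ y hy]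
        simp
  have hswap := integral_integral_swap (f := fun y s => f (y, s)) hfint
  have hs1 : ∀ s, ∫ y, f (y, s) ∂μ = planeWave k r 0 s * (dens k s * pathAmplitude k μ a b θ s) := by
    intro s
    rw [pathAmplitude, amplitude, ← integral_const_mul, ← integral_const_mul]
    exact integral_congr_ae (ae_of_all _ fun y => hfwave y s)
  have hs2 : ∀ y, a y * fundamentalSolution k (r • θ) y +
    (b 0 y * fderiv ℝ (fundamentalSolution k (r • θ)) y (EuclideanSpace.single 0 1) +
      b 1 y * fderiv ℝ (fundamentalSolution k (r • θ)) y (EuclideanSpace.single 1 1))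
      = 1 / (4 * Real.pi) * ∫ s, f (y, s) := by
    intro y
    by_cases hy : y ∈ Metric.closedBall (0 : Plane) R₀
    · have hcy := hcone y hy
      have hint : ∀ {g : ℝ → ℂ}, Continuous g → (∀ s, ‖g s‖ ≤ 4 * C * (1 + s ^ 2)) →
          Integrable fun s => planeWave k (along θ (r • θ - y)) (across θ (r • θ - y)) s *
            (-(Complex.I * k * g s) * dens k s) := by
        intro g hg hgb
        refine integrable_planeWave_mul (A := ‖k‖ * (4 * C) * C) hk hC (by fun_prop)
          (fun s => ?_) hcy
        simp only [norm_mul, norm_neg, Complex.norm_I, one_mul]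
        calc ‖k‖ * ‖g s‖ * ‖dens k s‖ ≤ ‖k‖ * (4 * C * (1 + s ^ 2)) * C := by
              gcongr
              exacts [hgb s, (hC.2 s).1]
          _ = ‖k‖ * (4 * C) * C * (1 + s ^ 2) := by ring
          _ ≤ _ := by
              gcongr
              nlinarith [sq_nonneg s]
      have i0 : Integrable fun s => planeWave k (along θ (r • θ - y)) (across θ (r • θ - y)) s *
            dens k s :=
        integrable_planeWave_mul (A := C) hk hC hcd (fun s => (hC.2 s).1.trans (by
          nlinarith [sq_nonneg s, sq_nonneg (s ^ 2)])) hcy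
      have i1 := hint hpc hpb
      have i2 := hint hqc hqb
      rw [fundamentalSolution_eq_integral hk hC hθ hcy,
        fderiv_fundamentalSolution_eq_integral hk hC hθ hcy,
        fderiv_fundamentalSolution_eq_integral hk hC hθ hcy]
      have e0 : ∀ s, ((along θ (EuclideanSpace.single 0 1) : ℝ) : ℂ) * dirC k s +
          ((across θ (EuclideanSpace.single 0 1) : ℝ) : ℂ) * dirS k s = p s := by
        intro s; simp [along, across, hp]; ring
      have e1 : ∀ s, ((along θ (EuclideanSpace.single 1 1) : ℝ) : ℂ) * dirC k s +
          ((across θ (EuclideanSpace.single 1 1) : ℝ) : ℂ) * dirS k s = q s := by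
        intro s; simp [along, across, hq]
      simp only [e0, e1]
      have hsum : ∫ s, f (y, s) = a y * (∫ s, planeWave k (along θ (r • θ - y))
            (across θ (r • θ - y)) s * dens k s) +
          (b 0 y * (∫ s, planeWave k (along θ (r • θ - y)) (across θ (r • θ - y)) s *
            (-(Complex.I * k * p s) * dens k s)) +
          b 1 y * (∫ s, planeWave k (along θ (r • θ - y)) (across θ (r • θ - y)) s *
            (-(Complex.I * k * q s) * dens k s))) := by
        simp only [← integral_const_mul]
        rw [← integral_add (i1.const_mul _) (i2.const_mul _)]
        have i12 : Integrable fun s => b 0 y * (planeWave k (along θ (r • θ - y))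
          (across θ (r • θ - y)) s * (-(Complex.I * k * p s) * dens k s)) +
          b 1 y * (planeWave k (along θ (r • θ - y)) (across θ (r • θ - y)) s *
            (-(Complex.I * k * q s) * dens k s)) := (i1.const_mul _).add (i2.const_mul _)
        rw [← integral_add (i0.const_mul _) i12]
        congr 1
        ext s
        simp only [hf]
        rw [hl, hc]
        ring
      rw [hsum]
      ring
    · simp only [hs.mono_eq_zero y hy, hs.di_eq_zero _ y hy, hf]
      simp
  refine ⟨?_, ?_⟩
  · have := hfint.integral_prod_right
    simpa only [hs1] using this
  · rw [potential]
    simp only [hs2]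
    rw [integral_const_mul, hswap]
    simp only [hs1]

/-! ### Second differences along the path -/

/-- `f` has first and second differences at `0` of first and second order, with constant `A`. -/
def EvenTame (A : ℝ) (f : ℝ → ℂ) : Prop :=
  ‖f 0‖ ≤ A ∧ (∀ s, ‖f s - f 0‖ ≤ A * |s| * Real.exp (A * s ^ 2)) ∧
    ∀ s, ‖f s + f (-s) - 2 * f 0‖ ≤ A * s ^ 2 * Real.exp (A * s ^ 2)

lemma EvenTame.mono {A A' : ℝ} (hA : 0 ≤ A) (h : A ≤ A') {f : ℝ → ℂ} (hf : EvenTame A f) :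
    EvenTame A' f := by
  have hA' := hA.trans h
  refine ⟨hf.1.trans h, fun s => (hf.2.1 s).trans ?_, fun s => (hf.2.2 s).trans ?_⟩ <;> gcongr

/-- Leibniz rule for differences: besides terms with one difference, only products of two first
differences occur, and these are already of order `s²`. -/
lemma EvenTame.mul {A : ℝ} (hA : 0 ≤ A) {f g : ℝ → ℂ} (hf : EvenTame A f) (hg : EvenTame A g) :
    EvenTame (4 * A ^ 2 + 2 * A + 1) fun s => f s * g s := by
  have hexp : ∀ s : ℝ, Real.exp (A * s ^ 2) ≤ Real.exp ((2 * A) * s ^ 2) := fun s => by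
    gcongr; linarith
  have hexp2 : ∀ s : ℝ, Real.exp (A * s ^ 2) * Real.exp (A * s ^ 2)
      = Real.exp ((2 * A) * s ^ 2) := fun s => by rw [← Real.exp_add]; ring_nf
  have hprod : ∀ s, ‖f s - f 0‖ * ‖g s - g 0‖ ≤ A ^ 2 * s ^ 2 * Real.exp ((2 * A) * s ^ 2) := by
    intro s
    calc ‖f s - f 0‖ * ‖g s - g 0‖ ≤ (A * |s| * Real.exp (A * s ^ 2)) *
          (A * |s| * Real.exp (A * s ^ 2)) := by
          gcongr
          exacts [hf.2.1 s, hg.2.1 s]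
      _ = A ^ 2 * |s| ^ 2 * (Real.exp (A * s ^ 2) * Real.exp (A * s ^ 2)) := by ring
      _ = _ := by rw [hexp2, sq_abs]
  refine ⟨?_, fun s => ?_, fun s => ?_⟩
  · rw [norm_mul]
    calc ‖f 0‖ * ‖g 0‖ ≤ A * A := by gcongr; exacts [hf.1, hg.1]
      _ ≤ _ := by nlinarith
  · have e : f s * g s - f 0 * g 0 = f 0 * (g s - g 0) + (f s - f 0) * g 0
        + (f s - f 0) * (g s - g 0) := by ring
    -- A first-order bound is wanted here, so one factor `|s|` is absorbed into `e^{s²}`; hence the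
    -- exponent `2 A + 1`.
    have hs2 : s ^ 2 ≤ |s| * Real.exp (s ^ 2) := by
      have h1 := Real.add_one_le_exp (s ^ 2)
      have h2 := abs_le_one_add_sq s
      rw [← sq_abs, sq]
      gcongr
      rw [← sq, sq_abs]
      linarith
    have h3 : A ^ 2 * s ^ 2 * Real.exp ((2 * A) * s ^ 2) ≤
        A ^ 2 * |s| * Real.exp ((2 * A + 1) * s ^ 2) := by
      calc A ^ 2 * s ^ 2 * Real.exp ((2 * A) * s ^ 2)
          ≤ A ^ 2 * (|s| * Real.exp (s ^ 2)) * Real.exp ((2 * A) * s ^ 2) := by gcongr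
        _ = A ^ 2 * |s| * (Real.exp (s ^ 2) * Real.exp ((2 * A) * s ^ 2)) := by ring
        _ = _ := by rw [← Real.exp_add]; ring_nf
    have h4 : Real.exp (A * s ^ 2) ≤ Real.exp ((2 * A + 1) * s ^ 2) := by gcongr; linarith
    rw [e]
    calc _ ≤ ‖f 0‖ * ‖g s - g 0‖ + ‖f s - f 0‖ * ‖g 0‖ + ‖f s - f 0‖ * ‖g s - g 0‖ := by
          refine (norm_add₃_le).trans ?_
          simp only [norm_mul, le_refl]
      _ ≤ A * (A * |s| * Real.exp (A * s ^ 2)) + (A * |s| * Real.exp (A * s ^ 2)) * A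
          + A ^ 2 * |s| * Real.exp ((2 * A + 1) * s ^ 2) := by
          refine add_le_add (add_le_add ?_ ?_) ((hprod s).trans h3)
          · gcongr; exacts [hf.1, hg.2.1 s]
          · gcongr; exacts [hf.2.1 s, hg.1]
      _ = 2 * A ^ 2 * |s| * Real.exp (A * s ^ 2) + A ^ 2 * |s| * Real.exp ((2 * A + 1) * s ^ 2) := by
          ring
      _ ≤ 2 * A ^ 2 * |s| * Real.exp ((2 * A + 1) * s ^ 2)
          + A ^ 2 * |s| * Real.exp ((2 * A + 1) * s ^ 2) := by gcongr
      _ = (3 * A ^ 2) * |s| * Real.exp ((2 * A + 1) * s ^ 2) := by ring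
      _ ≤ _ := by
          gcongr <;> nlinarith
  · have e : f s * g s + f (-s) * g (-s) - 2 * (f 0 * g 0) =
        f 0 * (g s + g (-s) - 2 * g 0) + (f s + f (-s) - 2 * f 0) * g 0
        + ((f s - f 0) * (g s - g 0) + (f (-s) - f 0) * (g (-s) - g 0)) := by ring
    have h2 := hprod (-s)
    rw [neg_sq] at h2
    rw [e]
    calc _ ≤ ‖f 0‖ * ‖g s + g (-s) - 2 * g 0‖ + ‖f s + f (-s) - 2 * f 0‖ * ‖g 0‖ +
          (‖f s - f 0‖ * ‖g s - g 0‖ + ‖f (-s) - f 0‖ * ‖g (-s) - g 0‖) := by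
          refine (norm_add₃_le).trans ?_
          simp only [norm_mul]
          gcongr
          refine (norm_add_le _ _).trans ?_
          simp only [norm_mul, le_refl]
      _ ≤ A * (A * s ^ 2 * Real.exp (A * s ^ 2)) + (A * s ^ 2 * Real.exp (A * s ^ 2)) * A
          + (A ^ 2 * s ^ 2 * Real.exp ((2 * A) * s ^ 2) +
            A ^ 2 * s ^ 2 * Real.exp ((2 * A) * s ^ 2)) := by
          refine add_le_add (add_le_add ?_ ?_) (add_le_add (hprod s) h2)
          · gcongr; exacts [hf.1, hg.2.2 s]
          · gcongr; exacts [hf.2.2 s, hg.1]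
      _ = 2 * A ^ 2 * s ^ 2 * Real.exp (A * s ^ 2) + 2 * A ^ 2 * s ^ 2 * Real.exp ((2 * A) * s ^ 2) := by
          ring
      _ ≤ 2 * A ^ 2 * s ^ 2 * Real.exp ((2 * A) * s ^ 2)
          + 2 * A ^ 2 * s ^ 2 * Real.exp ((2 * A) * s ^ 2) := by gcongr; linarith
      _ = (4 * A ^ 2) * s ^ 2 * Real.exp ((2 * A) * s ^ 2) := by ring
      _ ≤ _ := by
          gcongr <;> nlinarith

lemma EvenTame.mul_of_le {A A' : ℝ} (hA : 0 ≤ A) (h : 4 * A ^ 2 + 2 * A + 1 ≤ A') {f g : ℝ → ℂ}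
    (hf : EvenTame A f) (hg : EvenTame A g) : EvenTame A' fun s => f s * g s :=
  (hf.mul hA hg).mono (by positivity) h

lemma abs_add_sq_le (s : ℝ) : |s| + s ^ 2 ≤ 2 * |s| * Real.exp (s ^ 2) := by
  have h1 := Real.add_one_le_exp (s ^ 2)
  have h2 := abs_le_one_add_sq s
  have h3 : 1 + |s| ≤ 2 * Real.exp (s ^ 2) := by linarith [sq_nonneg s]
  calc |s| + s ^ 2 = |s| * (1 + |s|) := by rw [← sq_abs]; ring
    _ ≤ |s| * (2 * Real.exp (s ^ 2)) := by gcongr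
    _ = _ := by ring

lemma sq_le_abs_mul_exp (s : ℝ) : s ^ 2 ≤ 2 * |s| * Real.exp (s ^ 2) :=
  le_trans (by linarith [abs_nonneg s]) (abs_add_sq_le s)

lemma evenTame_of_even {f : ℝ → ℂ} {C : ℝ} (hC : 1 ≤ C) (h0 : ‖f 0‖ ≤ C) (he : ∀ s, f (-s) = f s)
    (h : ∀ s, ‖f s - f 0‖ ≤ C * s ^ 2) : EvenTame (2 * C) f := by
  refine ⟨by linarith, fun s => (h s).trans ?_, fun s => ?_⟩
  · calc C * s ^ 2 ≤ C * (2 * |s| * Real.exp (s ^ 2)) := by gcongr; exact sq_le_abs_mul_exp s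
      _ = 2 * C * |s| * Real.exp (1 * s ^ 2) := by rw [one_mul]; ring
      _ ≤ _ := by gcongr; linarith
  · have e : f s + f (-s) - 2 * f 0 = 2 * (f s - f 0) := by rw [he]; ring
    rw [e, norm_mul, Complex.norm_ofNat]
    calc 2 * ‖f s - f 0‖ ≤ 2 * (C * s ^ 2) := by gcongr; exact h s
      _ = 2 * C * s ^ 2 * 1 := by ring
      _ ≤ _ := by gcongr; exact Real.one_le_exp (by positivity)

lemma evenTame_const {c : ℂ} {C : ℝ} (hC : 1 ≤ C) (h : ‖c‖ ≤ C) : EvenTame (2 * C) fun _ => c :=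
  evenTame_of_even hC h (fun _ => rfl) (fun s => by
    simp only [sub_self, norm_zero]
    have : 0 ≤ C := by linarith
    positivity)

lemma evenTame_dirS {k : ℂ} {C : ℝ} (hC : PathBound k C) : EvenTame (2 * C) (dirS k) := by
  have hC1 := hC.1
  refine ⟨by rw [dirS_zero, norm_zero]; linarith, fun s => ?_, fun s => ?_⟩
  · rw [dirS_zero, sub_zero]
    calc ‖dirS k s‖ ≤ C * (|s| + s ^ 2) := (hC.2 s).2.2.2
      _ ≤ C * (2 * |s| * Real.exp (s ^ 2)) := by gcongr; exact abs_add_sq_le s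
      _ = 2 * C * |s| * Real.exp (1 * s ^ 2) := by rw [one_mul]; ring
      _ ≤ _ := by gcongr; linarith
  · rw [dirS_neg, dirS_zero]
    simp only [add_neg_cancel, mul_zero, sub_zero, norm_zero]
    positivity

lemma norm_exp_sub_one_le (z : ℂ) : ‖Complex.exp z - 1‖ ≤ ‖z‖ * Real.exp ‖z‖ := by
  simpa using Complex.norm_exp_sub_sum_le_norm_mul_exp z 1

lemma norm_exp_sub_one_sub_le (z : ℂ) : ‖Complex.exp z - 1 - z‖ ≤ ‖z‖ ^ 2 * Real.exp ‖z‖ := by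
  have := Complex.norm_exp_sub_sum_le_norm_mul_exp z 2
  simpa [Finset.sum_range_succ, sub_sub] using this

/-- The exponential of a function with odd part of first order and even part of second order. -/
lemma exists_evenTame_exp (L : ℝ) (hL : 0 ≤ L) : ∃ A : ℝ, 1 ≤ A ∧ ∀ z : ℝ → ℂ,
    (∀ s, ‖z s‖ ≤ L * (|s| + s ^ 2)) → (∀ s, ‖z s + z (-s)‖ ≤ L * s ^ 2) →
    EvenTame A fun s => Complex.exp (z s) := by
  set E := Real.exp L
  have hE : 1 ≤ E := Real.one_le_exp hL
  set A : ℝ := 1 + (2 * L + 8 * L ^ 2) * E + L + (2 + 2 * L) with hA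
  have hA0 : 0 ≤ A := by positivity
  refine ⟨A, by
    have h1 : 0 ≤ (2 * L + 8 * L ^ 2) * E := by positivity
    simp only [hA]; linarith, fun z hz1 hz2 => ?_⟩
  have hz0 : z 0 = 0 := by simpa using hz1 0
  have hexp : ∀ s, Real.exp ‖z s‖ ≤ E * Real.exp ((2 * L) * s ^ 2) := by
    intro s
    rw [← Real.exp_add]
    gcongr
    refine (hz1 s).trans ?_
    have := abs_le_one_add_sq s
    nlinarith
  have hz3 : ∀ s, ‖z s‖ ≤ 2 * L * |s| * Real.exp (s ^ 2) := fun s => (hz1 s).trans (by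
    calc L * (|s| + s ^ 2) ≤ L * (2 * |s| * Real.exp (s ^ 2)) := by
          gcongr; exact abs_add_sq_le s
      _ = _ := by ring)
  have hsecond : ∀ s, ‖Complex.exp (z s) - 1 - z s‖ ≤
      4 * L ^ 2 * E * s ^ 2 * Real.exp ((2 + 2 * L) * s ^ 2) := by
    intro s
    calc _ ≤ ‖z s‖ ^ 2 * Real.exp ‖z s‖ := norm_exp_sub_one_sub_le _
      _ ≤ (2 * L * |s| * Real.exp (s ^ 2)) ^ 2 * (E * Real.exp ((2 * L) * s ^ 2)) := by
          gcongr; exacts [hz3 s, hexp s]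
      _ = 4 * L ^ 2 * E * |s| ^ 2 *
          (Real.exp (s ^ 2) * Real.exp (s ^ 2) * Real.exp ((2 * L) * s ^ 2)) := by ring
      _ = _ := by
          rw [sq_abs, ← Real.exp_add, ← Real.exp_add]; ring_nf
  refine ⟨?_, fun s => ?_, fun s => ?_⟩
  · simp only [hz0, Complex.exp_zero, norm_one, hA]
    have h1 : 0 ≤ (2 * L + 8 * L ^ 2) * E := by positivity
    linarith
  · simp only [hz0, Complex.exp_zero]
    calc ‖Complex.exp (z s) - 1‖ ≤ ‖z s‖ * Real.exp ‖z s‖ := norm_exp_sub_one_le _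
      _ ≤ (2 * L * |s| * Real.exp (s ^ 2)) * (E * Real.exp ((2 * L) * s ^ 2)) := by
          gcongr; exacts [hz3 s, hexp s]
      _ = (2 * L * E) * |s| * (Real.exp (s ^ 2) * Real.exp ((2 * L) * s ^ 2)) := by ring
      _ = (2 * L * E) * |s| * Real.exp ((1 + 2 * L) * s ^ 2) := by
          rw [← Real.exp_add]; ring_nf
      _ ≤ _ := by
          have h1 : 0 ≤ L ^ 2 * E := by positivity
          have h2 : 0 ≤ (2 * L + 8 * L ^ 2) * E := by positivity
          gcongr
          · simp only [hA]; linarith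
          · simp only [hA]; linarith
  · simp only [hz0, Complex.exp_zero]
    -- After removing the linear parts the remainders are quadratic, while the linear parts combine
    -- to `z s + z (-s)`, where the odd first-order contribution cancels.
    have e : Complex.exp (z s) + Complex.exp (z (-s)) - 2 * 1 =
        (Complex.exp (z s) - 1 - z s) + (Complex.exp (z (-s)) - 1 - z (-s)) +
          (z s + z (-s)) := by ring
    have h2 := hsecond (-s)
    rw [neg_sq] at h2
    rw [e]
    calc _ ≤ 4 * L ^ 2 * E * s ^ 2 * Real.exp ((2 + 2 * L) * s ^ 2) +
          4 * L ^ 2 * E * s ^ 2 * Real.exp ((2 + 2 * L) * s ^ 2) + L * s ^ 2 * 1 := by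
          rw [mul_one]
          exact (norm_add₃_le).trans (add_le_add (add_le_add (hsecond s) h2) (hz2 s))
      _ ≤ 4 * L ^ 2 * E * s ^ 2 * Real.exp ((2 + 2 * L) * s ^ 2) +
          4 * L ^ 2 * E * s ^ 2 * Real.exp ((2 + 2 * L) * s ^ 2) +
          L * s ^ 2 * Real.exp ((2 + 2 * L) * s ^ 2) := by
          gcongr
          exact Real.one_le_exp (by positivity)
      _ = (8 * L ^ 2 * E + L) * s ^ 2 * Real.exp ((2 + 2 * L) * s ^ 2) := by ring
      _ ≤ _ := by
          have h1 : 0 ≤ L * E := by positivity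
          have h2 : 0 ≤ (2 * L + 8 * L ^ 2) * E := by positivity
          gcongr
          · simp only [hA]; linarith
          · simp only [hA]; linarith

/-- The plane wave with direction on the path starting at `θ`, evaluated at `-y`. -/
def pathWave (k : ℂ) (θ y : Plane) (s : ℝ) : ℂ :=
  Complex.exp (-(Complex.I * k * (y 0 * (θ 0 * dirC k s - θ 1 * dirS k s) +
    y 1 * (θ 1 * dirC k s + θ 0 * dirS k s))))

lemma exists_evenTame_pathWave {k : ℂ} (hk : k ∈ Complex.slitPlane) (R₀ : ℝ) (hR₀ : 0 ≤ R₀) :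
    ∃ A : ℝ, 0 ≤ A ∧ ∀ θ y : Plane, ‖θ‖ = 1 → ‖y‖ ≤ R₀ →
      EvenTame A (fun s => dens k s * pathWave k θ y s) ∧
      EvenTame A (fun s => dens k s * pathWave k θ y s * dirC k s) ∧
      EvenTame A (fun s => dens k s * pathWave k θ y s * dirS k s) := by
  obtain ⟨C, hC⟩ : ∃ C, PathBound k C := exists_path_bounds hk
  have hC1 := hC.1
  obtain ⟨A₁, hA₁, hexp⟩ := exists_evenTame_exp (2 * (‖k‖ * R₀ * C)) (by positivity)
  set M := Real.exp (‖k‖ * R₀)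
  have hM : 1 ≤ M := Real.one_le_exp (by positivity)
  -- `A₂` serves all basic factors; each further level of products replaces `A` by `4 A² + 2 A + 1`,
  -- uniformly in `θ` and `y`.
  obtain ⟨A₂, hA₂⟩ : ∃ x : ℝ, x = A₁ + 2 * M + 2 * C := ⟨_, rfl⟩
  have hA₂0 : 0 ≤ A₂ := by rw [hA₂]; positivity
  obtain ⟨A₃, hA₃⟩ : ∃ x : ℝ, 4 * A₂ ^ 2 + 2 * A₂ + 1 = x := ⟨_, rfl⟩
  have h23 : A₂ ≤ A₃ := by nlinarith
  have hA₃0 : 0 ≤ A₃ := hA₂0.trans h23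
  obtain ⟨A₄, hA₄⟩ : ∃ x : ℝ, 4 * A₃ ^ 2 + 2 * A₃ + 1 = x := ⟨_, rfl⟩
  have h34 : A₃ ≤ A₄ := by nlinarith
  have hA₄0 : 0 ≤ A₄ := hA₃0.trans h34
  obtain ⟨A₅, hA₅⟩ : ∃ x : ℝ, 4 * A₄ ^ 2 + 2 * A₄ + 1 = x := ⟨_, rfl⟩
  have h45 : A₄ ≤ A₅ := by nlinarith
  refine ⟨A₅, hA₄0.trans h45, fun θ y hθ hy => ?_⟩
  have hl : |along θ y| ≤ R₀ := (abs_along_le hθ y).trans hy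
  have hc : |across θ y| ≤ R₀ := (abs_across_le hθ y).trans hy
  -- The phase minus its value at `s = 0`. In coordinates adapted to `θ`, the even part `dirC - 1`
  -- is of second order and the odd `dirS` drops out of `z s + z (-s)`.
  set z : ℝ → ℂ := fun s => -(Complex.I * k * (along θ y * (dirC k s - 1) + across θ y * dirS k s))
    with hz
  have hnz : ∀ s, ‖z s‖ ≤ ‖k‖ * R₀ * (‖dirC k s - 1‖ + ‖dirS k s‖) := by
    intro s
    rw [hz, norm_neg, norm_mul, norm_mul, Complex.norm_I, one_mul, mul_assoc]
    gcongr
    refine (norm_add_le _ _).trans ?_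
    rw [norm_mul, norm_mul, Complex.norm_real, Complex.norm_real, Real.norm_eq_abs,
      Real.norm_eq_abs, mul_add]
    gcongr
  have t1 : EvenTame A₂ fun s => Complex.exp (z s) := by
    refine (hexp z (fun s => (hnz s).trans ?_) (fun s => ?_)).mono (by linarith) (by
      rw [hA₂]; linarith)
    · have h1 := (hC.2 s).2.2.1
      have h2 := (hC.2 s).2.2.2
      calc ‖k‖ * R₀ * (‖dirC k s - 1‖ + ‖dirS k s‖)
          ≤ ‖k‖ * R₀ * (C * s ^ 2 + C * (|s| + s ^ 2)) := by gcongr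
        _ ≤ ‖k‖ * R₀ * (C * (|s| + s ^ 2) + C * (|s| + s ^ 2)) := by
            gcongr
            linarith [abs_nonneg s]
        _ = _ := by ring
    · have e : z s + z (-s) = -(Complex.I * k * (2 * (along θ y * (dirC k s - 1)))) := by
        simp only [hz, dirC_neg, dirS_neg]; ring
      rw [e]
      simp only [norm_neg, norm_mul, Complex.norm_I, one_mul, Complex.norm_ofNat,
        Complex.norm_real, Real.norm_eq_abs]
      calc ‖k‖ * (2 * (|along θ y| * ‖dirC k s - 1‖)) ≤ ‖k‖ * (2 * (R₀ * (C * s ^ 2))) := by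
            gcongr
            exact (hC.2 s).2.2.1
        _ = _ := by ring
  have t2 : EvenTame A₂ fun _ => Complex.exp (-(Complex.I * k * along θ y)) := by
    refine (evenTame_const hM ?_).mono (by linarith) (by rw [hA₂]; linarith)
    rw [Complex.norm_exp]
    refine Real.exp_le_exp.2 ((Complex.re_le_norm _).trans ?_)
    rw [norm_neg, norm_mul, norm_mul, Complex.norm_I, one_mul, Complex.norm_real,
      Real.norm_eq_abs]
    gcongr
  have t3 : EvenTame A₂ (dens k) := by
    refine (evenTame_of_even hC1 (hC.2 0).1 (dens_neg k) (fun s => (hC.2 s).2.1)).mono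
      (by linarith) (by rw [hA₂]; linarith)
  have t4 : EvenTame A₂ (dirC k) := by
    refine (evenTame_of_even hC1 ?_ (dirC_neg k) (fun s => ?_)).mono
      (by linarith) (by rw [hA₂]; linarith)
    · simpa [dirC_zero] using hC1
    · rw [dirC_zero]; exact (hC.2 s).2.2.1
  have t5 : EvenTame A₂ (dirS k) :=
    (evenTame_dirS hC).mono (by linarith) (by rw [hA₂]; linarith)
  have t6 : EvenTame A₃ (pathWave k θ y) := by
    have := t2.mul_of_le hA₂0 hA₃.le t1
    refine (congrArg (EvenTame A₃) (funext fun s => ?_)).mp this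
    rw [← Complex.exp_add, pathWave]
    congr 1
    simp only [hz, along, across]
    push_cast
    ring
  have t7 : EvenTame A₄ fun s => dens k s * pathWave k θ y s :=
    (t3.mono hA₂0 h23).mul_of_le hA₃0 hA₄.le t6
  exact ⟨t7.mono hA₄0 h45, t7.mul_of_le hA₄0 hA₅.le (t4.mono hA₂0 (h23.trans h34)),
    t7.mul_of_le hA₄0 hA₅.le (t5.mono hA₂0 (h23.trans h34))⟩

/-- Second differences are linear, so the pointwise bounds for waves integrate against the source
densities. Rotating by `θ` only mixes the two dipole densities with coefficients of modulus at most
`1`. -/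
lemma exists_second_difference_pathAmplitude_le {k : ℂ} (hk : k ∈ Complex.slitPlane)
    {μ : Measure Plane} {a : Plane → ℂ} {b : Fin 2 → Plane → ℂ} {R₀ : ℝ} (hR₀ : 0 ≤ R₀)
    (hs : IsSource μ a b (Metric.closedBall 0 R₀)) :
    ∃ A : ℝ, 0 ≤ A ∧ ∀ θ : Plane, ‖θ‖ = 1 → ∀ s : ℝ,
      ‖dens k s * pathAmplitude k μ a b θ s + dens k (-s) * pathAmplitude k μ a b θ (-s)
        - 2 * (dens k 0 * pathAmplitude k μ a b θ 0)‖ ≤ A * s ^ 2 * Real.exp (A * s ^ 2) := by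
  obtain ⟨A, hA, hw⟩ := exists_evenTame_pathWave hk R₀ hR₀
  set B : ℝ := ∫ y, (‖a y‖ + 2 * ‖k‖ * (‖b 0 y‖ + ‖b 1 y‖)) ∂μ
  have iB : Integrable (fun y => ‖a y‖ + 2 * ‖k‖ * (‖b 0 y‖ + ‖b 1 y‖)) μ :=
    hs.integrable_mono.norm.add
      (((hs.integrable_di 0).norm.add (hs.integrable_di 1).norm).const_mul _)
  have hB : 0 ≤ B := integral_nonneg fun y => by positivity
  refine ⟨A * B + A, by positivity, fun θ hθ s => ?_⟩
  have hθi : ∀ i, |θ i| ≤ 1 := fun i => hθ ▸ abs_apply_le_norm θ i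
  set w : Plane → ℝ → ℂ := fun y s => dens k s * ((a y - Complex.I * k *
    (b 0 y * (θ 0 * dirC k s - θ 1 * dirS k s) + b 1 y * (θ 1 * dirC k s + θ 0 * dirS k s))) *
      pathWave k θ y s) with hwdef
  have hwint : ∀ s, dens k s * pathAmplitude k μ a b θ s = ∫ y, w y s ∂μ := by
    intro s
    rw [pathAmplitude, amplitude, ← integral_const_mul]
    rfl
  have hwi : ∀ s, Integrable (fun y => w y s) μ := by
    intro s
    have h1 : Integrable (fun y => a y - Complex.I * k *
        (b 0 y * (θ 0 * dirC k s - θ 1 * dirS k s) +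
          b 1 y * (θ 1 * dirC k s + θ 0 * dirS k s))) μ :=
      hs.integrable_mono.sub ((((hs.integrable_di 0).mul_const _).add
        ((hs.integrable_di 1).mul_const _)).const_mul _)
    have hc : Continuous fun y => pathWave k θ y s := by unfold pathWave; fun_prop
    obtain ⟨M, hM⟩ := (isCompact_closedBall (0 : Plane) R₀).exists_bound_of_continuousOn
      hc.continuousOn
    refine Integrable.const_mul ?_ _
    refine (h1.norm.mul_const M).mono' (h1.aestronglyMeasurable.mul hc.aestronglyMeasurable)
      (ae_of_all _ fun y => ?_)
    rw [norm_mul]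
    by_cases hy : y ∈ Metric.closedBall (0 : Plane) R₀
    · gcongr
      exact hM y hy
    · simp [hs.mono_eq_zero y hy, hs.di_eq_zero _ y hy]
  have hpt : ∀ y, ‖w y s + w y (-s) - 2 * w y 0‖ ≤
      (A * s ^ 2 * Real.exp (A * s ^ 2)) * (‖a y‖ + 2 * ‖k‖ * (‖b 0 y‖ + ‖b 1 y‖)) := by
    intro y
    by_cases hy : y ∈ Metric.closedBall (0 : Plane) R₀
    · obtain ⟨⟨-, -, h0⟩, ⟨-, -, h1⟩, ⟨-, -, h2⟩⟩ := hw θ y hθ (by simpa using hy)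
      set D : (ℝ → ℂ) → ℂ := fun f => f s + f (-s) - 2 * f 0 with hD
      have e : w y s + w y (-s) - 2 * w y 0 =
          a y * D (fun s => dens k s * pathWave k θ y s)
          - Complex.I * k * ((b 0 y * θ 0 + b 1 y * θ 1) *
            D (fun s => dens k s * pathWave k θ y s * dirC k s))
          - Complex.I * k * ((b 1 y * θ 0 - b 0 y * θ 1) *
            D (fun s => dens k s * pathWave k θ y s * dirS k s)) := by
        simp only [hwdef, hD]
        ring
      set X := A * s ^ 2 * Real.exp (A * s ^ 2)
      have hb1 : ‖b 0 y * θ 0 + b 1 y * θ 1‖ ≤ ‖b 0 y‖ + ‖b 1 y‖ := by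
        refine (norm_add_le _ _).trans ?_
        rw [norm_mul, norm_mul, Complex.norm_real, Complex.norm_real]
        gcongr
        · exact mul_le_of_le_one_right (norm_nonneg _) (hθi 0)
        · exact mul_le_of_le_one_right (norm_nonneg _) (hθi 1)
      have hb2 : ‖b 1 y * θ 0 - b 0 y * θ 1‖ ≤ ‖b 0 y‖ + ‖b 1 y‖ := by
        rw [add_comm]
        refine (norm_sub_le _ _).trans ?_
        rw [norm_mul, norm_mul, Complex.norm_real, Complex.norm_real]
        gcongr
        · exact mul_le_of_le_one_right (norm_nonneg _) (hθi 0)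
        · exact mul_le_of_le_one_right (norm_nonneg _) (hθi 1)
      have h0' : ‖D (fun s => dens k s * pathWave k θ y s)‖ ≤ X := h0 s
      have h1' : ‖D (fun s => dens k s * pathWave k θ y s * dirC k s)‖ ≤ X := h1 s
      have h2' : ‖D (fun s => dens k s * pathWave k θ y s * dirS k s)‖ ≤ X := h2 s
      rw [e]
      refine (norm_sub_le _ _).trans ?_
      have hX : 0 ≤ X := by positivity
      calc _ ≤ ‖a y‖ * X + ‖k‖ * ((‖b 0 y‖ + ‖b 1 y‖) * X)
            + ‖k‖ * ((‖b 0 y‖ + ‖b 1 y‖) * X) := by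
            refine add_le_add ((norm_sub_le _ _).trans (add_le_add ?_ ?_)) ?_
            · rw [norm_mul]; gcongr
            · rw [norm_mul, norm_mul, norm_mul, Complex.norm_I, one_mul]; gcongr
            · rw [norm_mul, norm_mul, norm_mul, Complex.norm_I, one_mul]; gcongr
        _ = _ := by ring
    · simp [hwdef, hs.mono_eq_zero y hy, hs.di_eq_zero _ y hy]
  have hsum : dens k s * pathAmplitude k μ a b θ s + dens k (-s) * pathAmplitude k μ a b θ (-s)
        - 2 * (dens k 0 * pathAmplitude k μ a b θ 0)
      = ∫ y, (w y s + w y (-s) - 2 * w y 0) ∂μ := by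
    have i12 : Integrable (fun y => w y s + w y (-s)) μ := (hwi s).add (hwi (-s))
    rw [hwint, hwint, hwint, integral_sub i12 ((hwi 0).const_mul 2), integral_add (hwi s) (hwi (-s)),
      integral_const_mul 2 fun y => w y 0]
  rw [hsum]
  calc _ ≤ ∫ y, (A * s ^ 2 * Real.exp (A * s ^ 2)) *
        (‖a y‖ + 2 * ‖k‖ * (‖b 0 y‖ + ‖b 1 y‖)) ∂μ :=
        norm_integral_le_of_norm_le (iB.const_mul _) (ae_of_all _ hpt)
    _ = (A * B) * s ^ 2 * Real.exp (A * s ^ 2) := by rw [integral_const_mul]; ring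
    _ ≤ _ := by
        have : 0 ≤ A * B := by positivity
        gcongr <;> linarith

/-! ### Far-field patterns of potentials -/

/-- The far-field pattern of a potential. -/
def farField (k : ℂ) (μ : Measure Plane) (a : Plane → ℂ) (b : Fin 2 → Plane → ℂ) (θ : Plane) : ℂ :=
  1 / (4 * Real.pi) * ((∫ s : ℝ, Complex.exp (-lam k * (s : ℂ) ^ 2)) *
    (2 * sig k * amplitude k μ a b (θ 0) (θ 1)))

lemma integral_gaussian_lam_ne_zero {k : ℂ} (hk : k ∈ Complex.slitPlane) :
    (∫ s : ℝ, Complex.exp (-lam k * (s : ℂ) ^ 2)) ≠ 0 := by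
  have h := lam_re_pos hk
  have h0 : lam k ≠ 0 := fun h0 => by simp [h0] at h
  rw [integral_gaussian_complex h, Complex.cpow_ne_zero_iff]
  exact Or.inl (div_ne_zero (by exact_mod_cast Real.pi_ne_zero) h0)

lemma farField_eq_zero_iff {k : ℂ} (hk : k ∈ Complex.slitPlane) {μ : Measure Plane}
    {a : Plane → ℂ} {b : Fin 2 → Plane → ℂ} {θ : Plane} :
    farField k μ a b θ = 0 ↔ amplitude k μ a b (θ 0) (θ 1) = 0 := by
  have h1 := integral_gaussian_lam_ne_zero hk
  have h2 := sig_ne_zero hk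
  have h3 : (Real.pi : ℂ) ≠ 0 := by exact_mod_cast Real.pi_ne_zero
  rw [farField, mul_eq_zero, mul_eq_zero, mul_eq_zero]
  simp only [h1, h2, mul_eq_zero, OfNat.ofNat_ne_zero, false_or, one_div, inv_eq_zero, h3]

lemma integral_sqrt_scale {E : Type*} [NormedAddCommGroup E] [NormedSpace ℝ E] {r : ℝ} (hr : 0 < r)
    (f : ℝ → E) : ∫ s, f (√r * s) = (√r)⁻¹ • ∫ s, f s := by
  rw [Measure.integral_comp_mul_left, abs_of_pos (by positivity)]

/-- Laplace's method with an exactly quadratic phase. As the Gaussian is even, only the symmetric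
part of the amplitude counts; it differs from its value at `s = 0` by `O(s²)`. The extra `s²` gains
a factor `1 / r` over the leading order `r^{-1/2}`. -/
lemma exists_norm_potential_sub_le {k : ℂ} (hk : k ∈ Complex.slitPlane) {μ : Measure Plane}
    [SFinite μ] {a : Plane → ℂ} {b : Fin 2 → Plane → ℂ} {R₀ : ℝ} (hR₀ : 0 ≤ R₀)
    (hs : IsSource μ a b (Metric.closedBall 0 R₀)) :
    ∃ C R : ℝ, 0 < R ∧ ∀ r : ℝ, R ≤ r → ∀ θ : Plane, ‖θ‖ = 1 → ∃ ρ : ℂ, ‖ρ‖ ≤ C / r ∧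
      potential k μ a b (r • θ) = Complex.exp (Complex.I * k * (r : ℂ)) / (√r : ℂ) *
        (farField k μ a b θ + ρ) := by
  obtain ⟨R₁, hR₁, hpot⟩ := exists_potential_eq_integral hk hR₀ hs
  obtain ⟨A, hA, hsd⟩ := exists_second_difference_pathAmplitude_le hk hR₀ hs
  have hlam := lam_re_pos hk
  set Λ := (lam k).re with hΛ
  set G : ℝ := ∫ s : ℝ, s ^ 2 * Real.exp (-(Λ / 2) * s ^ 2) with hG
  -- For `r ≥ 2 A / Λ` the growth `e^{A s²}` of the second difference uses up at most half of the
  -- Gaussian decay.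
  refine ⟨1 / (4 * Real.pi) * (1 / 2 * (A * G)), max R₁ (2 * A / Λ + 1), lt_max_of_lt_left hR₁,
    fun r hr θ hθ => ?_⟩
  have hr1 : R₁ ≤ r := (le_max_left _ _).trans hr
  have hr2 : A ≤ Λ * r / 2 := by
    have : 2 * A / Λ ≤ r := by linarith [(le_max_right _ _).trans hr]
    rw [div_le_iff₀ hlam] at this
    linarith
  have hr0 : 0 < r := hR₁.trans_le hr1
  have hsr : 0 < √r := Real.sqrt_pos.2 hr0
  obtain ⟨hint, heq⟩ := hpot r hr1 θ hθ
  set M : ℝ → ℂ := fun s => dens k s * pathAmplitude k μ a b θ s with hM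
  set E : ℝ → ℂ := fun s => Complex.exp (-(lam k * r) * (s : ℂ) ^ 2) with hE
  have hM0 : M 0 = 2 * sig k * amplitude k μ a b (θ 0) (θ 1) := by
    simp [hM, pathAmplitude, dens_zero, dirC_zero, dirS_zero]
  have hpw : ∀ s, planeWave k r 0 s = Complex.exp (Complex.I * k * r) * E s :=
    fun s => planeWave_zero_right hk r s
  have hlr : 0 < (lam k * r).re := by
    rw [Complex.re_mul_ofReal]; positivity
  have hEint : Integrable E := integrable_cexp_neg_mul_sq hlr
  have hEM : Integrable fun s => E s * M s := by
    have := hint.const_mul (Complex.exp (Complex.I * k * r))⁻¹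
    refine this.congr (ae_of_all _ fun s => ?_)
    simp only [hpw]
    rw [mul_assoc _ (E s), inv_mul_cancel_left₀ (Complex.exp_ne_zero _)]
  have hEneg : ∀ s, E (-s) = E s := fun s => by simp [hE]
  have hEM' : Integrable fun s => E s * M (-s) := by
    simpa only [hEneg] using hEM.comp_neg
  have hEMeq : ∫ s, E s * M (-s) = ∫ s, E s * M s := by
    simpa only [hEneg] using integral_neg_eq_self (fun s => E s * M s) volume
  set S : ℂ := ∫ s, E s * (M s + M (-s) - 2 * M 0) with hS
  have hsplit : ∫ s, E s * M s = M 0 * (∫ s, E s) + 1 / 2 * S := by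
    have : S = (∫ s, E s * M s) + (∫ s, E s * M (-s)) - (2 * M 0) * ∫ s, E s := by
      have hadd : Integrable fun s => E s * M s + E s * M (-s) := hEM.add hEM'
      rw [← integral_const_mul, ← integral_add hEM hEM',
        ← integral_sub hadd (hEint.const_mul _)]
      refine integral_congr_ae (ae_of_all _ fun s => ?_)
      ring
    rw [this, hEMeq]
    ring
  have hE0 : ∫ s, E s = (∫ s : ℝ, Complex.exp (-lam k * (s : ℂ) ^ 2)) / (√r : ℂ) := by
    have := integral_sqrt_scale hr0 fun s : ℝ => Complex.exp (-lam k * (s : ℂ) ^ 2)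
    rw [Complex.real_smul, Complex.ofReal_inv] at this
    rw [div_eq_inv_mul, ← this]
    congr 1
    ext s
    simp only [hE]
    congr 1
    rw [Complex.ofReal_mul, mul_pow, ← Complex.ofReal_pow (√r), Real.sq_sqrt hr0.le]
    ring
  have hG2 : ∫ s : ℝ, s ^ 2 * Real.exp (-(Λ * r / 2) * s ^ 2) = r⁻¹ * ((√r)⁻¹ * G) := by
    have := integral_sqrt_scale hr0 fun s : ℝ => s ^ 2 * Real.exp (-(Λ / 2) * s ^ 2)
    rw [smul_eq_mul] at this
    rw [hG, ← this, ← integral_const_mul]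
    congr 1
    ext s
    rw [mul_pow, Real.sq_sqrt hr0.le]
    field_simp
  have hgint : Integrable fun s : ℝ => A * (s ^ 2 * Real.exp (-(Λ * r / 2) * s ^ 2)) := by
    have := integrable_rpow_mul_exp_neg_mul_sq (b := Λ * r / 2) (by positivity) (s := 2) (by norm_num)
    refine Integrable.const_mul ?_ _
    simpa only [Real.rpow_two] using this
  have hSle : ‖S‖ ≤ A * G / (r * √r) := by
    calc ‖S‖ ≤ ∫ s : ℝ, A * (s ^ 2 * Real.exp (-(Λ * r / 2) * s ^ 2)) := by
          refine norm_integral_le_of_norm_le hgint (ae_of_all _ fun s => ?_)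
          rw [norm_mul]
          calc ‖E s‖ * ‖M s + M (-s) - 2 * M 0‖
              ≤ Real.exp (-(Λ * r) * s ^ 2) * (A * s ^ 2 * Real.exp (A * s ^ 2)) := by
                rw [norm_exp_neg_lam_mul_sq r s]
                gcongr
                exact hsd θ hθ s
            _ ≤ Real.exp (-(Λ * r) * s ^ 2) * (A * s ^ 2 * Real.exp (Λ * r / 2 * s ^ 2)) := by
                gcongr
            _ = A * s ^ 2 * (Real.exp (-(Λ * r) * s ^ 2) * Real.exp (Λ * r / 2 * s ^ 2)) := by ring
            _ = _ := by
                rw [← Real.exp_add, mul_assoc]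
                ring_nf
      _ = _ := by
          rw [integral_const_mul, hG2]
          field_simp
  refine ⟨1 / (4 * Real.pi) * (1 / 2 * (S * (√r : ℂ))), ?_, ?_⟩
  · simp only [norm_mul, norm_div, norm_one, Complex.norm_ofNat, Complex.norm_real,
      Real.norm_eq_abs, abs_of_pos hsr, abs_of_pos Real.pi_pos]
    calc _ ≤ 1 / (4 * Real.pi) * (1 / 2 * (A * G / (r * √r) * √r)) := by gcongr
      _ = _ := by field_simp
  · have hsc : (√r : ℂ) ≠ 0 := by exact_mod_cast hsr.ne'
    have hpi : (Real.pi : ℂ) ≠ 0 := by exact_mod_cast Real.pi_ne_zero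
    rw [heq]
    have : ∫ s, planeWave k r 0 s * (dens k s * pathAmplitude k μ a b θ s)
        = Complex.exp (Complex.I * k * r) * ∫ s, E s * M s := by
      rw [← integral_const_mul]
      congr 1
      ext s
      rw [hpw]
      ring
    rw [this, hsplit, hE0, hM0, farField]
    field_simp

lemma isFarField_of_eq_potential {k : ℂ} (hk : k ∈ Complex.slitPlane) {μ : Measure Plane}
    [SFinite μ] {a : Plane → ℂ} {b : Fin 2 → Plane → ℂ} {R₀ : ℝ} (hR₀ : 0 ≤ R₀)
    (hs : IsSource μ a b (Metric.closedBall 0 R₀)) {u : Plane → ℂ}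
    (hu : ∀ x, R₀ < ‖x‖ → u x = potential k μ a b x) :
    IsFarField k u fun θ => farField k μ a b θ := by
  obtain ⟨C, R, hR, h⟩ := exists_norm_potential_sub_le hk hR₀ hs
  refine ⟨C, max R (R₀ + 1), lt_max_of_lt_left hR, fun r hr θ => ?_⟩
  have hθ : ‖(θ : Plane)‖ = 1 := by simp
  have hr0 : R₀ + 1 ≤ r := (le_max_right _ _).trans hr
  obtain ⟨ρ, h1, h2⟩ := h r ((le_max_left _ _).trans hr) θ hθ
  refine ⟨ρ, h1, ?_⟩
  rw [hu _ (by rw [norm_smul, hθ, mul_one, Real.norm_eq_abs]; linarith [le_abs_self r]), h2]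

lemma IsFarField.unique {k : ℂ} {u : Plane → ℂ} {w w' : Metric.sphere (0 : Plane) 1 → ℂ}
    (h : IsFarField k u w) (h' : IsFarField k u w') : w = w' := by
  obtain ⟨C, R, hR, h⟩ := h
  obtain ⟨C', R', hR', h'⟩ := h'
  ext θ
  have hle : ∀ᶠ r : ℝ in atTop, ‖w θ - w' θ‖ ≤ (C + C') / r := by
    filter_upwards [eventually_ge_atTop R, eventually_ge_atTop R'] with r h1 h2
    obtain ⟨ρ, hρ, e⟩ := h r h1 θ
    obtain ⟨ρ', hρ', e'⟩ := h' r h2 θ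
    have hr : 0 < √r := Real.sqrt_pos.2 (hR.trans_le h1)
    rw [e] at e'
    have hne : Complex.exp (Complex.I * k * (r : ℂ)) / (√r : ℂ) ≠ 0 :=
      div_ne_zero (Complex.exp_ne_zero _) (by exact_mod_cast hr.ne')
    have e2 := mul_left_cancel₀ hne e'
    have : w θ - w' θ = ρ' - ρ := by linear_combination e2
    rw [this, add_div]
    exact (norm_sub_le _ _).trans (by linarith)
  have hlim : Tendsto (fun r : ℝ => (C + C') / r) atTop (𝓝 0) :=
    tendsto_const_nhds.div_atTop tendsto_id
  have := ge_of_tendsto hlim hle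
  exact sub_eq_zero.1 (norm_le_zero_iff.1 this)

/-! ### Holomorphic dependence on parameters -/

lemma integrable_mul_of_continuousOn {X : Type*} [TopologicalSpace X] [T2Space X]
    [MeasurableSpace X] [OpensMeasurableSpace X] {μ : Measure X} {c f : X → ℂ}
    (hc : Integrable c μ) {K : Set X} (hK : IsCompact K) (hcK : ∀ y ∉ K, c y = 0)
    (hf : ContinuousOn f K) : Integrable (fun y => c y * f y) μ := by
  have h := hc.integrableOn.mul_continuousOn hf hK
  refine (integrableOn_iff_integrable_of_support_subset fun y hy => ?_).1 h
  by_contra hyK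
  exact hy (by simp [hcK y hyK])

/-- Joint continuity bounds `F` on a compact product. Cauchy's estimate on discs of radius `ε / 2`
turns this into a bound for the `t`-derivative, so domination needs no separate hypothesis on
derivatives. -/
lemma differentiableOn_integral_mul {X : Type*} [TopologicalSpace X] [T2Space X]
    [MeasurableSpace X] [OpensMeasurableSpace X] {μ : Measure X} {c : X → ℂ}
    (hc : Integrable c μ) {K : Set X} (hK : IsCompact K) (hcK : ∀ y ∉ K, c y = 0)
    {U : Set ℂ} (hU : IsOpen U) {F : ℂ → X → ℂ}
    (hF : ContinuousOn (Function.uncurry F) (U ×ˢ K))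
    (hd : ∀ y ∈ K, DifferentiableOn ℂ (fun t => F t y) U) :
    DifferentiableOn ℂ (fun t => ∫ y, c y * F t y ∂μ) U := by
  intro t₀ ht₀
  obtain ⟨ε, hε, hεU⟩ := Metric.nhds_basis_closedBall.mem_iff.1 (hU.mem_nhds ht₀)
  obtain ⟨B, hB⟩ := ((isCompact_closedBall t₀ ε).prod hK).exists_bound_of_continuousOn
    (hF.mono (Set.prod_mono hεU subset_rfl))
  have hFt : ∀ t ∈ U, ContinuousOn (F t) K := fun t ht =>
    hF.comp (by fun_prop : ContinuousOn (fun y => (t, y)) K) fun y hy => ⟨ht, hy⟩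
  have hint : ∀ t ∈ U, Integrable (fun y => c y * F t y) μ := fun t ht =>
    integrable_mul_of_continuousOn hc hK hcK (hFt t ht)
  have hderiv : ∀ y, ∀ t ∈ U, HasDerivAt (fun t => c y * F t y)
      (c y * deriv (fun t => F t y) t) t := by
    intro y t ht
    by_cases hy : y ∈ K
    · exact (((hd y hy).differentiableAt (hU.mem_nhds ht)).hasDerivAt).const_mul _
    · simpa [hcK y hy] using hasDerivAt_const t (0 : ℂ)
  have hball : Metric.ball t₀ (ε / 2) ⊆ U := fun t ht =>
    hεU (Metric.ball_subset_closedBall (Metric.ball_subset_ball (by linarith) ht))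
  -- Measurability in `y` of the derivative at `t₀`, obtained as a pointwise limit of difference
  -- quotients.
  have hmeas : AEStronglyMeasurable (fun y => c y * deriv (fun t => F t y) t₀) μ := by
    have hlim : ∀ y, Tendsto (fun n : ℕ => ((ε / 2 / (n + 1) : ℝ) : ℂ)⁻¹ •
        (c y * F (t₀ + ((ε / 2 / (n + 1) : ℝ) : ℂ)) y - c y * F t₀ y)) atTop
        (𝓝 (c y * deriv (fun t => F t y) t₀)) := by
      intro y
      refine (hderiv y t₀ ht₀).tendsto_slope_zero.comp ?_
      refine tendsto_nhdsWithin_iff.2 ⟨?_, Eventually.of_forall fun n => ?_⟩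
      · have h1 : Tendsto (fun n : ℕ => ε / 2 / ((n : ℝ) + 1)) atTop (𝓝 0) :=
          tendsto_const_nhds.div_atTop
            (tendsto_atTop_add_const_right _ _ tendsto_natCast_atTop_atTop)
        exact_mod_cast (Complex.continuous_ofReal.tendsto 0).comp h1
      · have : (0 : ℝ) < ε / 2 / (n + 1) := by positivity
        simpa only [Set.mem_compl_iff, Set.mem_singleton_iff, Complex.ofReal_eq_zero] using this.ne'
    refine aestronglyMeasurable_of_tendsto_ae atTop (fun n => ?_) (ae_of_all _ hlim)
    refine ((hint _ (hεU ?_)).sub (hint t₀ ht₀)).aestronglyMeasurable.const_smul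
      ((ε / 2 / (n + 1) : ℝ) : ℂ)⁻¹
    have h0 : (0 : ℝ) < ε / 2 / (n + 1) := by positivity
    have h1 : ε / 2 / (n + 1) ≤ ε / 2 := div_le_self (by positivity) (by linarith [n.cast_nonneg (α := ℝ)])
    rw [Metric.mem_closedBall, dist_eq_norm, add_sub_cancel_left, Complex.norm_real,
      Real.norm_eq_abs, abs_of_pos h0]
    linarith
  have key := hasDerivAt_integral_of_dominated_loc_of_deriv_le (μ := μ) (𝕜 := ℂ)
    (F := fun t y => c y * F t y) (F' := fun t y => c y * deriv (fun t => F t y) t)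
    (bound := fun y => ‖c y‖ * (B / (ε / 2))) (x₀ := t₀)
    (Metric.ball_mem_nhds t₀ (half_pos hε))
    ((hU.mem_nhds ht₀ |> eventually_mem_set.2).mono fun t ht => (hint t ht).aestronglyMeasurable)
    (hint t₀ ht₀) hmeas (ae_of_all _ fun y t ht => ?_) (hc.norm.mul_const _)
    (ae_of_all _ fun y t ht => hderiv y t (hball ht))
  · exact key.2.differentiableAt.differentiableWithinAt
  · by_cases hy : y ∈ K
    · rw [norm_mul]
      gcongr
      have hsub : Metric.closedBall t (ε / 2) ⊆ Metric.closedBall t₀ ε :=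
        Metric.closedBall_subset_closedBall' (by linarith [Metric.mem_ball.1 ht])
      refine Complex.norm_deriv_le_of_forall_mem_sphere_norm_le (half_pos hε) ?_ fun z hz =>
        hB (z, y) ⟨hsub (Metric.sphere_subset_closedBall hz), hy⟩
      refine DifferentiableOn.diffContOnCl ?_
      rw [closure_ball _ (half_pos hε).ne']
      exact (hd y hy).mono (hsub.trans hεU)
    · simp [hcK y hy]

/-! ### Vanishing far-field patterns -/

/-- Since `(p + iq)(p - iq) = 1`, the number `p + iq` is nonzero and equals `e^{it}` for a complex
`t`. Thus a single entire parameter covers the whole complex circle. -/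
lemma exists_cos_sin_eq {p q : ℂ} (h : p ^ 2 + q ^ 2 = 1) :
    ∃ t : ℂ, Complex.cos t = p ∧ Complex.sin t = q := by
  have hI := Complex.I_mul_I
  have hmul : (p + Complex.I * q) * (p - Complex.I * q) = 1 := by
    linear_combination h - q ^ 2 * hI
  have h0 : p + Complex.I * q ≠ 0 := left_ne_zero_of_mul_eq_one hmul
  have e1 : Complex.exp (-Complex.I * Complex.log (p + Complex.I * q) * Complex.I)
      = p + Complex.I * q := by
    rw [show -Complex.I * Complex.log (p + Complex.I * q) * Complex.I
      = Complex.log (p + Complex.I * q) by linear_combination -Complex.log (p + Complex.I * q) * hI,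
      Complex.exp_log h0]
  have e2 : Complex.exp (-(-Complex.I * Complex.log (p + Complex.I * q)) * Complex.I)
      = p - Complex.I * q := by
    rw [neg_mul, Complex.exp_neg, e1]
    exact inv_eq_of_mul_eq_one_right hmul
  refine ⟨-Complex.I * Complex.log (p + Complex.I * q), ?_, ?_⟩
  · rw [Complex.cos, e1, e2]; ring
  · rw [Complex.sin, e1, e2]; linear_combination -q * hI

lemma exists_real_cos_sin_eq {x y : ℝ} (h : x ^ 2 + y ^ 2 = 1) :
    ∃ t : ℝ, Real.cos t = x ∧ Real.sin t = y := by
  have h1 : ‖(⟨x, y⟩ : ℂ)‖ = 1 := by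
    rw [Complex.norm_def, Complex.normSq_mk, ← sq, ← sq, h, Real.sqrt_one]
  have h0 : (⟨x, y⟩ : ℂ) ≠ 0 := by
    intro h0; simp [h0] at h1
  refine ⟨Complex.arg ⟨x, y⟩, ?_, ?_⟩
  · rw [Complex.cos_arg h0, h1, div_one]
  · rw [Complex.sin_arg, h1, div_one]

lemma differentiable_amplitude_cos_sin {k : ℂ} {μ : Measure Plane} {a : Plane → ℂ}
    {b : Fin 2 → Plane → ℂ} {R₀ : ℝ} (hs : IsSource μ a b (Metric.closedBall 0 R₀)) :
    Differentiable ℂ fun t => amplitude k μ a b (Complex.cos t) (Complex.sin t) := by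
  set E : ℂ → Plane → ℂ := fun t y =>
    Complex.exp (-(Complex.I * k * (y 0 * Complex.cos t + y 1 * Complex.sin t))) with hE
  have hEc : Continuous (Function.uncurry E) := by
    simp only [hE, Function.uncurry_def]
    fun_prop
  have hK : IsCompact (Metric.closedBall (0 : Plane) R₀) := isCompact_closedBall _ _
  have hd : ∀ {c : Plane → ℂ}, Integrable c μ → (∀ y ∉ Metric.closedBall 0 R₀, c y = 0) →
      Differentiable ℂ fun t => ∫ y, c y * E t y ∂μ := fun hc hcK =>
    differentiableOn_univ.1 (differentiableOn_integral_mul hc hK hcK isOpen_univ hEc.continuousOn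
      fun y _ => by simp only [hE]; fun_prop)
  have hi : ∀ {c : Plane → ℂ} (t : ℂ), Integrable c μ →
      (∀ y ∉ Metric.closedBall 0 R₀, c y = 0) → Integrable (fun y => c y * E t y) μ :=
    fun t hc hcK => integrable_mul_of_continuousOn hc hK hcK (by simp only [hE]; fun_prop)
  have heq : (fun t => amplitude k μ a b (Complex.cos t) (Complex.sin t)) = fun t =>
      (∫ y, a y * E t y ∂μ) - (Complex.I * k * Complex.cos t * (∫ y, b 0 y * E t y ∂μ) +
        Complex.I * k * Complex.sin t * ∫ y, b 1 y * E t y ∂μ) := by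
    ext t
    have h0 := (hi t (hs.integrable_di 0) (hs.di_eq_zero 0)).const_mul
      (Complex.I * k * Complex.cos t)
    have h1 := (hi t (hs.integrable_di 1) (hs.di_eq_zero 1)).const_mul
      (Complex.I * k * Complex.sin t)
    have h01 : Integrable (fun y => Complex.I * k * Complex.cos t * (b 0 y * E t y) +
        Complex.I * k * Complex.sin t * (b 1 y * E t y)) μ := h0.add h1
    rw [← integral_const_mul, ← integral_const_mul, ← integral_add h0 h1,
      ← integral_sub (hi t hs.integrable_mono hs.mono_eq_zero) h01, amplitude]
    refine integral_congr_ae (ae_of_all _ fun y => ?_)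
    simp only [hE]
    ring
  rw [heq]
  have h0 := hd (hs.integrable_di 0) (hs.di_eq_zero 0)
  have h1 := hd (hs.integrable_di 1) (hs.di_eq_zero 1)
  have h2 := hd hs.integrable_mono hs.mono_eq_zero
  fun_prop

/-- The point of the unit circle at angle `t`. -/
def circlePoint (t : ℝ) : Metric.sphere (0 : Plane) 1 :=
  ⟨!₂[Real.cos t, Real.sin t], by simp [EuclideanSpace.norm_eq, Fin.sum_univ_two]⟩

lemma continuous_circlePoint : Continuous circlePoint := by
  unfold circlePoint
  refine Continuous.subtype_mk ?_ _
  refine (PiLp.continuous_toLp 2 _).comp (continuous_pi fun i => ?_)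
  fin_cases i
  · exact Real.continuous_cos
  · exact Real.continuous_sin

lemma circlePoint_surjective : Function.Surjective circlePoint := by
  intro θ
  have h : ‖(θ : Plane)‖ = 1 := by simp
  have h2 := norm_sq_eq_sum_sq (θ : Plane)
  rw [h, one_pow] at h2
  obtain ⟨t, hc, hs⟩ := exists_real_cos_sin_eq h2.symm
  refine ⟨t, Subtype.ext ?_⟩
  ext i
  fin_cases i
  · exact hc
  · exact hs

/-- In the parameter `t` the amplitude is entire and vanishes on a real interval around some `t₀`;
the identity theorem and surjectivity of `(cos, sin)` onto the complex circle do the rest. -/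
lemma amplitude_eq_zero_of_farField {k : ℂ} (hk : k ∈ Complex.slitPlane) {μ : Measure Plane}
    {a : Plane → ℂ} {b : Fin 2 → Plane → ℂ} {R₀ : ℝ}
    (hs : IsSource μ a b (Metric.closedBall 0 R₀)) {V : Set (Metric.sphere (0 : Plane) 1)}
    (hV : IsOpen V) (hVn : V.Nonempty) (h : ∀ θ ∈ V, farField k μ a b θ = 0) {p q : ℂ}
    (hpq : p ^ 2 + q ^ 2 = 1) : amplitude k μ a b p q = 0 := by
  have hd := differentiable_amplitude_cos_sin (k := k) hs
  obtain ⟨θ, hθ⟩ := hVn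
  obtain ⟨t₀, rfl⟩ := circlePoint_surjective θ
  have hev : ∀ᶠ t : ℝ in 𝓝 t₀,
      amplitude k μ a b (Complex.cos (t : ℂ)) (Complex.sin (t : ℂ)) = 0 := by
    filter_upwards [continuous_circlePoint.continuousAt.preimage_mem_nhds (hV.mem_nhds hθ)]
      with t ht
    have := (farField_eq_zero_iff hk).1 (h _ ht)
    simpa [circlePoint] using this
  have hfr : ∃ᶠ t : ℂ in 𝓝[≠] (t₀ : ℂ),
      amplitude k μ a b (Complex.cos t) (Complex.sin t) = 0 := by
    have htend : Tendsto (fun t : ℝ => (t : ℂ)) (𝓝[≠] t₀) (𝓝[≠] (t₀ : ℂ)) :=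
      tendsto_nhdsWithin_iff.2 ⟨(Complex.continuous_ofReal.tendsto t₀).mono_left nhdsWithin_le_nhds,
        eventually_nhdsWithin_of_forall fun t ht => by simpa using ht⟩
    exact htend.frequently (hev.filter_mono nhdsWithin_le_nhds).frequently
  obtain ⟨t, rfl, rfl⟩ := exists_cos_sin_eq hpq
  have := (hd.differentiableOn.analyticOnNhd isOpen_univ).eq_of_frequently_eq
    (analyticOnNhd_const (v := (0 : ℂ))) hfr
  exact congrFun this t

/-- The integral formula is exact and samples the amplitude only at points of the complex circle,
where it vanishes identically. No decay argument is involved, so nonreal `k` causes no difficulty.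
-/
lemma exists_potential_eq_zero {k : ℂ} (hk : k ∈ Complex.slitPlane) {μ : Measure Plane}
    [SFinite μ] {a : Plane → ℂ} {b : Fin 2 → Plane → ℂ} {R₀ : ℝ} (hR₀ : 0 ≤ R₀)
    (hs : IsSource μ a b (Metric.closedBall 0 R₀)) {V : Set (Metric.sphere (0 : Plane) 1)}
    (hV : IsOpen V) (hVn : V.Nonempty) (h : ∀ θ ∈ V, farField k μ a b θ = 0) :
    ∃ R₁ : ℝ, ∀ x, R₁ ≤ ‖x‖ → potential k μ a b x = 0 := by
  obtain ⟨R₁, hR₁, hp⟩ := exists_potential_eq_integral hk hR₀ hs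
  refine ⟨R₁, fun x hx => ?_⟩
  have hx0 : ‖x‖ ≠ 0 := (hR₁.trans_le hx).ne'
  have hθ : ‖‖x‖⁻¹ • x‖ = 1 := by
    rw [norm_smul, norm_inv, norm_norm, inv_mul_cancel₀ hx0]
  have h2 := norm_sq_eq_sum_sq (‖x‖⁻¹ • x)
  rw [hθ, one_pow] at h2
  have hx' : x = ‖x‖ • (‖x‖⁻¹ • x) := by rw [smul_smul, mul_inv_cancel₀ hx0, one_smul]
  rw [hx', (hp _ hx _ hθ).2]
  set θ := ‖x‖⁻¹ • x
  have h2c : (θ 0 : ℂ) ^ 2 + (θ 1 : ℂ) ^ 2 = 1 := by exact_mod_cast h2.symm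
  have h0 : ∀ s, pathAmplitude k μ a b θ s = 0 := fun s =>
    amplitude_eq_zero_of_farField hk hs hV hVn h (by
      have h3 := dirC_sq_add_dirS_sq k s
      linear_combination ((θ 0 : ℂ) ^ 2 + (θ 1 : ℂ) ^ 2) * h3 + h2c)
  simp [h0]

/-! ### Unique continuation -/

/-- The squared distance from a point of a complexified line to `y`. -/
def lineSq (z v : Plane) (t : ℂ) (y : Plane) : ℂ :=
  ((z 0 : ℂ) + t * v 0 - y 0) ^ 2 + ((z 1 : ℂ) + t * v 1 - y 1) ^ 2

lemma continuous_lineSq (z v : Plane) : Continuous (Function.uncurry (lineSq z v)) := by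
  simp only [Function.uncurry_def, lineSq]
  fun_prop

lemma lineSq_ofReal (z v y : Plane) (t : ℝ) :
    lineSq z v t y = ((‖z + t • v - y‖ ^ 2 : ℝ) : ℂ) := by
  rw [norm_sq_eq_sum_sq]
  simp [lineSq]

lemma isOpen_setOf_forall_lineSq_mem (z v : Plane) {K : Set Plane} (hK : IsCompact K) :
    IsOpen {t : ℂ | ∀ y ∈ K, lineSq z v t y ∈ Complex.slitPlane} := by
  refine isOpen_iff_mem_nhds.2 fun t ht => ?_
  refine hK.eventually_forall_of_forall_eventually fun y hy => ?_
  exact (continuous_lineSq z v).continuousAt.preimage_mem_nhds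
    (Complex.isOpen_slitPlane.mem_nhds (ht y hy))

/-- Let the line parameter be complex. The squared distance to a source point is polynomial in it
and positive at real parameters off `K`. By compactness of `K` it avoids the cut for all sources at
once on an open complex neighbourhood, where the potential extends holomorphically. -/
lemma analyticAt_potential_line {k : ℂ} (hk : k ≠ 0) {μ : Measure Plane}
    {a : Plane → ℂ} {b : Fin 2 → Plane → ℂ} {K : Set Plane} (hK : IsCompact K)
    (hs : IsSource μ a b K) {z v : Plane} {t₀ : ℝ} (ht₀ : z + t₀ • v ∉ K) :
    AnalyticAt ℝ (fun t : ℝ => potential k μ a b (z + t • v)) t₀ := by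
  set U : Set ℂ := {t : ℂ | ∀ y ∈ K, lineSq z v t y ∈ Complex.slitPlane} with hUdef
  have hU : IsOpen U := isOpen_setOf_forall_lineSq_mem z v hK
  have hΨ := differentiableOn_radialProfile k
  have hΨ' := hΨ.deriv Complex.isOpen_slitPlane
  have hQd : ∀ y, Differentiable ℂ fun t => lineSq z v t y := fun y => by
    simp only [lineSq]
    fun_prop
  have hQmem : Set.MapsTo (Function.uncurry (lineSq z v)) (U ×ˢ K) Complex.slitPlane :=
    fun x hx => hx.1 x.2 hx.2
  set F : ℂ → Plane → ℂ := fun t y => radialProfile k (lineSq z v t y) with hF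
  set G : Fin 2 → ℂ → Plane → ℂ := fun i t y =>
    deriv (radialProfile k) (lineSq z v t y) * (2 * ((y i : ℂ) - (z i + t * v i))) with hG
  have hFc : ContinuousOn (Function.uncurry F) (U ×ˢ K) :=
    hΨ.continuousOn.comp (continuous_lineSq z v).continuousOn hQmem
  have hGc : ∀ i, ContinuousOn (Function.uncurry (G i)) (U ×ˢ K) := fun i =>
    (hΨ'.continuousOn.comp (continuous_lineSq z v).continuousOn hQmem).mul (by fun_prop)
  have hFd : ∀ y ∈ K, DifferentiableOn ℂ (fun t => F t y) U := fun y hy =>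
    hΨ.comp (hQd y).differentiableOn fun t (ht : t ∈ U) => ht y hy
  have hGd : ∀ i, ∀ y ∈ K, DifferentiableOn ℂ (fun t => G i t y) U := fun i y hy =>
    (hΨ'.comp (hQd y).differentiableOn fun t (ht : t ∈ U) => ht y hy).mul (by fun_prop)
  have slice : ∀ {H : ℂ → Plane → ℂ}, ContinuousOn (Function.uncurry H) (U ×ˢ K) →
      ∀ t ∈ U, ContinuousOn (H t) K := fun hH t ht =>
    hH.comp (by fun_prop : ContinuousOn (fun y => (t, y)) K) fun y hy => ⟨ht, hy⟩
  have hP : DifferentiableOn ℂ (fun t => (∫ y, a y * F t y ∂μ) +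
      ((∫ y, b 0 y * G 0 t y ∂μ) + ∫ y, b 1 y * G 1 t y ∂μ)) U :=
    (differentiableOn_integral_mul hs.integrable_mono hK hs.mono_eq_zero hU hFc hFd).add
      ((differentiableOn_integral_mul (hs.integrable_di 0) hK (hs.di_eq_zero 0) hU (hGc 0)
        (hGd 0)).add
      (differentiableOn_integral_mul (hs.integrable_di 1) hK (hs.di_eq_zero 1) hU (hGc 1)
        (hGd 1)))
  have hmem : ∀ t : ℝ, z + t • v ∉ K → (t : ℂ) ∈ U := fun t ht y hy => by
    rw [lineSq_ofReal]
    exact ofReal_norm_sq_mem_slitPlane fun h => ht (h ▸ hy)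
  have hana := (hP.analyticAt (hU.mem_nhds (hmem t₀ ht₀))).restrictScalars (𝕜 := ℝ)
  have hcomp := hana.comp_of_eq (g := _) (f := fun t : ℝ => (t : ℂ)) (x := t₀)
    (Complex.ofRealCLM.analyticAt t₀) rfl
  refine hcomp.congr ?_
  have hcont : Continuous fun t : ℝ => z + t • v := by fun_prop
  filter_upwards [hcont.continuousAt.preimage_mem_nhds (hK.isClosed.isOpen_compl.mem_nhds ht₀)]
    with t ht
  have htU := hmem t ht
  have i0 := integrable_mul_of_continuousOn (hs.integrable_di 0) hK (hs.di_eq_zero 0)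
    (slice (hGc 0) t htU)
  have i1 := integrable_mul_of_continuousOn (hs.integrable_di 1) hK (hs.di_eq_zero 1)
    (slice (hGc 1) t htU)
  have i2 := integrable_mul_of_continuousOn hs.integrable_mono hK hs.mono_eq_zero
    (slice hFc t htU)
  have i01 : Integrable (fun y => b 0 y * G 0 t y + b 1 y * G 1 t y) μ := i0.add i1
  simp only [Function.comp]
  rw [← integral_add i0 i1, ← integral_add i2 i01, potential]
  refine integral_congr_ae (ae_of_all _ fun y => ?_)
  by_cases hy : y ∈ K
  · have hne : y ≠ z + t • v := fun h => ht (show z + t • v ∈ K from h ▸ hy)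
    simp only [hF, hG]
    rw [fundamentalSolution_eq_radialProfile hk hne.symm, fderiv_fundamentalSolution_single hk hne,
      fderiv_fundamentalSolution_single hk hne, lineSq_ofReal]
    simp
  · simp [hs.mono_eq_zero y hy, hs.di_eq_zero _ y hy]

/-- Functions that are analytic along lines and vanish near one point of a connected open set vanish
on the whole set. -/
lemma eqOn_zero_of_analyticAt_line {E : Type*} [NormedAddCommGroup E] [NormedSpace ℝ E]
    {Ω : Set E} (hΩ : IsOpen Ω) (hc : IsPreconnected Ω) {f : E → ℂ}
    (hf : ∀ (z v : E) (t₀ : ℝ), z + t₀ • v ∈ Ω → AnalyticAt ℝ (fun t : ℝ => f (z + t • v)) t₀)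
    {x₀ : E} (hx₀ : x₀ ∈ Ω) (h₀ : ∀ᶠ x in 𝓝 x₀, f x = 0) : ∀ x ∈ Ω, f x = 0 := by
  set Z : Set E := {x | ∀ᶠ y in 𝓝 x, f y = 0} with hZ
  have hZo : IsOpen Z := isOpen_setOfPred_eventually_nhds
  have hsub : Ω ⊆ Z := by
    refine hc.subset_of_closure_inter_subset hZo ⟨x₀, hx₀, h₀⟩ ?_
    rintro x ⟨hx, hxΩ⟩
    -- Near a limit point `x` of `Z`, pick `z ∈ Z` in a ball inside `Ω`. Each `y` in that ball is
    -- reached from `z` along a line on which `f` is analytic and vanishes near parameter `0`, hence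
    -- also at parameter `1`.
    obtain ⟨ε, hε, hεΩ⟩ := Metric.isOpen_iff.1 hΩ x hxΩ
    obtain ⟨z, hzZ, hzx⟩ := Metric.mem_closure_iff.1 hx ε hε
    rw [dist_comm] at hzx
    refine eventually_of_mem (Metric.ball_mem_nhds x hε) fun y hy => ?_
    have hconv : Convex ℝ ((fun t : ℝ => z + t • (y - z)) ⁻¹' Metric.ball x ε) := by
      have := (convex_ball x ε).affine_preimage (AffineMap.lineMap z y : ℝ →ᵃ[ℝ] E)
      have he : (AffineMap.lineMap z y : ℝ →ᵃ[ℝ] E) = fun t : ℝ => z + t • (y - z) := by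
        ext t
        rw [AffineMap.lineMap_apply_module', add_comm]
      rwa [he] at this
    have hana : AnalyticOnNhd ℝ (fun t : ℝ => f (z + t • (y - z)))
        ((fun t : ℝ => z + t • (y - z)) ⁻¹' Metric.ball x ε) := fun t ht => hf _ _ _ (hεΩ ht)
    have hcont : Continuous fun t : ℝ => z + t • (y - z) := by fun_prop
    have hzero : (fun t : ℝ => f (z + t • (y - z))) =ᶠ[𝓝 0] 0 := by
      have : Tendsto (fun t : ℝ => z + t • (y - z)) (𝓝 0) (𝓝 z) := by
        simpa using hcont.tendsto 0
      exact this.eventually hzZ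
    have := hana.eqOn_zero_of_preconnected_of_eventuallyEq_zero hconv.isPreconnected
      (by simpa using hzx) hzero (x := 1) (by simpa using hy)
    simpa using this
  exact fun x hx => (hsub hx).self_of_nhds

/-- `u` is, outside every neighbourhood of `C`, a potential of sources in that neighbourhood. -/
def IsPotentialAround (k : ℂ) (μ : Measure Plane) (C : Set Plane) (u : Plane → ℂ) : Prop :=
  ∀ δ > 0, ∃ (a : Plane → ℂ) (b : Fin 2 → Plane → ℂ), IsSource μ a b (Metric.cthickening δ C) ∧
    ∀ x ∉ Metric.cthickening δ C, u x = potential k μ a b x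

/-- Each point off the compact `C` lies outside some thickening of it, so one of the potentials
represents `u` near that point and analyticity along lines holds on all of the complement. It
remains to find one starting point near which `u` vanishes. -/
lemma IsPotentialAround.eq_zero {k : ℂ} (hk : k ≠ 0) {μ : Measure Plane} {C : Set Plane}
    (hC : IsCompact C) (hconn : IsPreconnected Cᶜ) {u : Plane → ℂ}
    (hu : IsPotentialAround k μ C u) {R : ℝ} (hR : ∀ x, R ≤ ‖x‖ → u x = 0) :
    ∀ x ∈ Cᶜ, u x = 0 := by
  obtain ⟨R', hR'⟩ := hC.isBounded.subset_closedBall 0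
  -- Far enough out to lie both outside `C` and in the region where `u` is already zero.
  set x₀ : Plane := EuclideanSpace.single 0 (|R| + |R'| + 1) with hx₀
  have hx₀n : ‖x₀‖ = |R| + |R'| + 1 := by
    rw [hx₀, PiLp.norm_single, Real.norm_eq_abs, abs_of_pos (by positivity)]
  refine eqOn_zero_of_analyticAt_line hC.isClosed.isOpen_compl hconn (fun z v t₀ ht₀ => ?_)
    (x₀ := x₀) ?_ ?_
  · have hcl := hC.isClosed
    have hcth : ∃ δ > 0, z + t₀ • v ∉ Metric.cthickening δ C := by
      by_contra! hcon
      exact ht₀ (by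
        rw [← hcl.closure_eq, Metric.closure_eq_iInter_cthickening]
        exact Set.mem_iInter₂.2 hcon)
    obtain ⟨δ, hδ, hmem⟩ := hcth
    obtain ⟨a, b, hs, he⟩ := hu δ hδ
    have hK : IsCompact (Metric.cthickening δ C) := hC.cthickening
    refine (analyticAt_potential_line hk hK hs hmem).congr ?_
    have hcont : Continuous fun t : ℝ => z + t • v := by fun_prop
    filter_upwards [hcont.continuousAt.preimage_mem_nhds
      (hK.isClosed.isOpen_compl.mem_nhds hmem)] with t ht
    exact (he _ ht).symm
  · intro h
    have := hR' h
    rw [mem_closedBall_zero_iff, hx₀n] at this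
    linarith [le_abs_self R', abs_nonneg R]
  · have : ∀ᶠ x in 𝓝 x₀, R < ‖x‖ := continuous_norm.continuousAt.eventually_const_lt (by
      simp only [hx₀n]; linarith [le_abs_self R, abs_nonneg R'])
    exact this.mono fun x hx => hR x hx.le

/-! ### The boundary has finite length -/

lemma norm_le_abs_add_abs (d : Plane) : ‖d‖ ≤ |d 0| + |d 1| := by
  refine abs_le_of_sq_le_sq' ?_ (by positivity) |>.2
  rw [norm_sq_eq_sum_sq]
  nlinarith [sq_abs (d 0), sq_abs (d 1), mul_nonneg (abs_nonneg (d 0)) (abs_nonneg (d 1))]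

lemma lipschitzWith_graph {K : NNReal} {γ : ℝ → ℝ} (hγ : LipschitzWith K γ) :
    LipschitzWith (1 + K) fun t : ℝ => (!₂[t, γ t] : Plane) := by
  refine LipschitzWith.of_dist_le_mul fun s t => ?_
  rw [dist_eq_norm]
  refine (norm_le_abs_add_abs _).trans ?_
  have h := hγ.dist_le_mul s t
  rw [Real.dist_eq, Real.dist_eq] at h
  simp only [PiLp.sub_apply, Real.dist_eq]
  simpa [add_mul] using h

lemma frontier_subset_graph {D : Set Plane} (hD : IsOpen D) {p : Plane} {e : Plane ≃ₗᵢ[ℝ] Plane}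
    {γ : ℝ → ℝ} {ε : ℝ} (hγ : Continuous γ)
    (h : ∀ x ∈ Metric.ball p ε, (x ∈ D ↔ γ (e x 0) < e x 1)) {x : Plane} (hx : x ∈ frontier D)
    (hxp : x ∈ Metric.ball p ε) : γ (e x 0) = e x 1 := by
  rw [hD.frontier_eq] at hx
  have hball := Metric.isOpen_ball.mem_nhds hxp
  have hc1 : Continuous fun y : Plane => e y 1 := by fun_prop
  have hc0 : Continuous fun y : Plane => γ (e y 0) := by fun_prop
  refine le_antisymm ?_ (not_lt.1 fun hlt => hx.2 ((h x hxp).2 hlt))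
  by_contra! hlt
  have hev : ∀ᶠ y in 𝓝 x, y ∉ D := by
    filter_upwards [hball, hc1.continuousAt.eventually_lt hc0.continuousAt hlt] with y hy hlt'
    rw [h y hy]
    exact hlt'.not_gt
  exact (mem_closure_iff_frequently.1 hx.1) hev

/-- Locally the boundary is contained in the image of an interval under a Lipschitz parametrisation
of a graph, which has finite length; compactness makes this global. Finiteness turns `L²` traces
into integrable sources. -/
lemma boundaryMeasure_univ_lt_top {D : Set Plane} (hD : IsObstacle D) :
    boundaryMeasure D Set.univ < ⊤ := by
  rw [boundaryMeasure, Measure.restrict_apply_univ]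
  have hcomp : IsCompact (frontier D) :=
    Metric.isCompact_of_isClosed_isBounded isClosed_frontier
      (hD.bounded.closure.subset frontier_subset_closure)
  refine hcomp.measure_lt_top_of_nhdsWithin fun p hp => ?_
  obtain ⟨e, K, γ, ε, hγ, hε, h⟩ := hD.lipschitz p hp
  refine ⟨frontier D ∩ Metric.ball p ε,
    inter_mem_nhdsWithin _ (Metric.ball_mem_nhds p hε), ?_⟩
  set G : ℝ → Plane := fun t => e.symm !₂[t, γ t] with hG
  have hGL : LipschitzWith (1 * (1 + K)) G := e.symm.isometry.lipschitz.comp (lipschitzWith_graph hγ)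
  have hsub : frontier D ∩ Metric.ball p ε ⊆ G '' Set.Icc (e p 0 - ε) (e p 0 + ε) := by
    rintro x ⟨hx, hxp⟩
    refine ⟨e x 0, ?_, ?_⟩
    · have h1 := abs_apply_le_norm (e x - e p) 0
      rw [← map_sub, e.norm_map, map_sub, PiLp.sub_apply, ← dist_eq_norm] at h1
      have h2 := abs_le.1 (h1.trans (Metric.mem_ball.1 hxp).le)
      constructor <;> linarith
    · simp only [hG]
      rw [frontier_subset_graph hD.isOpen hγ.continuous h hx hxp, LinearIsometryEquiv.symm_apply_eq]
      ext i
      fin_cases i <;> rfl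
  refine (measure_mono hsub).trans_lt ?_
  refine ((hGL.lipschitzOnWith (s := _)).hausdorffMeasure_image_le zero_le_one).trans_lt ?_
  rw [hausdorffMeasure_real, Real.volume_Icc]
  exact ENNReal.mul_lt_top (by simp) ENNReal.ofReal_lt_top

lemma isFiniteMeasure_boundaryMeasure {D : Set Plane} (hD : IsObstacle D) :
    IsFiniteMeasure (boundaryMeasure D) :=
  ⟨boundaryMeasure_univ_lt_top hD⟩

/-! ### Differences of potentials -/

lemma integrable_potential_integrand {k : ℂ} (hk : k ≠ 0) {μ : Measure Plane} {a : Plane → ℂ}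
    {b : Fin 2 → Plane → ℂ} {K : Set Plane} (hK : IsCompact K) (hs : IsSource μ a b K)
    {x : Plane} (hx : x ∉ K) :
    Integrable (fun y => a y * fundamentalSolution k x y +
      (b 0 y * fderiv ℝ (fundamentalSolution k x) y (EuclideanSpace.single 0 1) +
        b 1 y * fderiv ℝ (fundamentalSolution k x) y (EuclideanSpace.single 1 1))) μ := by
  have hc : ∀ y ∈ K, ContDiffAt ℝ ∞ (fundamentalSolution k x) y := fun y hy =>
    contDiffAt_fundamentalSolution hk fun h => hx (h ▸ hy)
  have hd : ∀ i : Fin 2, ContinuousOn (fun y =>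
      fderiv ℝ (fundamentalSolution k x) y (EuclideanSpace.single i 1)) K := fun i y hy =>
    (((hc y hy).fderiv_right (m := 0) (by simp)).continuousAt.clm_apply
      continuousAt_const).continuousWithinAt
  have i0 := integrable_mul_of_continuousOn (hs.integrable_di 0) hK (hs.di_eq_zero 0) (hd 0)
  have i1 := integrable_mul_of_continuousOn (hs.integrable_di 1) hK (hs.di_eq_zero 1) (hd 1)
  exact (integrable_mul_of_continuousOn hs.integrable_mono hK hs.mono_eq_zero fun y hy =>
    (hc y hy).continuousAt.continuousWithinAt).add (i0.add i1)

lemma IsSource.sub {μ : Measure Plane} {a a' : Plane → ℂ} {b b' : Fin 2 → Plane → ℂ}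
    {K : Set Plane} (h : IsSource μ a b K) (h' : IsSource μ a' b' K) :
    IsSource μ (fun y => a y - a' y) (fun i y => b i y - b' i y) K where
  integrable_mono := h.integrable_mono.sub h'.integrable_mono
  integrable_di i := (h.integrable_di i).sub (h'.integrable_di i)
  mono_eq_zero y hy := by rw [h.mono_eq_zero y hy, h'.mono_eq_zero y hy, sub_zero]
  di_eq_zero i y hy := by rw [h.di_eq_zero i y hy, h'.di_eq_zero i y hy, sub_zero]

lemma IsSource.superset {μ : Measure Plane} {a : Plane → ℂ} {b : Fin 2 → Plane → ℂ}
    {K L : Set Plane} (h : IsSource μ a b K) (hKL : K ⊆ L) : IsSource μ a b L where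
  integrable_mono := h.integrable_mono
  integrable_di := h.integrable_di
  mono_eq_zero y hy := h.mono_eq_zero y fun hyK => hy (hKL hyK)
  di_eq_zero i y hy := h.di_eq_zero i y fun hyK => hy (hKL hyK)

/-- Subtraction is done for sources rather than for outgoing solutions, whose representations may
come with different normal fields and traces. Here both live on the same measure and thickening. -/
lemma IsPotentialAround.sub {k : ℂ} (hk : k ≠ 0) {μ : Measure Plane} {C : Set Plane}
    (hC : IsCompact C) {u u' : Plane → ℂ} (h : IsPotentialAround k μ C u)
    (h' : IsPotentialAround k μ C u') : IsPotentialAround k μ C fun x => u x - u' x := by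
  intro δ hδ
  obtain ⟨a, b, hs, he⟩ := h δ hδ
  obtain ⟨a', b', hs', he'⟩ := h' δ hδ
  refine ⟨_, _, hs.sub hs', fun x hx => ?_⟩
  simp only
  rw [he x hx, he' x hx, potential, potential, potential,
    ← integral_sub (integrable_potential_integrand hk hC.cthickening hs hx)
      (integrable_potential_integrand hk hC.cthickening hs' hx)]
  refine integral_congr_ae (ae_of_all _ fun y => ?_)
  ring

/-! ### Outgoing solutions as potentials -/

lemma exists_cutoff {C : Set Plane} (hC : IsCompact C) {δ : ℝ} (hδ : 0 < δ) :
    ∃ χ : Plane → ℂ, ContDiff ℝ ∞ χ ∧ (∀ y ∈ C, χ y = 1) ∧ ∀ y ∉ Metric.cthickening δ C, χ y = 0 := by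
  obtain ⟨f, h1, h0, -⟩ := exists_contMDiffMap_one_nhds_of_subset_interior
    (modelWithCornersSelf ℝ Plane) (n := (⊤ : ℕ∞)) (s := C) (t := Metric.cthickening δ C) hC.isClosed
    ((Metric.self_subset_thickening hδ C).trans (interior_maximal
      (Metric.thickening_subset_cthickening δ C) Metric.isOpen_thickening))
  refine ⟨fun y => (f y : ℂ), ?_, fun y hy => ?_, fun y hy => ?_⟩
  · exact Complex.ofRealCLM.contDiff.comp f.contMDiff.contDiff
  · simp [h1.self_of_nhdsSet y hy]
  · simp [h0 y hy]

lemma integrableOn_mul_of_hasCompactSupport {S : Set Plane} (hS : MeasurableSet S)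
    {f ψ : Plane → ℂ} (hf : ∀ R : ℝ, IntegrableOn f (S ∩ Metric.ball 0 R)) (hψ : Continuous ψ)
    (hc : HasCompactSupport ψ) : IntegrableOn (fun y => f y * ψ y) S := by
  obtain ⟨B, hB⟩ := hc.exists_bound_of_continuous hψ
  obtain ⟨R, hR⟩ := hc.isCompact.isBounded.subset_ball 0
  have h : IntegrableOn (fun y => f y * ψ y) (S ∩ Metric.ball 0 R) :=
    Integrable.mul_bdd (hf R) hψ.aestronglyMeasurable (ae_of_all _ hB)
  refine h.of_forall_sdiff_eq_zero hS fun y hy => ?_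
  have : ψ y = 0 := by
    by_contra hne
    exact hy.2 ⟨hy.1, hR (subset_tsupport ψ hne)⟩
  rw [this, mul_zero]

lemma norm_apply_le_one_of_isOutwardNormalAt {D : Set Plane} {y n : Plane}
    (h : IsOutwardNormalAt D y n) (i : Fin 2) : ‖((n i : ℝ) : ℂ)‖ ≤ 1 := by
  rw [Complex.norm_real, ← h.1]
  exact abs_apply_le_norm n i

lemma eq_sum_single (v : Plane) :
    v = v 0 • EuclideanSpace.single 0 (1 : ℝ) + v 1 • EuclideanSpace.single 1 (1 : ℝ) := by
  ext i
  fin_cases i <;> simp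

lemma IsExteriorSolution.integrableOn {D : Set Plane} {k : ℂ} {u : Plane → ℂ}
    (hu : IsExteriorSolution D k u) (R : ℝ) :
    IntegrableOn u ((closure D)ᶜ ∩ Metric.ball 0 R) := by
  have : IsFiniteMeasure (volume.restrict ((closure D)ᶜ ∩ Metric.ball (0 : Plane) R)) :=
    isFiniteMeasure_restrict.2 ((measure_mono Set.inter_subset_right).trans_lt
      measure_ball_lt_top).ne
  exact (hu.memLp R).integrable one_le_two

lemma IsExteriorSolution.integrableOn_fderiv {D : Set Plane} {k : ℂ} {u : Plane → ℂ}
    (hu : IsExteriorSolution D k u) (v : Plane) (R : ℝ) :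
    IntegrableOn (fun y => fderiv ℝ u y v) ((closure D)ᶜ ∩ Metric.ball 0 R) := by
  have : IsFiniteMeasure (volume.restrict ((closure D)ᶜ ∩ Metric.ball (0 : Plane) R)) :=
    isFiniteMeasure_restrict.2 ((measure_mono Set.inter_subset_right).trans_lt
      measure_ball_lt_top).ne
  exact (ContinuousLinearMap.apply ℝ ℂ v).integrable_comp
    ((hu.memLp_fderiv R).integrable one_le_two)

lemma contDiff_cutoff_mul_fundamentalSolution {k : ℂ} (hk : k ≠ 0) {K : Set Plane}
    (hK : IsClosed K) {χ : Plane → ℂ} (hχ : ContDiff ℝ ∞ χ) (hχK : ∀ y ∉ K, χ y = 0) {x : Plane}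
    (hx : x ∉ K) : ContDiff ℝ ∞ fun y => χ y * fundamentalSolution k x y := by
  refine contDiff_iff_contDiffAt.2 fun y => ?_
  by_cases hy : y = x
  · refine (contDiffAt_const (c := (0 : ℂ))).congr_of_eventuallyEq ?_
    filter_upwards [hK.isOpen_compl.mem_nhds (hy ▸ hx : y ∉ K)] with z hz
    rw [hχK z hz, zero_mul]
  · exact hχ.contDiffAt.mul (contDiffAt_fundamentalSolution hk hy)

/-- The normal derivative is merely a functional defined by Green's identity, so it is evaluated on
`χ Φ`, where the cutoff `χ` is `1` on the obstacle and zero outside the thickening. The pairing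
becomes a volume integral over a layer, with sources built from `u`, `∇u` and `χ`, and the trace
supplies a dipole layer on the boundary. -/
lemma IsOutgoing.isPotentialAround {D : Set Plane} (hD : IsObstacle D) {k : ℂ} (hk : k ≠ 0)
    {u : Plane → ℂ} (hu : IsOutgoing D k u) :
    IsPotentialAround k (boundaryMeasure D + volume.restrict (closure D)ᶜ) (closure D) u := by
  obtain ⟨hsol, ν, g, h, hν, hg, hh, hrep⟩ := hu
  have hfin := isFiniteMeasure_boundaryMeasure hD
  have hC : IsCompact (closure D) :=
    Metric.isCompact_of_isClosed_isBounded isClosed_closure hD.bounded.closure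
  have hS : MeasurableSet (closure D)ᶜ := isClosed_closure.measurableSet.compl
  intro δ hδ
  obtain ⟨χ, hχ, hχ1, hχ0⟩ := exists_cutoff hC hδ
  set K := Metric.cthickening δ (closure D) with hKdef
  have hK : IsCompact K := hC.cthickening
  have hDK : closure D ⊆ K := Metric.self_subset_cthickening _
  set e : Fin 2 → Plane := fun i => EuclideanSpace.single i 1 with he
  have hχc : HasCompactSupport χ := HasCompactSupport.intro hK hχ0
  have hdχ0 : ∀ y ∉ K, fderiv ℝ χ y = 0 := by
    intro y hy
    have : χ =ᶠ[𝓝 y] fun _ => 0 := by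
      filter_upwards [hK.isClosed.isOpen_compl.mem_nhds hy] with z hz using hχ0 z hz
    rw [this.fderiv_eq, fderiv_fun_const, Pi.zero_apply]
  have hdχ : ∀ i, Continuous fun y => fderiv ℝ χ y (e i) := fun i =>
    (hχ.continuous_fderiv (by simp)).clm_apply continuous_const
  have hdχc : ∀ i, HasCompactSupport fun y => fderiv ℝ χ y (e i) := fun i =>
    HasCompactSupport.intro hK fun y hy => by rw [hdχ0 y hy]; rfl
  classical
  -- The product rule splits `∇u · ∇(χ Φ)` into a multiple of `Φ` and a multiple of `∇Φ`; the first,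
  -- with the term in `k²`, is the monopole density, the second the dipole density.
  set a₀ : Plane → ℂ := fun y => fderiv ℝ u y (e 0) * fderiv ℝ χ y (e 0) +
    fderiv ℝ u y (e 1) * fderiv ℝ χ y (e 1) - k ^ 2 * (u y * χ y) with ha₀
  set b₀ : Fin 2 → Plane → ℂ := fun i y => fderiv ℝ u y (e i) * χ y with hb₀
  -- The boundary measure is carried by `closure D` and the volume measure by its complement, so a
  -- case distinction encodes both kinds of sources for the sum of the measures.
  set a : Plane → ℂ := fun y => if y ∈ closure D then 0 else a₀ y with ha
  set b : Fin 2 → Plane → ℂ := fun i y => if y ∈ closure D then g y * (ν y i : ℂ) else b₀ i y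
    with hb
  have hae_bd : ∀ᵐ y ∂boundaryMeasure D, y ∈ closure D :=
    (ae_restrict_mem isClosed_frontier.measurableSet).mono fun y hy => frontier_subset_closure hy
  have hae_ext : ∀ᵐ y ∂volume.restrict (closure D)ᶜ, y ∉ closure D := ae_restrict_mem hS
  have ha_bd : a =ᵐ[boundaryMeasure D] fun _ => 0 := hae_bd.mono fun y hy => if_pos hy
  have hb_bd : ∀ i, b i =ᵐ[boundaryMeasure D] fun y => g y * (ν y i : ℂ) := fun i =>
    hae_bd.mono fun y hy => if_pos hy
  have ha_ext : a =ᵐ[volume.restrict (closure D)ᶜ] a₀ := hae_ext.mono fun y hy => if_neg hy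
  have hb_ext : ∀ i, b i =ᵐ[volume.restrict (closure D)ᶜ] b₀ i := fun i =>
    hae_ext.mono fun y hy => if_neg hy
  have hgint : ∀ i, Integrable (fun y => g y * (ν y i : ℂ)) (boundaryMeasure D) := fun i => by
    have hm : Measurable fun y => ((ν y i : ℝ) : ℂ) :=
      Complex.measurable_ofReal.comp ((by fun_prop : Continuous fun v : Plane => v i).measurable.comp
        hν.1)
    exact (hg.1.integrable one_le_two).mul_bdd (c := 1) hm.aestronglyMeasurable
      (hν.2.mono fun y hy => norm_apply_le_one_of_isOutwardNormalAt hy i)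
  have ha₀int : IntegrableOn a₀ (closure D)ᶜ :=
    ((integrableOn_mul_of_hasCompactSupport hS (hsol.integrableOn_fderiv _) (hdχ 0) (hdχc 0)).add
      (integrableOn_mul_of_hasCompactSupport hS (hsol.integrableOn_fderiv _) (hdχ 1) (hdχc 1))).sub
      ((integrableOn_mul_of_hasCompactSupport hS hsol.integrableOn hχ.continuous hχc).const_mul _)
  have hb₀int : ∀ i, IntegrableOn (b₀ i) (closure D)ᶜ := fun i =>
    integrableOn_mul_of_hasCompactSupport hS (hsol.integrableOn_fderiv _) hχ.continuous hχc
  have hs : IsSource (boundaryMeasure D + volume.restrict (closure D)ᶜ) a b K := by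
    refine ⟨?_, fun i => ?_, fun y hy => ?_, fun i y hy => ?_⟩
    · exact integrable_add_measure.2
        ⟨(integrable_zero _ _ _).congr ha_bd.symm, ha₀int.congr ha_ext.symm⟩
    · exact integrable_add_measure.2
        ⟨(hgint i).congr (hb_bd i).symm, (hb₀int i).congr (hb_ext i).symm⟩
    · simp only [ha, ha₀, if_neg (fun h => hy (hDK h)), hdχ0 y hy, hχ0 y hy]
      simp
    · simp only [hb, hb₀, if_neg (fun h => hy (hDK h)), hχ0 y hy, mul_zero]
  refine ⟨a, b, hs, fun x hx => ?_⟩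
  set Φ := fundamentalSolution k x with hΦ
  have hint := integrable_add_measure.1 (integrable_potential_integrand hk hK hs hx)
  have htest : IsTestFunction fun y => χ y * Φ y :=
    ⟨contDiff_cutoff_mul_fundamentalSolution hk hK.isClosed hχ hχ0 hx, hχc.mul_right⟩
  have hbdry : (fun y : frontier D => Φ y) = fun y : frontier D => χ y * Φ y := by
    ext y
    rw [hχ1 y (frontier_subset_closure y.2), one_mul]
  rw [hrep x fun h => hx (hDK h), hbdry, hh _ htest, sub_neg_eq_add, potential,
    integral_add_measure hint.1 hint.2]
  congr 1
  · refine integral_congr_ae ?_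
    filter_upwards [ha_bd, hb_bd 0, hb_bd 1] with y h1 h2 h3
    rw [h1, h2, h3]
    conv_lhs => rw [eq_sum_single (ν y)]
    simp only [map_add, map_smul, Complex.real_smul]
    ring
  · refine integral_congr_ae ?_
    filter_upwards [ha_ext, hb_ext 0, hb_ext 1] with y h1 h2 h3
    rw [h1, h2, h3, gradDot, Fin.sum_univ_two]
    by_cases hy : y ∈ K
    · have hΦd : DifferentiableAt ℝ Φ y := (contDiffAt_fundamentalSolution hk
        fun (h : y = x) => hx (h ▸ hy)).differentiableAt (by simp)
      have hχd : DifferentiableAt ℝ χ y := hχ.contDiffAt.differentiableAt (by simp)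
      rw [fderiv_fun_mul hχd hΦd]
      simp only [ha₀, hb₀, he, add_apply, smul_apply, smul_eq_mul]
      ring
    · have h0 : (fun z => χ z * Φ z) =ᶠ[𝓝 y] fun _ => 0 := by
        filter_upwards [hK.isClosed.isOpen_compl.mem_nhds hy] with z hz
        rw [hχ0 z hz, zero_mul]
      rw [h0.fderiv_eq]
      simp [ha₀, hb₀, hdχ0 y hy, hχ0 y hy]

/-! ### Outgoing solutions and their far-field patterns -/

lemma IsPotentialAround.exists_source {k : ℂ} {μ : Measure Plane} {C : Set Plane}
    (hC : IsCompact C) {u : Plane → ℂ} (hu : IsPotentialAround k μ C u) :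
    ∃ (R₀ : ℝ) (a : Plane → ℂ) (b : Fin 2 → Plane → ℂ), 0 ≤ R₀ ∧
      IsSource μ a b (Metric.closedBall 0 R₀) ∧ ∀ x, R₀ < ‖x‖ → u x = potential k μ a b x := by
  -- For the far field any single thickening is enough; arbitrarily small ones matter only for
  -- unique continuation.
  obtain ⟨a, b, hs, he⟩ := hu 1 one_pos
  obtain ⟨R, hR⟩ := (hC.cthickening (r := 1)).isBounded.subset_closedBall 0
  have hR' : Metric.cthickening 1 C ⊆ Metric.closedBall 0 |R| :=
    hR.trans (Metric.closedBall_subset_closedBall (le_abs_self R))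
  refine ⟨|R|, a, b, abs_nonneg R, hs.superset hR', fun x hx => he x fun hxK => ?_⟩
  exact (mem_closedBall_zero_iff.1 (hR' hxK)).not_gt hx

lemma IsPotentialAround.exists_isFarField {k : ℂ} (hk : k ∈ Complex.slitPlane) {μ : Measure Plane}
    [SFinite μ] {C : Set Plane} (hC : IsCompact C) {u : Plane → ℂ}
    (hu : IsPotentialAround k μ C u) : ∃ w, IsFarField k u w := by
  obtain ⟨R₀, a, b, hR₀, hs, he⟩ := hu.exists_source hC
  exact ⟨_, isFarField_of_eq_potential hk hR₀ hs he⟩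

lemma IsPotentialAround.eq_zero_of_isFarField {k : ℂ} (hk : k ∈ Complex.slitPlane)
    {μ : Measure Plane} [SFinite μ] {C : Set Plane} (hC : IsCompact C) (hconn : IsPreconnected Cᶜ)
    {u : Plane → ℂ} (hu : IsPotentialAround k μ C u) {w : Metric.sphere (0 : Plane) 1 → ℂ}
    (hw : IsFarField k u w) {V : Set (Metric.sphere (0 : Plane) 1)} (hV : IsOpen V)
    (hVn : V.Nonempty) (h : ∀ θ ∈ V, w θ = 0) : ∀ x ∈ Cᶜ, u x = 0 := by
  obtain ⟨R₀, a, b, hR₀, hs, he⟩ := hu.exists_source hC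
  have hweq := hw.unique (isFarField_of_eq_potential hk hR₀ hs he)
  subst hweq
  obtain ⟨R₁, hR₁⟩ := exists_potential_eq_zero hk hR₀ hs hV hVn h
  refine hu.eq_zero (Complex.slitPlane_ne_zero hk) hC hconn (R := max R₁ (R₀ + 1)) fun x hx => ?_
  rw [he x (by linarith [(le_max_right R₁ (R₀ + 1)).trans hx]),
    hR₁ x ((le_max_left _ _).trans hx)]

lemma IsFarField.sub {k : ℂ} {u u' : Plane → ℂ} {w w' : Metric.sphere (0 : Plane) 1 → ℂ}
    (h : IsFarField k u w) (h' : IsFarField k u' w') :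
    IsFarField k (fun x => u x - u' x) fun θ => w θ - w' θ := by
  obtain ⟨C, R, hR, h⟩ := h
  obtain ⟨C', R', -, h'⟩ := h'
  refine ⟨C + C', max R R', lt_max_of_lt_left hR, fun r hr θ => ?_⟩
  obtain ⟨ρ, hρ, e⟩ := h r ((le_max_left _ _).trans hr) θ
  obtain ⟨ρ', hρ', e'⟩ := h' r ((le_max_right _ _).trans hr) θ
  refine ⟨ρ - ρ', ?_, ?_⟩
  · rw [add_div]
    exact (norm_sub_le _ _).trans (add_le_add hρ hρ')
  · simp only [e, e']
    ring

end ExteriorHelmholtz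

end

/-! ### Far-field patterns of outgoing solutions -/

theorem mainTheorem1
    (D : Set ExteriorHelmholtz.Plane) (hD : ExteriorHelmholtz.IsObstacle D)
    (k : ℂ) (hk : ∀ t : ℝ, t ≤ 0 → k ≠ (t : ℂ)) :
    -- every outgoing solution has exactly one far-field pattern
    (∀ u : ExteriorHelmholtz.Plane → ℂ, ExteriorHelmholtz.IsOutgoing D k u →
      ∃! w : Metric.sphere (0 : ExteriorHelmholtz.Plane) 1 → ℂ,
        ExteriorHelmholtz.IsFarField k u w) ∧
    -- if the far-field pattern vanishes on an open part of the circle, the solution vanishes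
    (∀ (u : ExteriorHelmholtz.Plane → ℂ)
      (w : Metric.sphere (0 : ExteriorHelmholtz.Plane) 1 → ℂ)
      (V : Set (Metric.sphere (0 : ExteriorHelmholtz.Plane) 1)),
      ExteriorHelmholtz.IsOutgoing D k u → ExteriorHelmholtz.IsFarField k u w →
      IsOpen V → V.Nonempty → (∀ θ ∈ V, w θ = 0) →
      ∀ x ∈ (closure D)ᶜ, u x = 0) ∧
    -- the far-field pattern determines the outgoing solution
    (∀ (u₁ u₂ : ExteriorHelmholtz.Plane → ℂ)
      (w : Metric.sphere (0 : ExteriorHelmholtz.Plane) 1 → ℂ),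
      ExteriorHelmholtz.IsOutgoing D k u₁ → ExteriorHelmholtz.IsOutgoing D k u₂ →
      ExteriorHelmholtz.IsFarField k u₁ w → ExteriorHelmholtz.IsFarField k u₂ w →
      ∀ x ∈ (closure D)ᶜ, u₁ x = u₂ x) := by

  -- Avoiding the nonpositive reals is exactly the domain of the principal branches used for `log k`
  -- and `√k`.
  have hk' : k ∈ Complex.slitPlane := by
    rw [Complex.mem_slitPlane_iff]
    by_contra! h
    exact hk k.re h.1 (Complex.ext rfl h.2)
  have hk0 : k ≠ 0 := Complex.slitPlane_ne_zero hk'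
  have hC : IsCompact (closure D) :=
    Metric.isCompact_of_isClosed_isBounded isClosed_closure hD.bounded.closure
  have hconn := hD.connected_exterior.isPreconnected
  have := ExteriorHelmholtz.isFiniteMeasure_boundaryMeasure hD
  refine ⟨fun u hu => ?_, fun u w V hu hw hV hVn h => ?_, fun u₁ u₂ w hu₁ hu₂ hw₁ hw₂ => ?_⟩
  · obtain ⟨w, hw⟩ := (hu.isPotentialAround hD hk0).exists_isFarField hk' hC
    exact ⟨w, hw, fun w' hw' => hw'.unique hw⟩
  · exact (hu.isPotentialAround hD hk0).eq_zero_of_isFarField hk' hC hconn hw hV hVn h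
  -- The difference is again a potential around the obstacle, and its pattern `w - w` vanishes on
  -- the whole circle.
  · have hu := (hu₁.isPotentialAround hD hk0).sub hk0 hC (hu₂.isPotentialAround hD hk0)
    have hne : (Set.univ : Set (Metric.sphere (0 : ExteriorHelmholtz.Plane) 1)).Nonempty :=
      ⟨ExteriorHelmholtz.circlePoint 0, trivial⟩
    intro x hx
    exact sub_eq_zero.1 (hu.eq_zero_of_isFarField hk' hC hconn (hw₁.sub hw₂) isOpen_univ hne
      (fun θ _ => sub_self _) x hx)
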